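/- **Setting.** Let $E$ be a Polish space and $B(E)$ the space of bounded measurable functions $E\to\mathbb C$ with the supremum norm. Let $X=(X_t)_{t\ge0}$ be a branching Markov process on $E$: particles move independently as a Markov process $\xi$ in $E\cup\{\dagger\}$ ($\dagger$ absorbing; particles in $\dagger$ are not counted); a particle at $y\in E$ branches at rate $\gamma(y)\ge 0$, where $\gamma$ is bounded and measurable, and is then replaced by a random number $N\in\{0,1,2,\dots\}$ of particles at $x_1,\dots,x_N\in E$, whose joint law is $\mathcal P_y$ (expectation $\mathcal E_y$). $X_t$ is the sum of the unit masses at the particles in $E$ at time $t$, and $\mathbb E_{\delta_x}$ is the expectation for one initial particle at $x$. Put $\psi_t[f](x)=\mathbb E_{\delta_x}[X_t[f]]$ and, for $\boldsymbol f\in B(E)^\ell$, $\psi^{(\ell)}_t[\boldsymbol f](x)=\mathbb E_{\delta_x}\big[\prod_{i=1}^{\ell}X_t[f_i]\big]$, with $X_t[f]=\int f\,dX_t$. For a finite set $A$ and functions $g(B,\cdot)$ on $E$, $B\subseteq A$, let $$\zeta_A[g](x)=\mathcal E_x\Big[\sum_{\sigma}\sum_{\boldsymbol i}\prod_{j=1}^{|\sigma|}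 g(\sigma_j,x_{i_j})\Big],$$ where $\sigma$ runs over the partitions of $A$ other than $\{A\}$, with blocks $\sigma_1,\dots,\sigma_{|\sigma|}$, and $\boldsymbol i$ over the $|\sigma|$-tuples of distinct elements of $\{1,\dots,N\}$. **Assumption (H1).** There are $m\ge1$, distinct $\lambda_1,\dots,\lambda_m\in\mathbb C$ with $\lambda_1$ real, $\lambda_1>0$ and $\lambda_1>\mathrm{Re}\,\lambda_2\ge\dots\ge\mathrm{Re}\,\lambda_m$, integers $p_i\ge1$ and $k_{i,j}\ge1$ ($1\le i\le m$, $1\le j\le p_i$), functions $\varphi_{i,j}^{(k)}\in B(E)$ and bounded linear functionals $\tilde\varphi_{i,j}^{(k)}:B(E)\to\mathbb C$ ($1\le k\le k_{i,j}$) with $\tilde\varphi_{i,j}^{(k)}[\varphi_{l,n}^{(q)}]=1$ if $(i,j,k)=(l,n,q)$ and $0$ otherwise, and a linear operator $\mathcal N$ on $B(E)$ such that: $\mathcal N\varphi_{i,1}^{(k)}=0$; for $2\le j\le p_i$, $\mathcal N\varphi_{i,j}^{(k)}=\varphi_{i,j-1}^{(k^*)}$ for some $k^*=k^*(i,j,k)\in\{1,\dots,k_{i,j-1}\}$,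 injective in $k$; $\mathcal Nf=0$ if all $\tilde\varphi_{i,j}^{(k)}[f]$ vanish; for all $t\ge0$ and $f\in B(E)$, $$\psi_t[\varphi_{i,j}^{(k)}]=e^{(\lambda_i+\mathcal N)t}\varphi_{i,j}^{(k)},\qquad \tilde\varphi_{i,j}^{(k)}[\psi_t[f]]=e^{\lambda_it}\,\tilde\varphi_{i,j}^{(k)}[e^{\mathcal Nt}f];$$ and, with $\Phi_{i,j}[f]=\sum_{k=1}^{k_{i,j}}\tilde\varphi_{i,j}^{(k)}[f]\varphi_{i,j}^{(k)}$ and $\Phi_i=\sum_{j=1}^{p_i}\Phi_{i,j}$, $$\sup_{x\in E,\ \|f\|\le1}e^{-\mathrm{Re}\,\lambda_m t}\Big|\psi_t[f](x)-\sum_{i=1}^m e^{(\lambda_i+\mathcal N)t}\Phi_i[f](x)\Big|\to0\qquad(t\to\infty).$$ **Notation.** Let $\mathrm{Ei}^*(\lambda_i)$ be the set of $f\in B(E)$ with $\Phi_{i,j}[f]\ne0$ for some $j$, and $\mathrm{Ei}(\lambda_i)$ the set of $f\in\mathrm{Ei}^*(\lambda_i)$ that lie in no $\mathrm{Ei}^*(\lambda_j)$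 with $\mathrm{Re}\,\lambda_j\ge\mathrm{Re}\,\lambda_i$, $\lambda_j\neq\lambda_i$. Let $\mathrm{Ei}(\Lambda_C)$ be the union of the $\mathrm{Ei}(\lambda_i)$ over all $i$ with $2\,\mathrm{Re}\,\lambda_i=\lambda_1$, and $\mathrm{Ei}_1(\Lambda_C)$ the set of its elements of norm at most $1$. For $f\in \mathrm{Ei}(\Lambda_C)$ let $\nu(f)$ be the unique index with $f\in\mathrm{Ei}(\lambda_{\nu(f)})$, $\lambda(f)=\lambda_{\nu(f)}$, $p(f)=\max\{i\ge1:\mathcal N^{i-1}f\ne0\}$ and $f^*=\mathcal N^{p(f)-1}f$. For $\boldsymbol f\in\mathrm{Ei}(\Lambda_C)^\ell$ and $A\subseteq\{1,\dots,\ell\}$ let $\tilde p_A(\boldsymbol f)=\sum_{i\in A}p(f_i)$ and $\tilde p(\boldsymbol f)=\tilde p_{\{1,\dots,\ell\}}(\boldsymbol f)$; call $A$ *conjugate* if $A$ splits into pairs $\{i,j\}$ with $\lambda(f_i)=\overline{\lambda(f_j)}$. Define $L_A[\boldsymbol f]$ recursively: if $A=\{a,b\}$, $a\ne b$, is conjugate,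 $$L_A[\boldsymbol f](x)=\frac{(\tilde p_A(\boldsymbol f)-2)!}{(p(f_a)-1)!\,(p(f_b)-1)!\,(p_1+\tilde p_A(\boldsymbol f)-2)!}\;\Phi_{1,1}\big[\mathcal N^{p_1-1}\big(\gamma\,\zeta_A[g]\big)\big](x),\qquad g(\{i\},\cdot)=\Phi_{\nu(f_i),1}[f_i^*]\quad(i\in A);$$ if $|A|\ge4$ is even and $A$ is conjugate, $$L_A[\boldsymbol f](x)=\int_0^\infty e^{-\lambda_1|A|s/2}\,\psi_s\big[\gamma\,\zeta_A[L_\cdot[\boldsymbol f]]\big](x)\,ds;$$ and $L_A[\boldsymbol f]=0$ otherwise. **Theorem.** Assume (H1) and, for some $k\ge2$, $\sup_{x\in E}\mathcal E_x[N^k]<\infty$. Let $1\le\ell\le k$. Then $X$ does not explode, the moments $\psi_t^{(\ell)}[\boldsymbol f](x)$, $\boldsymbol f\in B(E)^\ell$, and the integrals over $s$ above converge absolutely, and with $$\Delta_{\ell,t}=\sup_{x\in E,\ \boldsymbol f\in\mathrm{Ei}_1(\Lambda_C)^\ell}\Big|e^{-\ell\lambda_1t/2}(1+t)^{-\left(\tilde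 p(\boldsymbol f)+\ell(p_1-2)/2\right)}\psi_t^{(\ell)}[\boldsymbol f](x)-L_{\{1,\dots,\ell\}}[\boldsymbol f](x)\Big|$$ we have $\displaystyle\sup_{t\ge0}\Delta_{\ell,t}<\infty$ and $\displaystyle\lim_{t\to\infty}\Delta_{\ell,t}=0$. -/

import Mathlib

open MeasureTheory ProbabilityTheory Filter Topology
open scoped ENNReal ComplexConjugate

universe u v

noncomputable section

namespace BMP

/-! ### The branching Markov process -/

/-- A Markov process `(ξ, P)` on `E ∪ {†}`. The cemetery state `†` is `Sum.inr ()`. Under `P x` the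
process starts at `x`; only the times `t ≥ 0` matter. Joint measurability in time and chance is the
only path regularity, so that the branching rate can be integrated along paths. -/
structure Motion (E : Type u) [MeasurableSpace E] where
  Ω : Type v
  [mΩ : MeasurableSpace Ω]
  ξ : ℝ → Ω → E ⊕ Unit
  P : Kernel E Ω
  [isMarkovKernel : IsMarkovKernel P]
  measurable_ξ : Measurable (fun p : ℝ × Ω => ξ p.1 p.2)
  start : ∀ x, ∀ᵐ ω ∂P x, ξ 0 ω = Sum.inl x
  /-- The Markov property at time `t`, for every event `A` of the past `σ(ξ_r : 0 ≤ r ≤ t)`.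
  The case `B = E`, `A = {ξ_t = †}` says that `†` is absorbing. -/
  markov : ∀ (x : E) (s t : ℝ), 0 ≤ s → 0 ≤ t → ∀ A : Set Ω,
    MeasurableSet[⨆ r ∈ Set.Icc (0 : ℝ) t, MeasurableSpace.comap (ξ r) inferInstance] A →
    ∀ B : Set E, MeasurableSet B →
      P x (A ∩ {ω | ξ (t + s) ω ∈ Sum.inl '' B}) =
        ∫⁻ ω in A, Sum.elim (fun y => P y {ω' | ξ s ω' ∈ Sum.inl '' B}) (fun _ => 0) (ξ t ω) ∂P x

attribute [instance] Motion.mΩ Motion.isMarkovKernel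

/-- The data `(P, γ, 𝒫)` of a branching Markov process: the motion, the bounded branching rate `γ`,
and for each `y` the law `𝒫_y` of the number `N` of offspring and of their positions
`x_1, …, x_N`, a random point `⟨N, (x_1, …, x_N)⟩`. -/
structure Data (E : Type u) [MeasurableSpace E] extends Motion.{u, v} E where
  γ : E → ℝ
  measurable_γ : Measurable γ
  γ_nonneg : ∀ y, 0 ≤ γ y
  γ_bounded : ∃ C, ∀ y, γ y ≤ C
  offspring : Kernel E (Σ n : ℕ, (Fin n → E))
  [isMarkovKernel_offspring : IsMarkovKernel offspring]

attribute [instance] Data.isMarkovKernel_offspring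

variable {E : Type u} [MeasurableSpace E]

/-- The configuration of one particle: the unit mass at `y ∈ E`, and nothing for a particle in `†`. -/
def pointMass : E ⊕ Unit → Measure E := Sum.elim Measure.dirac (fun _ => 0)

namespace Data

variable (X : Data.{u, v} E)

/-- The branching rate along the motion; there is no branching at `†`. -/
def rate : E ⊕ Unit → ℝ := Sum.elim X.γ (fun _ => 0)

/-- The integrated branching rate `∫_0^t γ(ξ_r) dr`. A particle that follows the path `ω` has not
branched by age `t` with probability `exp (- hazard t ω)`, and branches at age `ds` with probability
`γ(ξ_s) exp (- hazard s ω) ds`. -/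
def hazard (t : ℝ) (ω : X.Ω) : ℝ := ∫ r in (0 : ℝ)..t, X.rate (X.ξ r ω)

/-- The law of the population that descends from a branching event at `z`, if a single particle
started from `y` evolves into a population with law `q y`: the offspring `(x_1, …, x_N)` have
law `𝒫_z`, and given their positions their populations are independent and are superposed. -/
def branch (q : E → Measure (Measure E)) : E ⊕ Unit → Measure (Measure E) :=
  Sum.elim
    (fun z => (X.offspring z).bind fun c =>
      (Measure.pi fun i => q (c.2 i)).map (fun ν => ∑ i, ν i))
    (fun _ => 0)

/-- `lawGen n t x` is the law of `X_t` under `ℙ_{δ_x}`, restricted to the event that fewer than `n`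
generations of particles (the initial one included) are born by time `t`. The initial particle
moves along `ξ` under `P x`. Either it has not branched by time `t`, and then `X_t` is the point
mass at `ξ_t`; or it branched at some time `s ≤ t`, and then each child starts, independently of all
others, the same dynamics at its place of birth and has the time `t - s` left. (All families of measures
that are mixed by `bind` here depend measurably on their parameter.) -/
def lawGen : ℕ → ℝ → E → Measure (Measure E)
  | 0, _, _ => 0
  | n + 1, t, x => (X.P x).bind fun ω =>
      ENNReal.ofReal (Real.exp (-X.hazard t ω)) • Measure.dirac (pointMass (X.ξ t ω)) +
      (volume.restrict (Set.Ioc 0 t)).bind fun s =>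
        ENNReal.ofReal (X.rate (X.ξ s ω) * Real.exp (-X.hazard s ω)) •
          X.branch (fun y => lawGen n (t - s) y) (X.ξ s ω)

/-- The law of the random finite measure `X_t` on `E` under `ℙ_{δ_x}`: the increasing limit of the
laws of `X_t` on the events that finitely many generations are born by time `t`. -/
def law (t : ℝ) (x : E) : Measure (Measure E) := ⨆ n, X.lawGen n t x

/-- The expectation semigroup `ψ_t[f](x) = 𝔼_{δ_x}[X_t[f]]`. -/
def ψ (t : ℝ) (f : E → ℂ) (x : E) : ℂ := ∫ μ, (∫ y, f y ∂μ) ∂(X.law t x)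

/-- The product moments `ψ_t^{(ℓ)}[f](x) = 𝔼_{δ_x}[X_t[f_1] ⋯ X_t[f_ℓ]]`. -/
def ψProd {ℓ : ℕ} (t : ℝ) (f : Fin ℓ → E → ℂ) (x : E) : ℂ :=
  ∫ μ, (∏ i, ∫ y, f i y ∂μ) ∂(X.law t x)

open Classical in
/-- The operator `ζ_A[g](x) = 𝓔_x[∑_σ ∑_i ∏_j g(σ_j, x_{i_j})]`, where `σ` runs over the partitions of
`A` other than `{A}` and `i` over the injections from the blocks of `σ` to the offspring. -/
def ζ {ι : Type*} (A : Finset ι) (g : Finset ι → E → ℂ) (x : E) : ℂ :=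
  ∫ c, (∑ σ ∈ (Finset.univ : Finset (Finpartition A)).filter (fun σ => σ.parts ≠ {A}),
    ∑ i : {B // B ∈ σ.parts} ↪ Fin c.1, ∏ B : {B // B ∈ σ.parts}, g B (c.2 (i B)))
    ∂(X.offspring x)

end Data

/-! ### The spectral assumption -/

/-- `B(E)`: bounded measurable complex-valued functions on `E`. -/
def BddFun (E : Type u) [MeasurableSpace E] : Submodule ℂ (E → ℂ) where
  carrier := {f | Measurable f ∧ ∃ C : ℝ, ∀ x, ‖f x‖ ≤ C}
  add_mem' := by
    rintro f g ⟨hf, C, hC⟩ ⟨hg, C', hC'⟩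
    exact ⟨hf.add hg, C + C', fun x => (norm_add_le _ _).trans (add_le_add (hC x) (hC' x))⟩
  zero_mem' := ⟨measurable_const, 0, fun x => by simp⟩
  smul_mem' := by
    rintro c f ⟨hf, C, hC⟩
    refine ⟨hf.const_smul c, ‖c‖ * C, fun x => ?_⟩
    simpa using mul_le_mul_of_nonneg_left (hC x) (norm_nonneg c)

open Classical in
/-- A function on `E` as an element of `B(E)`; used only for functions that are in `B(E)`
(the value `0` for other functions is never relevant). -/
def toBdd (f : E → ℂ) : BddFun E := if h : f ∈ BddFun E then ⟨f, h⟩ else 0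

/-- The spectral data. The eigenvalue `λ_i` is `eig (i - 1)`, so `λ_1 = eig 0`; the other indices
are those of the mathematics: `φ i j k` and `φ' i j k` (for `φ̃`) are
meaningful only for `1 ≤ j ≤ p i` and `1 ≤ k ≤ mult i j`. -/
structure Spectrum (E : Type u) [MeasurableSpace E] where
  m : ℕ
  [m_ne_zero : NeZero m]
  eig : Fin m → ℂ
  p : Fin m → ℕ
  mult : Fin m → ℕ → ℕ
  φ : Fin m → ℕ → ℕ → BddFun E
  φ' : Fin m → ℕ → ℕ → (BddFun E →ₗ[ℂ] ℂ)
  nil : Module.End ℂ (BddFun E)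

attribute [instance] Spectrum.m_ne_zero

namespace Spectrum

variable (D : Spectrum E)

/-- The real number `λ_1`. -/
def lam1 : ℝ := (D.eig 0).re

/-- The number `p_1`. -/
def p1 : ℕ := D.p 0

/-- The admissible index triples `(i, j, k)`. -/
def Idx (i : Fin D.m) (j k : ℕ) : Prop := 1 ≤ j ∧ j ≤ D.p i ∧ 1 ≤ k ∧ k ≤ D.mult i j

/-- `e^{t 𝒩}`, a finite sum since `𝒩` is nilpotent. -/
def expNil (t : ℝ) : Module.End ℂ (BddFun E) := IsNilpotent.exp ((t : ℂ) • D.nil)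

/-- `Φ_{i,j}[f] = ∑_k φ̃_{i,j}^{(k)}[f] φ_{i,j}^{(k)}`. -/
def Φ₂ (i : Fin D.m) (j : ℕ) (f : BddFun E) : BddFun E :=
  ∑ k ∈ Finset.Icc 1 (D.mult i j), D.φ' i j k f • D.φ i j k

/-- `Φ_i[f] = ∑_j Φ_{i,j}[f]`. -/
def Φ (i : Fin D.m) (f : BddFun E) : BddFun E := ∑ j ∈ Finset.Icc 1 (D.p i), D.Φ₂ i j f

/-- Assumption (H1) on the branching Markov process `X`. -/
structure H1 (X : Data.{u, v} E) : Prop where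
  p_pos : ∀ i, 1 ≤ D.p i
  mult_pos : ∀ i j, 1 ≤ j → j ≤ D.p i → 1 ≤ D.mult i j
  eig_injective : Function.Injective D.eig
  lam1_real : (D.eig 0).im = 0
  lam1_pos : 0 < D.lam1
  re_lt : ∀ i, i ≠ 0 → (D.eig i).re < D.lam1
  re_anti : ∀ i i', i ≤ i' → (D.eig i').re ≤ (D.eig i).re
  bounded : ∀ i j k, D.Idx i j k →
    ∃ C : ℝ, ∀ f : BddFun E, (∀ x, ‖f.1 x‖ ≤ 1) → ‖D.φ' i j k f‖ ≤ C
  dual_self : ∀ i j k, D.Idx i j k → D.φ' i j k (D.φ i j k) = 1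
  dual_ne : ∀ i j k l n q, D.Idx i j k → D.Idx l n q → (i, j, k) ≠ (l, n, q) →
    D.φ' i j k (D.φ l n q) = 0
  nil_one : ∀ i k, D.Idx i 1 k → D.nil (D.φ i 1 k) = 0
  nil_succ : ∀ i j, 2 ≤ j → j ≤ D.p i → ∃ kstar : ℕ → ℕ,
    Set.InjOn kstar (Set.Icc 1 (D.mult i j)) ∧
    ∀ k, 1 ≤ k → k ≤ D.mult i j →
      1 ≤ kstar k ∧ kstar k ≤ D.mult i (j - 1) ∧ D.nil (D.φ i j k) = D.φ i (j - 1) (kstar k)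
  nil_ker : ∀ f : BddFun E, (∀ i j k, D.Idx i j k → D.φ' i j k f = 0) → D.nil f = 0
  right_eigen : ∀ i j k, D.Idx i j k → ∀ t : ℝ, 0 ≤ t → ∀ x,
    X.ψ t (D.φ i j k).1 x = Complex.exp (D.eig i * t) * (D.expNil t (D.φ i j k)).1 x
  left_eigen : ∀ i j k, D.Idx i j k → ∀ t : ℝ, 0 ≤ t → ∀ f : BddFun E,
    D.φ' i j k (toBdd (X.ψ t f.1)) = Complex.exp (D.eig i * t) * D.φ' i j k (D.expNil t f)
  /-- `sup_{x, f} e^{- Re λ_m t} |ψ_t[f](x) - ∑_i e^{(λ_i + 𝒩) t} Φ_i[f](x)| → 0`, the supremum over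
  `x ∈ E` and `f ∈ B(E)` bounded by one; all `Re λ_i` are at least `Re λ_m`. -/
  asymptotics : ∀ last : Fin D.m, (∀ i, i ≤ last) →
    Tendsto (fun t : ℝ => ⨆ (x : E) (f : BddFun E) (_ : ∀ y, ‖f.1 y‖ ≤ 1),
      ‖(Real.exp (-(D.eig last).re * t) : ℂ) *
        (X.ψ t f.1 x - ∑ i, Complex.exp (D.eig i * t) * (D.expNil t (D.Φ i f)).1 x)‖ₑ)
      atTop (𝓝 0)

/-! ### Eigenspaces and the critical regime -/

/-- `Ei*(λ_i)`: the functions with a component in the generalised eigenspace of `λ_i`. -/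
def EiStar (i : Fin D.m) : Set (BddFun E) := {f | ∃ j, 1 ≤ j ∧ j ≤ D.p i ∧ D.Φ₂ i j f ≠ 0}

/-- `Ei(λ_i)`: the functions in `Ei*(λ_i)` with no component for another eigenvalue `λ_j` with
`Re λ_j ≥ Re λ_i`. For `λ_1` there is no such `λ_j`, so that `Ei(λ_1) = Ei*(λ_1)`. -/
def Ei (i : Fin D.m) : Set (BddFun E) :=
  {f | f ∈ D.EiStar i ∧
    ∀ j, (D.eig i).re ≤ (D.eig j).re → D.eig j ≠ D.eig i → f ∉ D.EiStar j}

/-- `Ei(Λ_C)`, the union of the `Ei(λ_i)` over the critical eigenvalues, `2 Re λ_i = λ_1`. -/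
def EiCrit : Set (BddFun E) := {f | ∃ i, 2 * (D.eig i).re = D.lam1 ∧ f ∈ D.Ei i}

open Classical in
/-- `ν(f)`: the index (unique when there is one) with `f ∈ Ei(λ_{ν(f)})`. -/
def ν (f : BddFun E) : Fin D.m := if h : ∃ i, f ∈ D.Ei i then h.choose else 0

/-- `λ(f) = λ_{ν(f)}`. -/
def lam (f : BddFun E) : ℂ := D.eig (D.ν f)

/-- `p(f)`: the largest `i` with `𝒩^{i-1} f ≠ 0` (and `0` for `f = 0`). -/
def pOf (f : BddFun E) : ℕ := sSup {i : ℕ | 1 ≤ i ∧ (D.nil ^ (i - 1)) f ≠ 0}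

/-- `f^* = 𝒩^{p(f)-1} f`. -/
def star (f : BddFun E) : BddFun E := (D.nil ^ (D.pOf f - 1)) f

/-- `p̃(f) = ∑_{i ∈ A} p(f_i)`. -/
def pTilde {ι : Type*} (f : ι → BddFun E) (A : Finset ι) : ℕ := ∑ i ∈ A, D.pOf (f i)

open Classical in
/-- `(λ(f_i) : i ∈ A)` is a conjugate tuple: `A` splits into pairs `{i, j}` with
`λ(f_i)` the complex conjugate of `λ(f_j)`. -/
def IsConjugateTuple {ι : Type*} (f : ι → BddFun E) (A : Finset ι) : Prop :=
  ∃ σ : Finpartition A, ∀ B ∈ σ.parts, ∃ i j, i ≠ j ∧ B = {i, j} ∧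
    D.lam (f i) = conj (D.lam (f j))

open Classical in
/-- The limits `L_A[f]`. In the case `|A| = 2` the only partition that contributes to `ζ_A` is that
into singletons, and the argument of `ζ_A` is `({i}, y) ↦ Φ_{ν(f_i),1}[f_i^*](y)`. In the case
`|A| ≥ 4` all blocks that occur in `ζ_A` are proper subsets of `A`, so that the recursion, written
with a test for this, is well founded. -/
def L (X : Data.{u, v} E) {ι : Type*} (f : ι → BddFun E) (A : Finset ι) (x : E) : ℂ :=
  if A.card = 2 ∧ D.IsConjugateTuple f A then
    (((D.pTilde f A - 2).factorial : ℂ) /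
        ((∏ i ∈ A, ((D.pOf (f i) - 1).factorial : ℂ)) * ((D.p1 + D.pTilde f A - 2).factorial : ℂ))) *
      (D.Φ₂ 0 1 ((D.nil ^ (D.p1 - 1)) (toBdd fun z => (X.γ z : ℂ) *
        X.ζ A (fun B y => ∏ i ∈ B, (D.Φ₂ (D.ν (f i)) 1 (D.star (f i))).1 y) z))).1 x
  else if 4 ≤ A.card ∧ Even A.card ∧ D.IsConjugateTuple f A then
    ∫ s in Set.Ioi (0 : ℝ), (Real.exp (-(D.lam1 * A.card * s / 2)) : ℂ) *
      X.ψ s (fun z => (X.γ z : ℂ) *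
        X.ζ A (fun B y => if _h : B ⊂ A then L X f B y else 0) z) x
  else 0
termination_by A.card
decreasing_by exact Finset.card_lt_card _h

/-- `Δ_{ℓ,t}`, the supremum over `x ∈ E` and over `f ∈ Ei(Λ_C)^ℓ` with entries bounded by one, as an
element of `[0, ∞]`. -/
def Δ (X : Data.{u, v} E) (ℓ : ℕ) (t : ℝ) : ℝ≥0∞ :=
  ⨆ (x : E) (f : Fin ℓ → BddFun E) (_ : ∀ i, f i ∈ D.EiCrit ∧ ∀ y, ‖(f i).1 y‖ ≤ 1),
    ‖(Real.exp (-(ℓ * D.lam1 * t / 2)) : ℂ) *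
        (((1 + t) ^ (-((D.pTilde f Finset.univ : ℝ) + ℓ * ((D.p1 : ℝ) - 2) / 2)) : ℝ) : ℂ) *
        X.ψProd t (fun i => (f i).1) x - D.L X f Finset.univ x‖ₑ

end Spectrum

end BMP

end

/-!
The law of the population is the least fixed point of the equation obtained by conditioning on the
first branching event of the initial particle (`limLaw_eq_next`). If the mean number of offspring
is bounded, then this equation is a contraction in a norm that is weighted exponentially in time,
which gives a Gronwall lemma (`MomentBound.eq_zero_of_le`). Applied to the missing mass it shows
that the process does not explode (`MomentBound.isProbabilityMeasure`). A bound on `𝓔_x[N^k]` gives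
bounds on the moments up to order `k` that are uniform on bounded time intervals
(`MomentBound.exists_lintegral_pow_le`).

A product of integrals against a superposition of offspring populations expands over the set
partitions of the factors, two factors being in the same block if they are evaluated on the same
offspring population (`prod_sum_eq_sum_finpartition`). Hence the moments satisfy a linear equation
whose only locally bounded solution is given by the many-to-few formula
`MomentBound.mom_eq_sg_add_duhamel`:
`ψ_t^{(A)}[f] = ψ_t[∏_{i ∈ A} f_i] + ∫_0^t ψ_s[γ ζ_A[ψ_{t-s}^{(·)}[f]]] ds`,
in which `ζ_A` only involves moments of a lower order. The asymptotics follow by induction over the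
order (`H1.limitRate`), from the leading terms of `ψ_t` that the spectral assumption provides: it
grows like `e^{λ_1 t} (1 + t)^{p_1 - 1}` on general functions (`H1.exists_rate_lead`) and like
`e^{λ(f) t} (1 + t)^{p(f) - 1}`, with `Re λ(f) = λ_1 / 2`, on critical ones
(`H1.exists_rate_critLead`).

* In the first order the normalisation is larger than `ψ_t[f]` by `(1 + t)^{p_1 / 2}`, so that the
  limit is zero (`H1.limitRate_one`).
* In the second order both factors of the integrand grow with the exponential rate `λ_1`, so that
  branching events at all times between `0` and `t` contribute. What remains of the integral is a
  Beta integral of the two polynomial factors, which oscillates with the frequency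
  `Im λ(f_a) + Im λ(f_b)`. It converges to the Beta function if this frequency is zero, that is, if
  the pair is conjugate, and to zero otherwise (`exists_rate_beta`, `H1.limitRate_two`).
* From the third order on, the normalised moments of lower order enter with the factor
  `e^{-λ_1 |A| s / 2}`, which beats the growth `e^{λ_1 s}` of the semigroup. By dominated convergence
  the limit is the integral that defines `L_A` (`exists_rate_conv`, `H1.limitRate_of_lt`). If `A` is
  not conjugate, then each of its partitions has a block that is not, and the limit vanishes
  (`branching_L_eq_zero`).

All estimates are uniform in the starting point and in the functions. This is carried by the bounds
`IsRate`: decreasing functions of time that tend to zero. Such a bound on the error gives both the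
boundedness of `Δ_{ℓ,t}` for all `t ≥ 0` and its convergence to zero.
-/

noncomputable section

namespace BMP

/-! ### Measures on product spaces and on spaces of measures -/

theorem measurableEmbedding_sigmaMk {Y : ℕ → Type*} [∀ n, MeasurableSpace (Y n)] (n : ℕ) :
    MeasurableEmbedding (Sigma.mk n : Y n → Σ n, Y n) where
  injective := sigma_mk_injective
  measurable := measurable_iff_le_map.2 (iInf_le _ n)
  measurableSet_image' := by
    intro s hs
    refine MeasurableSpace.measurableSet_iInf.2 fun m => ?_
    change MeasurableSet (Sigma.mk m ⁻¹' (Sigma.mk n '' s))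
    by_cases h : m = n
    · subst h
      rwa [Set.preimage_image_eq _ sigma_mk_injective]
    · convert MeasurableSet.empty
      ext y
      simp only [Set.mem_preimage, Set.mem_image, Set.mem_empty_iff_false, iff_false]
      rintro ⟨z, -, hz⟩
      exact h (congrArg Sigma.fst hz).symm

theorem measurable_prod_sigma {T Z : Type*} [MeasurableSpace T] [MeasurableSpace Z]
    {Y : ℕ → Type*} [∀ n, MeasurableSpace (Y n)] {f : T × (Σ n, Y n) → Z}
    (h : ∀ n, Measurable fun p : T × Y n => f (p.1, ⟨n, p.2⟩)) : Measurable f := by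
  intro B hB
  have : f ⁻¹' B = ⋃ n, (Prod.map id (Sigma.mk n) : T × Y n → T × (Σ n, Y n)) ''
      ((fun p : T × Y n => f (p.1, ⟨n, p.2⟩)) ⁻¹' B) := by
    ext ⟨t, n, y⟩
    simp only [Set.mem_preimage, Set.mem_iUnion, Set.mem_image, Prod.exists, Prod.map_apply, id,
      Prod.mk.injEq]
    constructor
    · intro hf
      exact ⟨n, t, y, hf, rfl, rfl⟩
    · rintro ⟨n', t', y', hf, rfl, h2⟩
      rw [← h2]
      exact hf
  rw [this]
  refine MeasurableSet.iUnion fun n => ?_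
  exact ((MeasurableEmbedding.id.prodMap (measurableEmbedding_sigmaMk n)).measurableSet_image).2
    (h n hB)

theorem measurable_sigma_fst {Y : ℕ → Type*} [∀ n, MeasurableSpace (Y n)] :
    Measurable (Sigma.fst : (Σ n, Y n) → ℕ) := by
  have : Measurable fun p : Unit × (Σ n, Y n) => p.2.1 :=
    measurable_prod_sigma fun n => measurable_const
  exact this.comp (measurable_const.prodMk measurable_id : Measurable fun y => ((), y))

theorem measurable_measurePi {T S : Type*} [MeasurableSpace T] [MeasurableSpace S] {n : ℕ}
    {q : T → Fin n → Measure S} [∀ t i, IsFiniteMeasure (q t i)]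
    (hq : ∀ i, Measurable fun t => q t i) : Measurable fun t => Measure.pi (q t) := by
  refine Measurable.measure_of_isPiSystem (generateFrom_pi (ι := Fin n)).symm isPiSystem_pi ?_ ?_
  · rintro _ ⟨s, hs, rfl⟩
    simp_rw [Measure.pi_pi]
    exact Finset.measurable_fun_prod _ fun i _ =>
      (Measure.measurable_coe (hs i (Set.mem_univ i))).comp (hq i)
  · simp_rw [Measure.pi_univ]
    exact Finset.measurable_fun_prod _ fun i _ =>
      (Measure.measurable_coe MeasurableSet.univ).comp (hq i)

theorem measurable_sum_measure {S : Type*} [MeasurableSpace S] {n : ℕ} :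
    Measurable fun ν : Fin n → Measure S => ∑ i, ν i :=
  Finset.measurable_fun_sum _ fun i _ => measurable_pi_apply i

theorem measurePi_mono {ι : Type*} [Fintype ι] {S : ι → Type*} [∀ i, MeasurableSpace (S i)]
    {μ ν : ∀ i, Measure (S i)} (h : ∀ i, μ i ≤ ν i) : Measure.pi μ ≤ Measure.pi ν := by
  refine Measure.le_iff.2 fun s hs => ?_
  rw [Measure.pi, Measure.pi, toMeasure_apply _ _ hs, toMeasure_apply _ _ hs]
  refine (OuterMeasure.le_boundedBy.2 fun t => ?_ :
    OuterMeasure.pi (fun i => (μ i).toOuterMeasure) ≤ OuterMeasure.pi _) s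
  refine (OuterMeasure.boundedBy_le t).trans ?_
  unfold piPremeasure
  exact Finset.prod_le_prod' fun i _ => h i _

/-- The setwise limit of an increasing sequence of measures; it is their supremum
(`iSup_measure_apply`), which the lattice of measures does not express setwise. -/
def monotoneLimit {S : Type*} [MeasurableSpace S] (μ : ℕ → Measure S) (hμ : Monotone μ) :
    Measure S :=
  Measure.ofMeasurable (fun s _ => ⨆ n, μ n s) (by simp) (by
    intro f hf hd
    simp_rw [fun n => measure_iUnion (μ := μ n) hd hf]
    simp_rw [ENNReal.tsum_eq_iSup_sum]
    rw [iSup_comm]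
    congr 1
    ext s
    rw [ENNReal.finsetSum_iSup_of_monotone]
    exact fun i m n hmn => hμ hmn _)

theorem iSup_measure_apply {S : Type*} [MeasurableSpace S] {μ : ℕ → Measure S} (hμ : Monotone μ)
    {s : Set S} (hs : MeasurableSet s) : (⨆ n, μ n) s = ⨆ n, μ n s := by
  have : (⨆ n, μ n) = monotoneLimit μ hμ := by
    apply le_antisymm
    · refine iSup_le fun n => Measure.le_iff.2 fun s hs => ?_
      rw [monotoneLimit, Measure.ofMeasurable_apply s hs]
      exact le_iSup (fun n => μ n s) n
    · refine Measure.le_iff.2 fun s hs => ?_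
      rw [monotoneLimit, Measure.ofMeasurable_apply s hs]
      exact iSup_le fun n => le_iSup μ n s
  rw [this, monotoneLimit, Measure.ofMeasurable_apply s hs]

theorem lintegral_iSup_measure {S : Type*} [MeasurableSpace S] {μ : ℕ → Measure S}
    (hμ : Monotone μ) {f : S → ℝ≥0∞} (hf : Measurable f) :
    ∫⁻ x, f x ∂(⨆ n, μ n) = ⨆ n, ∫⁻ x, f x ∂(μ n) := by
  have h1 : ∀ ρ : Measure S, ∫⁻ x, f x ∂ρ = ⨆ k, (SimpleFunc.eapprox f k).lintegral ρ :=
    fun ρ => lintegral_eq_iSup_eapprox_lintegral hf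
  simp_rw [h1]
  rw [iSup_comm]
  congr 1
  ext k
  simp_rw [SimpleFunc.lintegral]
  rw [← ENNReal.finsetSum_iSup_of_monotone]
  · refine Finset.sum_congr rfl fun c _ => ?_
    rw [iSup_measure_apply hμ (SimpleFunc.measurableSet_preimage _ _), ENNReal.mul_iSup]
  · intro c m n hmn
    exact mul_le_mul_right (hμ hmn _) _

theorem prod_iSup_of_monotone {ι : Type*} (s : Finset ι) {f : ι → ℕ → ℝ≥0∞}
    (hf : ∀ i, Monotone (f i)) : ∏ i ∈ s, (⨆ n, f i n) = ⨆ n, ∏ i ∈ s, f i n := by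
  classical
  induction s using Finset.induction_on with
  | empty => simp
  | insert a s ha ih =>
    simp_rw [Finset.prod_insert ha, ih]
    have hm : Monotone fun n => ∏ i ∈ s, f i n :=
      fun m n hmn => Finset.prod_le_prod' fun i _ => hf i hmn
    refine le_antisymm ?_ (iSup_le fun n => mul_le_mul' (le_iSup (f a) n)
      (le_iSup (fun n => ∏ i ∈ s, f i n) n))
    rw [ENNReal.iSup_mul]
    refine iSup_le fun i => ?_
    rw [ENNReal.mul_iSup]
    exact iSup_le fun j => (mul_le_mul' (hf a (le_max_left i j)) (hm (le_max_right i j))).trans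
      (le_iSup (fun n => f a n * ∏ i ∈ s, f i n) (max i j))

theorem measurePi_iSup {n : ℕ} {S : Type*} [MeasurableSpace S] {μ : ℕ → Fin n → Measure S}
    [∀ i, IsFiniteMeasure (⨆ k, μ k i)]
    (hμ : ∀ i, Monotone fun k => μ k i) :
    Measure.pi (fun i => ⨆ k, μ k i) = ⨆ k, Measure.pi (μ k) := by
  have hfin : ∀ k i, IsFiniteMeasure (μ k i) := fun k i =>
    isFiniteMeasure_of_le _ (le_iSup (fun k => μ k i) k)
  have hm : Monotone fun k => Measure.pi (μ k) := fun k l hkl => measurePi_mono fun i => hμ i hkl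
  refine Measure.pi_eq fun s hs => ?_
  rw [iSup_measure_apply hm (MeasurableSet.univ_pi hs)]
  simp_rw [Measure.pi_pi]
  rw [← prod_iSup_of_monotone _ (f := fun i k => μ k i (s i)) (fun i k l hkl => hμ i hkl _)]
  exact Finset.prod_congr rfl fun i _ => (iSup_measure_apply (hμ i) (hs i)).symm

theorem lintegral_pi_prod {n : ℕ} {S : Type*} [MeasurableSpace S] {μ : Fin n → Measure S}
    [∀ i, SigmaFinite (μ i)] {f : Fin n → S → ℝ≥0∞} (hf : ∀ i, Measurable (f i)) :
    ∫⁻ x, ∏ i, f i (x i) ∂(Measure.pi μ) = ∏ i, ∫⁻ x, f i x ∂(μ i) := by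
  induction n with
  | zero => simp
  | succ n ih =>
    have hm : Measurable fun y : Fin n → S => ∏ i : Fin n, f (Fin.succ i) (y i) :=
      Finset.measurable_fun_prod _ fun i _ => (hf _).comp (measurable_pi_apply i)
    calc
      _ = ∫⁻ x : S × (Fin n → S), f 0 x.1 * ∏ i : Fin n, f (Fin.succ i) (x.2 i)
            ∂((μ 0).prod (Measure.pi (fun i ↦ μ i.succ))) := by
          have := (measurePreserving_piFinSuccAbove μ 0)
          rw [← (this.symm).lintegral_comp_emb (MeasurableEquiv.measurableEmbedding _)]
          simp_rw [MeasurableEquiv.piFinSuccAbove_symm_apply, Fin.insertNthEquiv,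
            Fin.prod_univ_succ, Fin.insertNth_zero]
          simp only [Fin.zero_succAbove, Equiv.coe_fn_mk, Fin.cons_zero, Fin.cons_succ, cast_eq]
      _ = (∫⁻ x, f 0 x ∂μ 0)
            * ∏ i : Fin n, ∫⁻ (x : S), f (Fin.succ i) x ∂(μ i.succ) := by
          rw [← ih (fun i => hf i.succ), ← lintegral_prod_mul (hf 0).aemeasurable hm.aemeasurable]
      _ = ∏ i, ∫⁻ x, f i x ∂(μ i) := by rw [Fin.prod_univ_succ]

/-! ### Killing at a bounded rate -/

section Killing

variable {r : ℝ → ℝ} {C : ℝ}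

theorem intervalIntegrable_of_bounded (hr : Measurable r) (hC : ∀ s, |r s| ≤ C) (a b : ℝ) :
    IntervalIntegrable r volume a b :=
  (intervalIntegrable_const (c := C)).mono_fun' hr.aestronglyMeasurable
    (ae_of_all _ fun s => by simpa using hC s)

/-- With rate `r`, the probability of survival up to `t` and that of death before `t` add up to one.
The rate is merely measurable, so that this is the fundamental theorem of calculus for the
Lipschitz function `t ↦ exp (- ∫_0^t r)`. -/
theorem exp_neg_add_lintegral (hr : Measurable r) (h0 : ∀ s, 0 ≤ r s) (hC : ∀ s, r s ≤ C) {t : ℝ}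
    (ht : 0 ≤ t) :
    ENNReal.ofReal (Real.exp (-∫ s in (0 : ℝ)..t, r s)) +
      ∫⁻ s in Set.Ioc 0 t, ENNReal.ofReal (r s * Real.exp (-∫ a in (0 : ℝ)..s, r a)) = 1 := by
  have hCa : ∀ s, |r s| ≤ C := fun s => by rw [abs_of_nonneg (h0 s)]; exact hC s
  have hint := intervalIntegrable_of_bounded hr hCa
  set F : ℝ → ℝ := fun t => ∫ s in (0 : ℝ)..t, r s with hF
  have hFlip : ∀ a b, |F a - F b| ≤ C * |a - b| := by
    intro a b
    have : F a - F b = ∫ s in b..a, r s := by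
      rw [hF]
      simp only
      rw [intervalIntegral.integral_interval_sub_left (hint _ _) (hint _ _)]
    rw [this, ← Real.norm_eq_abs]
    exact intervalIntegral.norm_integral_le_of_norm_le_const fun s _ => hCa s
  have hF0 : ∀ s, 0 ≤ s → 0 ≤ F s := fun s hs =>
    intervalIntegral.integral_nonneg hs fun u _ => h0 u
  have hC0 : 0 ≤ C := (h0 0).trans (hC 0)
  have hexp : ∀ a b : ℝ, 0 ≤ a → 0 ≤ b → |Real.exp (-a) - Real.exp (-b)| ≤ |a - b| := by
    have key : ∀ a b : ℝ, 0 ≤ a → a ≤ b → Real.exp (-a) - Real.exp (-b) ≤ b - a := by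
      intro a b ha hab
      have h1 : Real.exp (-a) ≤ 1 := by simpa using ha
      have h2 : Real.exp (-b) = Real.exp (-a) * Real.exp (-(b - a)) := by
        rw [← Real.exp_add]; congr 1; ring
      have h3 := Real.add_one_le_exp (-(b - a))
      have h4 := Real.exp_pos (-a)
      rw [h2]
      nlinarith
    intro a b ha hb
    rcases le_total a b with h | h
    · rw [abs_of_nonneg (sub_nonneg.2 (Real.exp_le_exp.2 (neg_le_neg h))), abs_sub_comm,
        abs_of_nonneg (sub_nonneg.2 h)]
      exact key a b ha h
    · rw [abs_sub_comm, abs_of_nonneg (sub_nonneg.2 (Real.exp_le_exp.2 (neg_le_neg h))),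
        abs_of_nonneg (sub_nonneg.2 h)]
      exact key b a hb h
  have hac : AbsolutelyContinuousOnInterval (fun s => Real.exp (-F s)) 0 t := by
    refine LipschitzOnWith.absolutelyContinuousOnInterval (K := Real.toNNReal C) ?_
    refine LipschitzOnWith.of_dist_le_mul fun a ha b hb => ?_
    rw [Set.uIcc_of_le ht] at ha hb
    rw [Real.dist_eq, Real.dist_eq, Real.coe_toNNReal _ hC0]
    exact (hexp _ _ (hF0 a ha.1) (hF0 b hb.1)).trans (hFlip a b)
  have hderiv : ∀ᵐ s, s ∈ Set.uIcc 0 t →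
      deriv (fun s => Real.exp (-F s)) s = -(r s * Real.exp (-F s)) := by
    filter_upwards [(hint 0 t).ae_hasDerivAt_integral] with s hs hmem
    have h1 := (hs hmem 0 (by simp)).neg.exp
    have h2 := h1.deriv
    simp only [Pi.neg_apply] at h2
    rw [show (fun s => Real.exp (-F s)) = fun x => Real.exp (-(∫ (t : ℝ) in 0..x, r t)) from rfl,
      h2]
    ring
  have hI := hac.integral_deriv_eq_sub
  have hI2 : ∫ s in (0 : ℝ)..t, r s * Real.exp (-F s) = 1 - Real.exp (-F t) := by
    have : ∫ s in (0 : ℝ)..t, deriv (fun s => Real.exp (-F s)) s =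
        ∫ s in (0 : ℝ)..t, -(r s * Real.exp (-F s)) := by
      refine intervalIntegral.integral_congr_ae ?_
      filter_upwards [hderiv] with s hs hmem
      exact hs (Set.uIoc_subset_uIcc hmem)
    rw [this, intervalIntegral.integral_neg] at hI
    have hz : F 0 = 0 := by simp [hF]
    rw [hz] at hI
    simp only [neg_zero, Real.exp_zero] at hI
    linarith
  have hFm : Continuous F := by
    refine continuous_iff_continuousAt.2 fun a => ?_
    exact (LipschitzWith.of_dist_le_mul (K := Real.toNNReal C) fun a b => by
      rw [Real.dist_eq, Real.dist_eq, Real.coe_toNNReal _ hC0]; exact hFlip a b).continuous.continuousAt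
  rw [intervalIntegral.integral_of_le ht] at hI2
  rw [← ofReal_integral_eq_lintegral_ofReal]
  · rw [hI2, ← ENNReal.ofReal_add (Real.exp_pos _).le]
    · simp [hF]
    · have : Real.exp (-F t) ≤ 1 := by simpa using hF0 t ht
      linarith
  · exact IntegrableOn.mul_continuousOn_of_subset (hint 0 t).1
      (hFm.neg.rexp).continuousOn measurableSet_Ioc isCompact_Icc Set.Ioc_subset_Icc_self
  · exact ae_of_all _ fun s => mul_nonneg (h0 s) (Real.exp_pos _).le

end Killing

end BMP

namespace BMP

/-! ### Sums over partitions of a finite set -/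

section Partitions

variable {ι : Type*} {R : Type*} [CommSemiring R] {E : Type*}

open Classical in
/-- The contribution of the partition `σ` to `ζ_A[g]` at the offspring configuration `c`. -/
def partitionTerm {A : Finset ι} (σ : Finpartition A) (g : Finset ι → E → R)
    (c : Σ n : ℕ, (Fin n → E)) : R :=
  ∑ e : {B // B ∈ σ.parts} ↪ Fin c.1, ∏ B : {B // B ∈ σ.parts}, g B (c.2 (e B))

open Classical in
/-- The random variable whose `𝓔_x`-expectation is `ζ_A[g](x)`. -/
def zetaSum (A : Finset ι) (g : Finset ι → E → R) (c : Σ n : ℕ, (Fin n → E)) : R :=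
  ∑ σ ∈ (Finset.univ : Finset (Finpartition A)).filter (fun σ => σ.parts ≠ {A}),
    partitionTerm σ g c

open Classical in
/-- Assigning to every `i ∈ A` one of `N` labels amounts to choosing a partition of `A` (into the
sets of elements with the same label) and distinct labels for its blocks. -/
theorem prod_sum_eq_sum_finpartition (A : Finset ι) (N : ℕ) (a : ι → Fin N → R) :
    ∏ i ∈ A, ∑ c, a i c = ∑ σ : Finpartition A, ∑ e : {B // B ∈ σ.parts} ↪ Fin N,
      ∏ B : {B // B ∈ σ.parts}, ∏ j ∈ B.1, a j (e B) := by
  have h1 : ∏ i ∈ A, ∑ c, a i c = ∑ φ : A → Fin N, ∏ i : A, a i (φ i) := by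
    rw [← Finset.prod_coe_sort, Finset.prod_univ_sum, Fintype.piFinset_univ]
  rw [h1, ← Fintype.sum_sigma' (fun (σ : Finpartition A) (e : {B // B ∈ σ.parts} ↪ Fin N) =>
    ∏ B : {B // B ∈ σ.parts}, ∏ j ∈ B.1, a j (e B))]
  -- A partition with distinct labels for its blocks gives the labelling that is constant on
  -- blocks.
  let F : (Σ σ : Finpartition A, {B // B ∈ σ.parts} ↪ Fin N) → (A → Fin N) :=
    fun p i => p.2 ⟨p.1.part i, p.1.part_mem.2 i.2⟩
  symm
  refine Fintype.sum_bijective F ⟨?_, ?_⟩ _ _ ?_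
  · rintro ⟨σ, e⟩ ⟨σ', e'⟩ h
    have key : ∀ (τ : Finpartition A) (d : {B // B ∈ τ.parts} ↪ Fin N) (i j : A),
        j.1 ∈ τ.part i ↔ F ⟨τ, d⟩ j = F ⟨τ, d⟩ i := by
      intro τ d i j
      rw [τ.mem_part_iff_part_eq_part j.2 i.2]
      simp only [F]
      rw [d.injective.eq_iff, Subtype.mk.injEq]
    have hpart : ∀ i : A, σ.part i = σ'.part i := by
      intro i
      ext j
      constructor
      · intro hj
        have hjA : j ∈ A := σ.part_subset _ hj
        exact (key σ' e' i ⟨j, hjA⟩).2 (by rw [← h]; exact (key σ e i ⟨j, hjA⟩).1 hj)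
      · intro hj
        have hjA : j ∈ A := σ'.part_subset _ hj
        exact (key σ e i ⟨j, hjA⟩).2 (by rw [h]; exact (key σ' e' i ⟨j, hjA⟩).1 hj)
    have hsub : ∀ τ τ' : Finpartition A, (∀ i : A, τ.part i = τ'.part i) → τ.parts ⊆ τ'.parts := by
      intro τ τ' hp B hB
      obtain ⟨i, hi⟩ := τ.nonempty_of_mem_parts hB
      have hiA : i ∈ A := τ.subset hB hi
      rw [← τ.part_eq_of_mem hB hi, hp ⟨i, hiA⟩]
      exact τ'.part_mem.2 hiA
    have hσ : σ = σ' := Finpartition.ext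
      (Finset.Subset.antisymm (hsub _ _ hpart) (hsub _ _ fun i => (hpart i).symm))
    subst hσ
    congr 1
    ext ⟨B, hB⟩
    obtain ⟨i, hi⟩ := σ.nonempty_of_mem_parts hB
    have hiA : i ∈ A := σ.subset hB hi
    have := congrFun h ⟨i, hiA⟩
    simp only [F, σ.part_eq_of_mem hB hi] at this
    rw [this]
  · intro φ
    -- Conversely, a labelling gives the partition into its fibres; `Option` extends the labelling
    -- to a function on all of `ι`, as `Setoid.ker` requires.
    let g : ι → Option (Fin N) := fun i => if h : i ∈ A then some (φ ⟨i, h⟩) else none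
    have hg : ∀ i : A, g i = some (φ i) := fun i => by simp [g]
    let σ : Finpartition A := Finpartition.ofSetSetoid (Setoid.ker g) A
    have hσ : ∀ i j : A, j.1 ∈ σ.part i ↔ φ i = φ j := by
      intro i j
      rw [Finpartition.mem_part_ofSetSetoid_iff_rel]
      change (i.1 ∈ A ∧ j.1 ∈ A ∧ g i = g j) ↔ _
      rw [hg, hg]
      simp
    have hne : ∀ B : {B // B ∈ σ.parts}, ∃ i : A, i.1 ∈ B.1 := fun B => by
      obtain ⟨i, hi⟩ := σ.nonempty_of_mem_parts B.2
      exact ⟨⟨i, σ.subset B.2 hi⟩, hi⟩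
    choose r hr using hne
    refine ⟨⟨σ, ⟨fun B => φ (r B), fun B B' h => ?_⟩⟩, ?_⟩
    · have h2 := (hσ _ _).2 h
      rw [σ.part_eq_of_mem B.2 (hr B)] at h2
      exact Subtype.ext (σ.eq_of_mem_parts B.2 B'.2 h2 (hr B'))
    · ext1 i
      simp only [F]
      exact ((hσ i _).1 (hr ⟨σ.part i, σ.part_mem.2 i.2⟩)).symm
  · rintro ⟨σ, e⟩
    have h2 : ∀ B : {B // B ∈ σ.parts}, ∏ j ∈ B.1, a j (e B) =
        ∏ j ∈ B.1, (if h : j ∈ A then a j (F ⟨σ, e⟩ ⟨j, h⟩) else 1) := by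
      intro B
      refine Finset.prod_congr rfl fun j hj => ?_
      have hjA : j ∈ A := σ.subset B.2 hj
      rw [dif_pos hjA]
      congr 2
      exact Subtype.ext (σ.part_eq_of_mem B.2 hj).symm
    simp only [h2]
    rw [Finset.prod_coe_sort σ.parts (fun B => ∏ j ∈ B,
      (if h : j ∈ A then a j (F ⟨σ, e⟩ ⟨j, h⟩) else 1))]
    have h3 := Finset.prod_biUnion (f := fun j => if h : j ∈ A then a j (F ⟨σ, e⟩ ⟨j, h⟩) else 1)
      σ.disjoint
    rw [σ.biUnion_parts] at h3
    refine h3.symm.trans ?_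
    rw [← Finset.prod_coe_sort]
    exact Finset.prod_congr rfl fun i _ => by simp

open Classical in
/-- The partition into a single block contributes the sum over the offspring; the other partitions
make up `zetaSum`. -/
theorem sum_partitionTerm (A : Finset ι) (hA : A.Nonempty) (g : Finset ι → E → R)
    (c : Σ n : ℕ, (Fin n → E)) :
    ∑ σ : Finpartition A, partitionTerm σ g c = ∑ i, g A (c.2 i) + zetaSum A g c := by
  rw [← Finset.sum_filter_add_sum_filter_not Finset.univ (fun σ : Finpartition A => σ.parts = {A})]
  congr 1
  have hne : A ≠ ⊥ := hA.ne_empty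
  have : (Finset.univ : Finset (Finpartition A)).filter (fun σ => σ.parts = {A}) =
      {Finpartition.indiscrete hne} := by
    ext σ
    simp only [Finset.mem_filter, Finset.mem_univ, true_and, Finset.mem_singleton]
    constructor
    · intro h
      exact Finpartition.ext h
    · rintro rfl
      rfl
  rw [this, Finset.sum_singleton, partitionTerm]
  have hu : ∀ B : {B // B ∈ (Finpartition.indiscrete hne).parts}, B.1 = A := fun B =>
    Finset.mem_singleton.1 B.2
  let B₀ : {B // B ∈ (Finpartition.indiscrete hne).parts} := ⟨A, Finset.mem_singleton_self A⟩
  have hu' : ∀ B, B = B₀ := fun B => Subtype.ext (hu B)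
  refine Fintype.sum_bijective (fun e => e B₀) ⟨?_, ?_⟩ _ _ ?_
  · intro e e' h
    ext B
    rw [hu' B]
    exact congrArg Fin.val h
  · intro i
    exact ⟨⟨fun _ => i, fun B B' _ => (hu' B).trans (hu' B').symm⟩, rfl⟩
  · intro e
    rw [Fintype.prod_eq_single B₀ fun B hB => absurd (hu' B) hB]

open Classical in
theorem block_ssubset {A : Finset ι} {σ : Finpartition A} (hσ : σ.parts ≠ {A}) {B : Finset ι}
    (hB : B ∈ σ.parts) : B ⊂ A := by
  refine (σ.subset hB).ssubset_of_ne ?_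
  rintro rfl
  refine hσ (Finset.eq_singleton_iff_unique_mem.2 ⟨hB, fun B' hB' => ?_⟩)
  obtain ⟨i, hi⟩ := σ.nonempty_of_mem_parts hB'
  exact σ.eq_of_mem_parts hB' hB hi (σ.subset hB' hi)

theorem zetaSum_congr {A : Finset ι} {g g' : Finset ι → E → R}
    (h : ∀ B, B.Nonempty → B ⊂ A → g B = g' B) (c : Σ n : ℕ, (Fin n → E)) :
    zetaSum A g c = zetaSum A g' c := by
  classical
  unfold zetaSum partitionTerm
  refine Finset.sum_congr rfl fun σ hσ => Finset.sum_congr rfl fun e _ =>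
    Finset.prod_congr rfl fun B _ => ?_
  rw [h B.1 (σ.nonempty_of_mem_parts B.2) (block_ssubset (Finset.mem_filter.1 hσ).2 B.2)]

open Classical in
theorem prod_blocks {A : Finset ι} (σ : Finpartition A) (d : ι → R) :
    ∏ B : {B // B ∈ σ.parts}, ∏ j ∈ B.1, d j = ∏ j ∈ A, d j := by
  rw [Finset.prod_coe_sort σ.parts (fun B => ∏ j ∈ B, d j)]
  have h3 := Finset.prod_biUnion (f := d) σ.disjoint
  rw [σ.biUnion_parts] at h3
  exact h3.symm

/-- Homogeneity of `ζ_A`: factors attached to the elements of `A` can be pulled out. -/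
theorem zetaSum_mul (A : Finset ι) (d : ι → R) (g : Finset ι → E → R) (c : Σ n : ℕ, (Fin n → E)) :
    zetaSum A (fun B y => (∏ j ∈ B, d j) * g B y) c = (∏ j ∈ A, d j) * zetaSum A g c := by
  classical
  unfold zetaSum partitionTerm
  rw [Finset.mul_sum]
  refine Finset.sum_congr rfl fun σ hσ => ?_
  rw [Finset.mul_sum]
  refine Finset.sum_congr rfl fun e _ => ?_
  rw [Finset.prod_mul_distrib, prod_blocks]

open Classical in
theorem card_embeddings_le {A : Finset ι} (σ : Finpartition A) (N : ℕ) :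
    Fintype.card ({B // B ∈ σ.parts} ↪ Fin N) ≤ N ^ σ.parts.card := by
  rw [Fintype.card_embedding_eq]
  simpa using Nat.descFactorial_le_pow N σ.parts.card

/-- The number of partitions of `A`. -/
def numPartitions (A : Finset ι) : ℕ := by
  classical exact Fintype.card (Finpartition A)

open Classical in
/-- A partition of a set of at most `k` elements has at least one and at most `k` blocks. At least
one is needed for `N = 0`. -/
theorem card_parts_pow_le {A : Finset ι} (hA : A.Nonempty) (σ : Finpartition A) (N k : ℕ)
    (hk : A.card ≤ k) : N ^ σ.parts.card ≤ N ^ k := by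
  classical
  rcases Nat.eq_zero_or_pos N with h | h
  · subst h
    have : σ.parts.card ≠ 0 := by
      rw [Finset.card_ne_zero]
      exact σ.parts_nonempty hA.ne_empty
    rw [zero_pow this]
    exact Nat.zero_le _
  · exact Nat.pow_le_pow_right h (σ.card_parts_le_card.trans hk)

theorem norm_prod_sub_prod_le {κ : Type*} (s : Finset κ) (a b : κ → ℂ) {C ε : ℝ} (hC : 1 ≤ C)
    (ha : ∀ i ∈ s, ‖a i‖ ≤ C) (hb : ∀ i ∈ s, ‖b i‖ ≤ C) (hab : ∀ i ∈ s, ‖a i - b i‖ ≤ ε) :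
    ‖∏ i ∈ s, a i - ∏ i ∈ s, b i‖ ≤ s.card * C ^ s.card * ε := by
  classical
  induction s using Finset.induction_on with
  | empty => simp
  | insert j s hj ih =>
    rw [Finset.prod_insert hj, Finset.prod_insert hj, Finset.card_insert_of_notMem hj]
    have ih' := ih (fun i hi => ha i (Finset.mem_insert_of_mem hi))
      (fun i hi => hb i (Finset.mem_insert_of_mem hi))
      (fun i hi => hab i (Finset.mem_insert_of_mem hi))
    have h1 : ‖∏ i ∈ s, b i‖ ≤ C ^ s.card := by
      rw [norm_prod]
      exact (Finset.prod_le_prod (fun i _ => norm_nonneg _)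
        fun i hi => hb i (Finset.mem_insert_of_mem hi)).trans_eq (Finset.prod_const C)
    have h2 := hab j (Finset.mem_insert_self j s)
    have h3 := ha j (Finset.mem_insert_self j s)
    have hε : 0 ≤ ε := (norm_nonneg _).trans h2
    have hCs : 0 ≤ C ^ s.card := by positivity
    calc _ = ‖a j * (∏ i ∈ s, a i - ∏ i ∈ s, b i) + (a j - b j) * ∏ i ∈ s, b i‖ := by
          congr 1; ring
      _ ≤ C * (s.card * C ^ s.card * ε) + ε * C ^ s.card := by
          refine (norm_add_le _ _).trans (add_le_add ?_ ?_)
          · rw [norm_mul]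
            exact mul_le_mul h3 ih' (norm_nonneg _) (by linarith)
          · rw [norm_mul]
            exact mul_le_mul h2 h1 (norm_nonneg _) hε
      _ ≤ C * (s.card * C ^ s.card * ε) + C * (ε * C ^ s.card) := by
          refine add_le_add le_rfl ?_
          exact le_mul_of_one_le_left (mul_nonneg hε hCs) hC
      _ = _ := by push_cast; ring

/-- `ζ_A` is Lipschitz in its argument on bounded sets. Each of the finitely many partitions has
at most `k` blocks, hence at most `N ^ k` injections of its blocks into the offspring, so that the
`k`-th moment of `N` bounds the expectation. -/
theorem norm_zetaSum_sub_le {A : Finset ι} (hA : A.Nonempty) {g g' : Finset ι → E → ℂ} {C ε : ℝ}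
    (hC : 1 ≤ C) (hε : 0 ≤ ε)
    (hg : ∀ B, B.Nonempty → B ⊂ A → ∀ y, ‖g B y‖ ≤ C)
    (hg' : ∀ B, B.Nonempty → B ⊂ A → ∀ y, ‖g' B y‖ ≤ C)
    (hgg : ∀ B, B.Nonempty → B ⊂ A → ∀ y, ‖g B y - g' B y‖ ≤ ε)
    {k : ℕ} (hk : A.card ≤ k) (c : Σ n : ℕ, (Fin n → E)) :
    ‖zetaSum A g c - zetaSum A g' c‖ ≤ numPartitions A * (k * C ^ k * ε) * (c.1 : ℝ) ^ k := by
  classical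
  unfold zetaSum partitionTerm
  simp_rw [← Finset.sum_sub_distrib]
  have h1 : ∀ σ ∈ (Finset.univ : Finset (Finpartition A)).filter (fun σ => σ.parts ≠ {A}),
      ‖∑ e : {B // B ∈ σ.parts} ↪ Fin c.1,
        (∏ B : {B // B ∈ σ.parts}, g B (c.2 (e B)) - ∏ B : {B // B ∈ σ.parts}, g' B (c.2 (e B)))‖
      ≤ (k * C ^ k * ε) * (c.1 : ℝ) ^ k := by
    intro σ hσ
    have hs := fun B : {B // B ∈ σ.parts} => block_ssubset (Finset.mem_filter.1 hσ).2 B.2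
    have hcard : Fintype.card {B // B ∈ σ.parts} ≤ k := by
      rw [Fintype.card_coe]
      exact σ.card_parts_le_card.trans hk
    have h2 : ∀ e ∈ (Finset.univ : Finset ({B // B ∈ σ.parts} ↪ Fin c.1)),
        ‖∏ B : {B // B ∈ σ.parts}, g B (c.2 (e B)) - ∏ B : {B // B ∈ σ.parts}, g' B (c.2 (e B))‖ ≤
        k * C ^ k * ε := by
      intro e _
      refine (norm_prod_sub_prod_le Finset.univ _ _ (ε := ε) hC
        (fun B _ => hg _ (σ.nonempty_of_mem_parts B.2) (hs B) _)
        (fun B _ => hg' _ (σ.nonempty_of_mem_parts B.2) (hs B) _)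
        (fun B _ => hgg _ (σ.nonempty_of_mem_parts B.2) (hs B) _)).trans ?_
      rw [Finset.card_univ]
      gcongr
    refine (norm_sum_le_of_le _ h2).trans ?_
    rw [Finset.sum_const, nsmul_eq_mul, mul_comm, Finset.card_univ]
    refine mul_le_mul_of_nonneg_left ?_ (by positivity)
    exact_mod_cast (card_embeddings_le σ c.1).trans (card_parts_pow_le hA σ c.1 k hk)
  refine (norm_sum_le_of_le _ h1).trans ?_
  rw [Finset.sum_const, nsmul_eq_mul, mul_assoc (numPartitions A : ℝ)]
  refine mul_le_mul_of_nonneg_right ?_ (by positivity)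
  exact_mod_cast (Finset.card_filter_le _ _).trans_eq (by rw [numPartitions, Finset.card_univ])

theorem norm_zetaSum_le {A : Finset ι} (hA : A.Nonempty) {g : Finset ι → E → ℂ} {C : ℝ}
    (hC : 1 ≤ C) (hg : ∀ B, B.Nonempty → B ⊂ A → ∀ y, ‖g B y‖ ≤ C)
    {k : ℕ} (hk : A.card ≤ k) (c : Σ n : ℕ, (Fin n → E)) :
    ‖zetaSum A g c‖ ≤ numPartitions A * (k * C ^ k * C) * (c.1 : ℝ) ^ k := by
  have h0 : zetaSum A (fun _ _ => (0 : ℂ)) c = 0 := by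
    classical
    unfold zetaSum partitionTerm
    refine Finset.sum_eq_zero fun σ _ => Finset.sum_eq_zero fun e _ => ?_
    obtain ⟨B, hB⟩ := σ.parts_nonempty hA.ne_empty
    exact Finset.prod_eq_zero (i := (⟨B, hB⟩ : {B // B ∈ σ.parts})) (Finset.mem_univ _) rfl
  have := norm_zetaSum_sub_le hA (g := g) (g' := fun _ _ => (0 : ℂ)) (ε := C) hC (by linarith) hg
    (fun _ _ _ _ => by simpa using (by linarith : 0 ≤ C))
    (fun B h1 h2 y => by simpa using hg B h1 h2 y) hk c
  rwa [h0, sub_zero] at this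

end Partitions

section Measurability

variable {ι : Type*} {E T : Type*} [MeasurableSpace E] [MeasurableSpace T]

open Classical in
theorem measurable_partitionTerm {R : Type*} [CommSemiring R] [MeasurableSpace R]
    [MeasurableAdd₂ R] [MeasurableMul₂ R] {A : Finset ι} (σ : Finpartition A)
    {g : T → Finset ι → E → R}
    (hg : ∀ B ∈ σ.parts, Measurable fun p : T × E => g p.1 B p.2) :
    Measurable fun p : T × (Σ n : ℕ, (Fin n → E)) => partitionTerm σ (g p.1) p.2 := by
  classical
  refine measurable_prod_sigma fun n => ?_
  change Measurable fun p : T × (Fin n → E) => ∑ e : {B // B ∈ σ.parts} ↪ Fin n,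
    ∏ B : {B // B ∈ σ.parts}, g p.1 B (p.2 (e B))
  refine Finset.measurable_fun_sum _ fun e _ => Finset.measurable_fun_prod _ fun B _ => ?_
  exact (hg B.1 B.2).comp (measurable_fst.prodMk ((measurable_pi_apply _).comp measurable_snd))

theorem measurable_zetaSum {R : Type*} [CommSemiring R] [MeasurableSpace R]
    [MeasurableAdd₂ R] [MeasurableMul₂ R] {A : Finset ι} {g : T → Finset ι → E → R}
    (hg : ∀ B, B.Nonempty → B ⊂ A → Measurable fun p : T × E => g p.1 B p.2) :
    Measurable fun p : T × (Σ n : ℕ, (Fin n → E)) => zetaSum A (g p.1) p.2 := by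
  classical
  unfold zetaSum
  refine Finset.measurable_fun_sum _ fun σ hσ => measurable_partitionTerm σ fun B hB => ?_
  exact hg B (σ.nonempty_of_mem_parts hB) (block_ssubset (Finset.mem_filter.1 hσ).2 hB)

theorem measurable_sum_children {R : Type*} [AddCommMonoid R] [MeasurableSpace R]
    [MeasurableAdd₂ R] {h : T → E → R} (hh : Measurable fun p : T × E => h p.1 p.2) :
    Measurable fun p : T × (Σ n : ℕ, (Fin n → E)) => ∑ i, h p.1 (p.2.2 i) := by
  refine measurable_prod_sigma fun n => ?_
  change Measurable fun p : T × (Fin n → E) => ∑ i, h p.1 (p.2 i)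
  refine Finset.measurable_fun_sum _ fun i _ => ?_
  exact hh.comp (measurable_fst.prodMk ((measurable_pi_apply _).comp measurable_snd))

end Measurability

end BMP

namespace BMP

variable {E : Type u} [MeasurableSpace E]

/-! ### The law of the process as a fixed point -/

theorem measurable_pointMass : Measurable (pointMass : E ⊕ Unit → Measure E) :=
  Measure.measurable_dirac.sumElim measurable_const

namespace Data

variable (X : Data.{u, v} E)

theorem measurable_rate : Measurable X.rate := X.measurable_γ.sumElim measurable_const

theorem rate_nonneg (z : E ⊕ Unit) : 0 ≤ X.rate z := by
  rcases z with y | y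
  · exact X.γ_nonneg y
  · exact le_rfl

/-- A bound for the branching rate. -/
def rateBound : ℝ := max 0 X.γ_bounded.choose

theorem rateBound_nonneg : 0 ≤ X.rateBound := le_max_left _ _

theorem γ_le (y : E) : X.γ y ≤ X.rateBound := (X.γ_bounded.choose_spec y).trans (le_max_right _ _)

theorem rate_le (z : E ⊕ Unit) : X.rate z ≤ X.rateBound := by
  rcases z with y | y
  · exact X.γ_le y
  · exact X.rateBound_nonneg

theorem measurable_rate_path : Measurable fun p : ℝ × X.Ω => X.rate (X.ξ p.1 p.2) :=
  X.measurable_rate.comp X.measurable_ξ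

theorem measurable_rate_section (ω : X.Ω) : Measurable fun s => X.rate (X.ξ s ω) :=
  X.measurable_rate_path.comp (measurable_id.prodMk measurable_const)

theorem measurable_ξ_time (t : ℝ) : Measurable fun ω : X.Ω => X.ξ t ω :=
  X.measurable_ξ.comp (measurable_const.prodMk measurable_id)

theorem measurable_hazard : Measurable fun p : ℝ × X.Ω => X.hazard p.1 p.2 := by
  have key : ∀ S : Set (ℝ × ℝ), MeasurableSet S →
      Measurable fun p : ℝ × X.Ω => ∫ r, S.indicator (fun _ => X.rate (X.ξ r p.2)) (p.1, r) := by
    intro S hS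
    refine (StronglyMeasurable.integral_prod_right (ν := volume)
      (f := fun (p : ℝ × X.Ω) r => S.indicator (fun _ => X.rate (X.ξ r p.2)) (p.1, r)) ?_).measurable
    refine Measurable.stronglyMeasurable ?_
    have : Measurable fun p : (ℝ × X.Ω) × ℝ => X.rate (X.ξ p.2 p.1.2) :=
      X.measurable_rate_path.comp (measurable_snd.prodMk (measurable_snd.comp measurable_fst))
    exact this.indicator (s := {p : (ℝ × X.Ω) × ℝ | (p.1.1, p.2) ∈ S})
      (((measurable_fst.comp measurable_fst).prodMk measurable_snd) hS)
  have h1 := key {q | 0 < q.2 ∧ q.2 ≤ q.1} ((measurableSet_lt measurable_const measurable_snd).inter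
    (measurableSet_le measurable_snd measurable_fst))
  have h2 := key {q | q.1 < q.2 ∧ q.2 ≤ 0} ((measurableSet_lt measurable_fst measurable_snd).inter
    (measurableSet_le measurable_snd measurable_const))
  convert h1.sub h2 using 1
  ext p
  rw [hazard, intervalIntegral, ← integral_indicator measurableSet_Ioc,
    ← integral_indicator measurableSet_Ioc]
  rfl

/-- The probability that a particle following the path `ω` survives up to time `t`. -/
def survival (t : ℝ) (ω : X.Ω) : ℝ := Real.exp (-X.hazard t ω)

theorem measurable_survival : Measurable fun p : ℝ × X.Ω => X.survival p.1 p.2 :=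
  Real.measurable_exp.comp X.measurable_hazard.neg

theorem survival_pos (t : ℝ) (ω : X.Ω) : 0 < X.survival t ω := Real.exp_pos _

theorem survival_le_one {t : ℝ} (ht : 0 ≤ t) (ω : X.Ω) : X.survival t ω ≤ 1 := by
  have : 0 ≤ X.hazard t ω := intervalIntegral.integral_nonneg ht fun _ _ => X.rate_nonneg _
  simpa [survival] using this

/-- The density of the time of branching along the path `ω`. -/
def branchDensity (p : ℝ × X.Ω) : NNReal :=
  Real.toNNReal (X.rate (X.ξ p.1 p.2) * X.survival p.1 p.2)

theorem measurable_branchDensity : Measurable X.branchDensity :=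
  (X.measurable_rate_path.mul X.measurable_survival).real_toNNReal

/-- Along a given path, the particle survives up to time `t` or branches before. -/
theorem survival_add_lintegral {t : ℝ} (ht : 0 ≤ t) (ω : X.Ω) :
    ENNReal.ofReal (X.survival t ω) + ∫⁻ s in Set.Ioc 0 t, (X.branchDensity (s, ω) : ℝ≥0∞) = 1 :=
  exp_neg_add_lintegral (X.measurable_rate_section ω) (fun _ => X.rate_nonneg _)
    (fun _ => X.rate_le _) ht

theorem branchDensity_le {s : ℝ} (hs : 0 ≤ s) (ω : X.Ω) :
    (X.branchDensity (s, ω) : ℝ≥0∞) ≤ ENNReal.ofReal X.rateBound := by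
  refine ENNReal.ofReal_le_ofReal ?_
  exact (mul_le_mul (X.rate_le _) (X.survival_le_one hs ω) (X.survival_pos _ _).le
    X.rateBound_nonneg).trans_eq (mul_one _)

/-- The offspring kernel on `E ∪ {†}`, without offspring law at `†`. -/
def offspringCem : Kernel (E ⊕ Unit) (Σ n : ℕ, (Fin n → E)) where
  toFun := Sum.elim X.offspring (fun _ => 0)
  measurable' := X.offspring.measurable.sumElim measurable_const

instance : IsFiniteKernel X.offspringCem := by
  refine ⟨1, ENNReal.one_lt_top, ?_⟩
  rintro (y | y)
  · exact prob_le_one (μ := X.offspring y)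
  · simp [offspringCem]

/-- The path up to the branching of the initial particle, together with the branching time. -/
def branchPath : Kernel E (ℝ × X.Ω) :=
  (Kernel.const E (volume.restrict (Set.Ioi (0 : ℝ))) ×ₖ X.P).withDensity
    fun _ p => (X.branchDensity p : ℝ≥0∞)

instance : IsSFiniteKernel X.branchPath := by
  unfold branchPath
  infer_instance

/-- The first branching event: time, path and offspring configuration. -/
def branchEvent : Kernel E ((ℝ × X.Ω) × (Σ n : ℕ, (Fin n → E))) :=
  X.branchPath ⊗ₖ (X.offspringCem.comap (fun p : ℝ × X.Ω => X.ξ p.1 p.2)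
    X.measurable_ξ).prodMkLeft E

instance : IsSFiniteKernel X.branchEvent := by
  unfold branchEvent
  infer_instance

theorem measurable_coe_branchDensity :
    Measurable fun p => (X.branchDensity p : ℝ≥0∞) :=
  X.measurable_branchDensity.coe_nnreal_ennreal

theorem lintegral_branchEvent (x : E) {F : (ℝ × X.Ω) × (Σ n : ℕ, (Fin n → E)) → ℝ≥0∞}
    (hF : Measurable F) :
    ∫⁻ b, F b ∂(X.branchEvent x) = ∫⁻ ω, (∫⁻ s in Set.Ioi 0, X.branchDensity (s, ω) *
      ∫⁻ c, F ((s, ω), c) ∂(X.offspringCem (X.ξ s ω))) ∂(X.P x) := by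
  have h1 : Measurable fun p : ℝ × X.Ω => ∫⁻ c, F (p, c) ∂(X.offspringCem (X.ξ p.1 p.2)) :=
    hF.lintegral_kernel_prod_right' (κ := X.offspringCem.comap (fun p : ℝ × X.Ω => X.ξ p.1 p.2)
      X.measurable_ξ)
  rw [branchEvent, Kernel.lintegral_compProd _ _ _ hF, branchPath, Kernel.lintegral_withDensity _
    (by exact X.measurable_coe_branchDensity.comp measurable_snd) _ (by exact h1), Kernel.prod_apply,
    Kernel.const_apply]
  exact lintegral_prod_symm _ (X.measurable_coe_branchDensity.mul h1).aemeasurable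

theorem measurableSet_time_le (t : ℝ) :
    MeasurableSet {b : (ℝ × X.Ω) × (Σ n : ℕ, (Fin n → E)) | b.1.1 ≤ t} :=
  measurableSet_le (measurable_fst.comp measurable_fst) measurable_const

theorem setLIntegral_branchEvent (x : E) (t : ℝ)
    {F : (ℝ × X.Ω) × (Σ n : ℕ, (Fin n → E)) → ℝ≥0∞} (hF : Measurable F) :
    ∫⁻ b in {b | b.1.1 ≤ t}, F b ∂(X.branchEvent x) =
      ∫⁻ ω, (∫⁻ s in Set.Ioc 0 t, X.branchDensity (s, ω) *
      ∫⁻ c, F ((s, ω), c) ∂(X.offspringCem (X.ξ s ω))) ∂(X.P x) := by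
  rw [← lintegral_indicator (X.measurableSet_time_le t),
    X.lintegral_branchEvent x (hF.indicator (X.measurableSet_time_le t))]
  refine lintegral_congr fun ω => ?_
  rw [← lintegral_indicator measurableSet_Ioi, ← lintegral_indicator measurableSet_Ioc]
  refine lintegral_congr fun s => ?_
  by_cases h1 : 0 < s <;> by_cases h2 : s ≤ t <;> simp [Set.indicator, h1, h2]

/-- Branching times are positive, so that integrals over `{b | b.1.1 ≤ t}` see the times in
`(0, t]` only. -/
theorem ae_time_pos (x : E) : ∀ᵐ b ∂(X.branchEvent x), 0 < b.1.1 := by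
  rw [ae_iff]
  have hm : MeasurableSet {b : (ℝ × X.Ω) × (Σ n : ℕ, (Fin n → E)) | ¬ 0 < b.1.1} :=
    (measurableSet_lt measurable_const (measurable_fst.comp measurable_fst)).compl
  rw [← lintegral_indicator_one hm, X.lintegral_branchEvent x (measurable_one.indicator hm)]
  rw [lintegral_eq_zero_of_ae_eq_zero]
  refine ae_of_all _ fun ω => ?_
  simp only [Pi.zero_apply]
  rw [setLIntegral_congr_fun (g := fun _ => 0) measurableSet_Ioi]
  · simp
  · intro s hs
    simp only [Set.mem_Ioi] at hs
    simp [Set.indicator, hs]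

/-- Superposition of independent populations started from the offspring configuration `c`, if one
particle at `y` has at time `r` a population with law `q r y`. -/
def family (q : ℝ → E → Measure (Measure E)) (r : ℝ) (c : Σ n : ℕ, (Fin n → E)) :
    Measure (Measure E) :=
  (Measure.pi fun i => q r (c.2 i)).map (fun ν => ∑ i, ν i)

/-- A measurable family of sub-probability laws. -/
structure SubLaw (q : ℝ → E → Measure (Measure E)) : Prop where
  meas : Measurable fun p : ℝ × E => q p.1 p.2
  mass : ∀ t x, q t x Set.univ ≤ 1

variable {X} {q q' : ℝ → E → Measure (Measure E)}

theorem SubLaw.isFinite (hq : SubLaw q) (t : ℝ) (x : E) : IsFiniteMeasure (q t x) :=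
  ⟨(hq.mass t x).trans_lt ENNReal.one_lt_top⟩

theorem SubLaw.measurable_family (hq : SubLaw q) :
    Measurable fun p : ℝ × (Σ n : ℕ, (Fin n → E)) => family q p.1 p.2 := by
  have := hq.isFinite
  refine measurable_prod_sigma fun n => ?_
  refine (Measure.measurable_map _ measurable_sum_measure).comp ?_
  exact measurable_measurePi (q := fun (p : ℝ × (Fin n → E)) i => q p.1 (p.2 i)) fun i =>
    hq.meas.comp (measurable_fst.prodMk ((measurable_pi_apply i).comp measurable_snd))

theorem SubLaw.lintegral_family (r : ℝ) (c : Σ n : ℕ, (Fin n → E))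
    {G : Measure E → ℝ≥0∞} (hG : Measurable G) :
    ∫⁻ μ, G μ ∂(family q r c) =
      ∫⁻ ν, G (∑ i, ν i) ∂(Measure.pi fun i => q r (c.2 i)) :=
  lintegral_map hG measurable_sum_measure

theorem SubLaw.family_univ_le (hq : SubLaw q) (r : ℝ) (c : Σ n : ℕ, (Fin n → E)) :
    family q r c Set.univ ≤ 1 := by
  have := hq.isFinite
  rw [family, Measure.map_apply measurable_sum_measure MeasurableSet.univ, Set.preimage_univ,
    Measure.pi_univ]
  exact Finset.prod_le_one' fun _ _ => hq.mass _ _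

variable (X)

/-- One step of the recursion for the law: the law at time `t` of the process whose particles of the
second generation evolve according to `q`. Negative times are read as `0`. -/
def next (q : ℝ → E → Measure (Measure E)) (t : ℝ) (x : E) : Measure (Measure E) :=
  ((X.P x).withDensity fun ω => ENNReal.ofReal (X.survival (max t 0) ω)).map
    (fun ω => pointMass (X.ξ (max t 0) ω)) +
  ((X.branchEvent x).restrict {b | b.1.1 ≤ max t 0}).bind
    fun b => family q (max t 0 - b.1.1) b.2

variable {X}

theorem measurable_family_event (hq : SubLaw q) (t : ℝ) :
    Measurable fun b : (ℝ × X.Ω) × (Σ n : ℕ, (Fin n → E)) => family q (t - b.1.1) b.2 :=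
  hq.measurable_family.comp
    ((measurable_const.sub (measurable_fst.comp measurable_fst)).prodMk measurable_snd)

theorem lintegral_next (hq : SubLaw q) (t : ℝ) (x : E) {G : Measure E → ℝ≥0∞} (hG : Measurable G) :
    ∫⁻ μ, G μ ∂(X.next q t x) =
      ∫⁻ ω, ENNReal.ofReal (X.survival (max t 0) ω) * G (pointMass (X.ξ (max t 0) ω)) ∂(X.P x) +
      ∫⁻ b in {b | b.1.1 ≤ max t 0}, ∫⁻ μ, G μ ∂(family q (max t 0 - b.1.1) b.2)
        ∂(X.branchEvent x) := by
  have hp : Measurable fun ω => pointMass (X.ξ (max t 0) ω) :=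
    measurable_pointMass.comp (X.measurable_ξ_time _)
  have hs : Measurable fun ω => ENNReal.ofReal (X.survival (max t 0) ω) :=
    (X.measurable_survival.comp (measurable_const.prodMk measurable_id)).ennreal_ofReal
  rw [next, lintegral_add_measure, lintegral_map hG hp,
    lintegral_withDensity_eq_lintegral_mul _ hs (by exact hG.comp hp),
    Measure.lintegral_bind (measurable_family_event hq _).aemeasurable hG.aemeasurable]
  rfl

theorem next_apply (hq : SubLaw q) (t : ℝ) (x : E) {S : Set (Measure E)} (hS : MeasurableSet S) :
    X.next q t x S =
      ∫⁻ ω, ENNReal.ofReal (X.survival (max t 0) ω) *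
        S.indicator 1 (pointMass (X.ξ (max t 0) ω)) ∂(X.P x) +
      ∫⁻ b in {b | b.1.1 ≤ max t 0}, family q (max t 0 - b.1.1) b.2 S ∂(X.branchEvent x) := by
  rw [← lintegral_indicator_one hS, lintegral_next hq t x (measurable_one.indicator hS)]
  simp_rw [lintegral_indicator_one hS]

theorem lintegral_survival_add (t : ℝ) (ht : 0 ≤ t) (x : E) :
    ∫⁻ ω, ENNReal.ofReal (X.survival t ω) ∂(X.P x) +
      X.branchEvent x {b | b.1.1 ≤ t} = 1 := by
  have hs : Measurable fun ω => ENNReal.ofReal (X.survival t ω) :=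
    (X.measurable_survival.comp (measurable_const.prodMk measurable_id)).ennreal_ofReal
  have h1 : X.branchEvent x {b | b.1.1 ≤ t} =
      ∫⁻ ω, (∫⁻ s in Set.Ioc 0 t, (X.branchDensity (s, ω) : ℝ≥0∞)) ∂(X.P x) := by
    rw [← setLIntegral_one, X.setLIntegral_branchEvent x t measurable_const]
    refine lintegral_congr fun ω => lintegral_congr fun s => ?_
    have h0 : branchDensity X (s, ω) * X.offspringCem (X.ξ s ω) Set.univ =
        (branchDensity X (s, ω) : ℝ≥0∞) := by
      rcases h : X.ξ s ω with y | y
      · have : X.offspringCem (Sum.inl y) Set.univ = 1 := measure_univ (μ := X.offspring y)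
        rw [this, mul_one]
      · have : branchDensity X (s, ω) = 0 := by
          simp [branchDensity, h, rate]
        rw [this]
        simp
    simpa using h0
  rw [h1, ← lintegral_add_left hs]
  simp_rw [X.survival_add_lintegral ht]
  simp

theorem SubLaw.next (hq : SubLaw q) : SubLaw (X.next q) where
  meas := by
    refine Measure.measurable_of_measurable_coe _ fun S hS => ?_
    simp_rw [next_apply hq _ _ hS]
    have hmax : Measurable fun p : ℝ × E => max p.1 0 := measurable_fst.max measurable_const
    refine Measurable.add ?_ ?_
    · refine Measurable.lintegral_kernel_prod_right' (κ := X.P.comap (Prod.snd : ℝ × E → E)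
        measurable_snd) (f := fun p : (ℝ × E) × X.Ω =>
          ENNReal.ofReal (X.survival (max p.1.1 0) p.2) *
          S.indicator 1 (pointMass (X.ξ (max p.1.1 0) p.2))) ?_
      have h1 : Measurable fun p : (ℝ × E) × X.Ω => (max p.1.1 0, p.2) :=
        (hmax.comp measurable_fst).prodMk measurable_snd
      exact ((X.measurable_survival.comp h1).ennreal_ofReal).mul
        ((measurable_one.indicator hS).comp (measurable_pointMass.comp (X.measurable_ξ.comp h1)))
    · have h2 : Measurable fun p : (ℝ × E) × ((ℝ × X.Ω) × (Σ n : ℕ, (Fin n → E))) =>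
          max p.1.1 0 := hmax.comp measurable_fst
      have h3 : Measurable fun p : (ℝ × E) × ((ℝ × X.Ω) × (Σ n : ℕ, (Fin n → E))) =>
          p.2.1.1 := measurable_fst.comp (measurable_fst.comp measurable_snd)
      have h4 : Measurable fun p : ℝ × E => ∫⁻ b, {p : (ℝ × E) × ((ℝ × X.Ω) ×
          (Σ n : ℕ, (Fin n → E))) | p.2.1.1 ≤ max p.1.1 0}.indicator
            (fun p => family q (max p.1.1 0 - p.2.1.1) p.2.2 S) (p, b) ∂(X.branchEvent p.2) := by
        refine Measurable.lintegral_kernel_prod_right' (κ := X.branchEvent.comap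
          (Prod.snd : ℝ × E → E) measurable_snd) ?_
        exact ((Measure.measurable_coe hS).comp (hq.measurable_family.comp
          ((h2.sub h3).prodMk (measurable_snd.comp measurable_snd)))).indicator
            (measurableSet_le h3 h2)
      convert h4 using 2 with p
      rw [← lintegral_indicator (X.measurableSet_time_le _)]
      rfl
  mass := fun t x => by
    rw [next_apply hq _ _ MeasurableSet.univ, ← lintegral_survival_add (X := X) (max t 0)
      (le_max_right _ _) x]
    refine add_le_add (by simp) ?_
    calc _ ≤ ∫⁻ b in {b | b.1.1 ≤ max t 0}, 1 ∂(X.branchEvent x) :=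
          lintegral_mono fun b => hq.family_univ_le _ _
      _ = _ := by simp

theorem family_mono (h : ∀ t x, q t x ≤ q' t x) (r : ℝ) (c : Σ n : ℕ, (Fin n → E)) :
    family q r c ≤ family q' r c :=
  Measure.map_mono (measurePi_mono fun _ => h _ _) measurable_sum_measure

theorem next_mono (hq : SubLaw q) (hq' : SubLaw q') (h : ∀ t x, q t x ≤ q' t x) (t : ℝ) (x : E) :
    X.next q t x ≤ X.next q' t x := by
  refine Measure.le_iff.2 fun S hS => ?_
  rw [next_apply hq _ _ hS, next_apply hq' _ _ hS]
  exact add_le_add le_rfl (lintegral_mono fun b => family_mono h _ _ S)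

theorem SubLaw.iSup {Q : ℕ → ℝ → E → Measure (Measure E)} (hQ : ∀ n, SubLaw (Q n))
    (hm : ∀ t x, Monotone fun n => Q n t x) : SubLaw fun t x => ⨆ n, Q n t x where
  meas := by
    refine Measure.measurable_of_measurable_coe _ fun S hS => ?_
    simp_rw [iSup_measure_apply (hm _ _) hS]
    exact Measurable.iSup fun n => (Measure.measurable_coe hS).comp (hQ n).meas
  mass := fun t x => by
    rw [iSup_measure_apply (hm _ _) MeasurableSet.univ]
    exact iSup_le fun n => (hQ n).mass t x

/-- The recursion is continuous along increasing sequences of laws, which makes the supremum of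
the iterates a fixed point. -/
theorem next_iSup {Q : ℕ → ℝ → E → Measure (Measure E)} (hQ : ∀ n, SubLaw (Q n))
    (hm : ∀ t x, Monotone fun n => Q n t x) (t : ℝ) (x : E) :
    X.next (fun t x => ⨆ n, Q n t x) t x = ⨆ n, X.next (Q n) t x := by
  have hlim := SubLaw.iSup hQ hm
  have hfin := hlim.isFinite
  have hfam : ∀ r c, ∀ S : Set (Measure E), MeasurableSet S →
      family (fun t x => ⨆ n, Q n t x) r c S = ⨆ n, family (Q n) r c S := by
    intro r c S hS
    simp_rw [family, Measure.map_apply measurable_sum_measure hS]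
    rw [measurePi_iSup (μ := fun n i => Q n r (c.2 i)) fun i => hm _ _]
    have hmono : Monotone fun n => Measure.pi fun i => Q n r (c.2 i) :=
      fun _ _ hmn => measurePi_mono fun i => hm r (c.2 i) hmn
    rw [iSup_measure_apply hmono (measurable_sum_measure hS)]
  ext S hS
  rw [iSup_measure_apply (fun m n hmn => next_mono (hQ m) (hQ n) (fun t x => hm t x hmn) t x) hS,
    next_apply hlim _ _ hS]
  simp_rw [next_apply (hQ _) _ _ hS]
  rw [← ENNReal.add_iSup, ← lintegral_iSup]
  · simp_rw [hfam _ _ S hS]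
  · exact fun n => (Measure.measurable_coe hS).comp (measurable_family_event (hQ n) _)
  · exact fun m n hmn b => family_mono (fun t x => hm t x hmn) _ _ S

variable (X)

/-- The clamped version of `lawGen`, for which negative times are read as `0`. -/
def genLaw : ℕ → ℝ → E → Measure (Measure E)
  | 0 => fun _ _ => 0
  | n + 1 => X.next (genLaw n)

theorem subLaw_genLaw (n : ℕ) : SubLaw (X.genLaw n) := by
  induction n with
  | zero => exact ⟨measurable_const, fun t x => by simp [genLaw]⟩
  | succ n ih => exact ih.next

theorem genLaw_mono (t : ℝ) (x : E) : Monotone fun n => X.genLaw n t x := by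
  have : ∀ n t x, X.genLaw n t x ≤ X.genLaw (n + 1) t x := by
    intro n
    induction n with
    | zero => intro t x; exact Measure.zero_le _
    | succ n ih => exact next_mono (X.subLaw_genLaw n) (X.subLaw_genLaw (n + 1)) ih
  exact monotone_nat_of_le_succ fun n => this n t x

/-- The iterates of the recursion over the first branching event, disintegrated over the path and
the branching time, are those of `next`, which integrates over the joint law of time, path and
offspring. -/
theorem lawGen_eq (n : ℕ) : ∀ t : ℝ, 0 ≤ t → ∀ x, X.lawGen n t x = X.genLaw n t x := by
  induction n with
  | zero => intro t _ x; simp [lawGen, genLaw]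
  | succ n ih =>
    intro t ht x
    have hq := X.subLaw_genLaw n
    have hbranch : ∀ s ∈ Set.Ioc 0 t, ∀ z, X.branch (fun y => X.lawGen n (t - s) y) z =
        (X.offspringCem z).bind fun c => family (X.genLaw n) (t - s) c := by
      intro s hs z
      have : (fun y => X.lawGen n (t - s) y) = fun y => X.genLaw n (t - s) y := by
        ext1 y
        exact ih _ (by linarith [hs.2]) y
      rw [this]
      rcases z with y | y
      · rfl
      · simp [branch, offspringCem]
    have hfam : ∀ s, Measurable fun c => family (X.genLaw n) (t - s) c := fun s =>
      hq.measurable_family.comp (measurable_const.prodMk measurable_id)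
    -- the law of the population at time `t` on the event of branching at time `s` at `z`
    have hjoint : ∀ S : Set (Measure E), MeasurableSet S → Measurable fun p : ℝ × X.Ω =>
        ∫⁻ c, family (X.genLaw n) (t - p.1) c S ∂(X.offspringCem (X.ξ p.1 p.2)) := by
      intro S hS
      refine Measurable.lintegral_kernel_prod_right' (κ := X.offspringCem.comap
        (fun p : ℝ × X.Ω => X.ξ p.1 p.2) X.measurable_ξ) (f := fun p : (ℝ × X.Ω) × _ =>
          family (X.genLaw n) (t - p.1.1) p.2 S) ?_
      exact (Measure.measurable_coe hS).comp (measurable_family_event hq t)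
    have hinner : Measurable fun p : ℝ × X.Ω =>
        (X.offspringCem (X.ξ p.1 p.2)).bind fun c => family (X.genLaw n) (t - p.1) c := by
      refine Measure.measurable_of_measurable_coe _ fun S hS => ?_
      simp_rw [fun p : ℝ × X.Ω => Measure.bind_apply (m := X.offspringCem (X.ξ p.1 p.2)) hS
        (hfam p.1).aemeasurable]
      exact hjoint S hS
    have hsm : Measurable fun p : ℝ × X.Ω => ((X.branchDensity p : ℝ≥0∞)) •
        (X.offspringCem (X.ξ p.1 p.2)).bind fun c => family (X.genLaw n) (t - p.1) c := by
      refine Measure.measurable_of_measurable_coe _ fun S hS => ?_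
      simp_rw [Measure.smul_apply, smul_eq_mul]
      exact X.measurable_coe_branchDensity.mul ((Measure.measurable_coe hS).comp hinner)
    have hrec : X.lawGen (n + 1) t x = (X.P x).bind fun ω =>
        ENNReal.ofReal (X.survival t ω) • Measure.dirac (pointMass (X.ξ t ω)) +
        (volume.restrict (Set.Ioc 0 t)).bind fun s => ((X.branchDensity (s, ω) : ℝ≥0∞)) •
          (X.offspringCem (X.ξ s ω)).bind fun c => family (X.genLaw n) (t - s) c := by
      rw [lawGen]
      congr 1
      ext1 ω
      congr 1
      refine Measure.bind_congr_right ?_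
      filter_upwards [ae_restrict_mem measurableSet_Ioc] with s hs
      rw [hbranch s hs]
      rfl
    have hout : ∀ ω S, MeasurableSet S → ((volume.restrict (Set.Ioc 0 t)).bind fun s =>
        ((X.branchDensity (s, ω) : ℝ≥0∞)) •
          (X.offspringCem (X.ξ s ω)).bind fun c => family (X.genLaw n) (t - s) c) S =
        ∫⁻ s in Set.Ioc 0 t, X.branchDensity (s, ω) *
          ∫⁻ c, family (X.genLaw n) (t - s) c S ∂(X.offspringCem (X.ξ s ω)) := by
      intro ω S hS
      rw [Measure.bind_apply hS (by exact
        (hsm.comp (measurable_id.prodMk measurable_const : Measurable fun s => (s, ω))).aemeasurable)]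
      refine lintegral_congr fun s => ?_
      rw [Measure.smul_apply, smul_eq_mul, Measure.bind_apply hS (hfam s).aemeasurable]
    have hsurv : Measurable fun ω => ENNReal.ofReal (X.survival t ω) :=
      (X.measurable_survival.comp (measurable_const.prodMk measurable_id)).ennreal_ofReal
    have hpm : Measurable fun ω => pointMass (X.ξ t ω) :=
      measurable_pointMass.comp (X.measurable_ξ_time _)
    have hfirst : Measurable fun ω =>
        ENNReal.ofReal (X.survival t ω) • Measure.dirac (pointMass (X.ξ t ω)) := by
      refine Measure.measurable_of_measurable_coe _ fun S hS => ?_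
      simp_rw [Measure.smul_apply, smul_eq_mul]
      exact hsurv.mul ((Measure.measurable_coe hS).comp (Measure.measurable_dirac.comp hpm))
    have hsecond : Measurable fun ω => (volume.restrict (Set.Ioc 0 t)).bind fun s =>
        ((X.branchDensity (s, ω) : ℝ≥0∞)) •
          (X.offspringCem (X.ξ s ω)).bind fun c => family (X.genLaw n) (t - s) c := by
      refine Measure.measurable_of_measurable_coe _ fun S hS => ?_
      simp_rw [hout _ S hS]
      exact Measurable.lintegral_prod_left' (μ := volume.restrict (Set.Ioc 0 t))
        (f := fun p : ℝ × X.Ω => (X.branchDensity p : ℝ≥0∞) *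
          ∫⁻ c, family (X.genLaw n) (t - p.1) c S ∂(X.offspringCem (X.ξ p.1 p.2)))
        (X.measurable_coe_branchDensity.mul (hjoint S hS))
    rw [hrec, genLaw]
    ext S hS
    rw [Measure.bind_apply hS (by exact (hfirst.add hsecond).aemeasurable), next_apply hq _ _ hS,
      max_eq_left ht]
    simp_rw [Measure.add_apply, hout _ S hS]
    rw [lintegral_add_left (by exact (Measure.measurable_coe hS).comp hfirst),
      X.setLIntegral_branchEvent x t
        (by exact (Measure.measurable_coe hS).comp (measurable_family_event hq t))]
    congr 1
    refine lintegral_congr fun ω => ?_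
    rw [Measure.smul_apply, smul_eq_mul, Measure.dirac_apply' _ hS]

/-- The law of `X_t` under `ℙ_{δ_x}`, with negative times read as `0`. -/
def limLaw (t : ℝ) (x : E) : Measure (Measure E) := ⨆ n, X.genLaw n t x

theorem law_eq {t : ℝ} (ht : 0 ≤ t) (x : E) : X.law t x = X.limLaw t x := by
  rw [law, limLaw]
  congr 1
  ext1 n
  exact X.lawGen_eq n t ht x

theorem subLaw_limLaw : SubLaw X.limLaw := SubLaw.iSup X.subLaw_genLaw X.genLaw_mono

/-- The law solves the fixed point equation given by the first branching event. -/
theorem limLaw_eq_next (t : ℝ) (x : E) : X.limLaw t x = X.next X.limLaw t x := by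
  rw [show X.limLaw = fun t x => ⨆ n, X.genLaw n t x from rfl,
    next_iSup X.subLaw_genLaw X.genLaw_mono]
  exact ((X.genLaw_mono t x).iSup_nat_add 1).symm

end Data

end BMP

namespace BMP

variable {E : Type u} [MeasurableSpace E]

namespace Data

/-! ### Moment bounds and non-explosion -/

variable (X : Data.{u, v} E)

/-- The moments of the number of offspring of order at most `k` are bounded by `K`. -/
def MomentBound (k : ℕ) (K : NNReal) : Prop :=
  ∀ j ≤ k, ∀ y, ∫⁻ c, (c.1 : ℝ≥0∞) ^ j ∂(X.offspring y) ≤ K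

theorem exists_momentBound {k : ℕ}
    (h : (⨆ x, ∫⁻ c : (Σ n : ℕ, (Fin n → E)), (c.1 : ℝ≥0∞) ^ k ∂(X.offspring x)) < ⊤) :
    ∃ K, X.MomentBound k K := by
  set S := ⨆ x, ∫⁻ c : (Σ n : ℕ, (Fin n → E)), (c.1 : ℝ≥0∞) ^ k ∂(X.offspring x) with hS
  refine ⟨(1 + S).toNNReal, fun j hj y => ?_⟩
  rw [ENNReal.coe_toNNReal (by finiteness)]
  calc _ ≤ ∫⁻ c, (1 + (c.1 : ℝ≥0∞) ^ k) ∂(X.offspring y) := by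
        refine lintegral_mono fun c => ?_
        have : c.1 ^ j ≤ 1 + c.1 ^ k := by
          rcases Nat.eq_zero_or_pos c.1 with h0 | h0
          · rw [h0]
            rcases Nat.eq_zero_or_pos j with hj0 | hj0
            · simp [hj0]
            · simp [Nat.pos_iff_ne_zero.1 hj0]
          · exact (Nat.pow_le_pow_right h0 hj).trans (Nat.le_add_left _ _)
        have h2 := Nat.cast_le (α := ℝ≥0∞).2 this
        push_cast at h2
        exact h2
    _ = 1 + ∫⁻ c, (c.1 : ℝ≥0∞) ^ k ∂(X.offspring y) := by
        rw [lintegral_add_left measurable_const]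
        simp
    _ ≤ 1 + S := by
        gcongr
        exact le_iSup (fun x => ∫⁻ c, (c.1 : ℝ≥0∞) ^ k ∂(X.offspring x)) y

variable {X} {k : ℕ} {K : NNReal}

theorem measurable_card : Measurable fun c : (Σ n : ℕ, (Fin n → E)) => (c.1 : ℝ≥0∞) :=
  (measurable_of_countable (fun n : ℕ => (n : ℝ≥0∞))).comp measurable_sigma_fst

/-- The first branching event has a density in time that is bounded by the branching rate. -/
theorem MomentBound.lintegral_event_le (hK : X.MomentBound k K) {j : ℕ} (hj : j ≤ k) (x : E) (t : ℝ)
    {h : ℝ → ℝ≥0∞} (hh : Measurable h) :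
    ∫⁻ b in {b | b.1.1 ≤ t}, h b.1.1 * (b.2.1 : ℝ≥0∞) ^ j ∂(X.branchEvent x) ≤
      ENNReal.ofReal X.rateBound * K * ∫⁻ s in Set.Ioc 0 t, h s := by
  have hmeas : Measurable fun b : (ℝ × X.Ω) × (Σ n : ℕ, (Fin n → E)) =>
      h b.1.1 * (b.2.1 : ℝ≥0∞) ^ j := (hh.comp (measurable_fst.comp measurable_fst)).mul
    ((measurable_card.comp measurable_snd).pow_const j)
  rw [X.setLIntegral_branchEvent x t hmeas]
  have hin : ∀ ω s, ∫⁻ c, h s * (c.1 : ℝ≥0∞) ^ j ∂(X.offspringCem (X.ξ s ω)) ≤ h s * K := by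
    intro ω s
    rw [lintegral_const_mul _ (measurable_card.pow_const j)]
    gcongr
    rcases X.ξ s ω with y | y
    · exact hK j hj y
    · simp [offspringCem]
  calc _ ≤ ∫⁻ ω, (∫⁻ s in Set.Ioc 0 t, ENNReal.ofReal X.rateBound * (h s * K)) ∂(X.P x) := by
        refine lintegral_mono fun ω => setLIntegral_mono' measurableSet_Ioc fun s hs => ?_
        exact mul_le_mul' (X.branchDensity_le hs.1.le ω) (hin ω s)
    _ = ∫⁻ s in Set.Ioc 0 t, ENNReal.ofReal X.rateBound * (h s * K) := by simp
    _ = _ := by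
        rw [lintegral_const_mul _ (hh.mul_const _), lintegral_mul_const _ hh]
        ring

/-- An exponential rate at which the mean offspring operator is a contraction
(`MomentBound.contraction`). -/
def growth (X : Data.{u, v} E) (K : NNReal) : ℝ := 2 * (X.rateBound * K + 1)

theorem growth_pos (X : Data.{u, v} E) (K : NNReal) : 0 < X.growth K := by
  have := mul_nonneg X.rateBound_nonneg K.2
  unfold growth
  simp only [NNReal.val_eq_coe] at this
  linarith

theorem lintegral_exp_le {β t : ℝ} (hβ : 0 < β) (ht : 0 ≤ t) :
    ∫⁻ s in Set.Ioc 0 t, ENNReal.ofReal (Real.exp (β * (t - s))) ≤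
      ENNReal.ofReal (Real.exp (β * t) / β) := by
  have hd : ∀ s ∈ Set.uIcc 0 t, HasDerivAt (fun s => -Real.exp (β * (t - s)) / β)
      (Real.exp (β * (t - s))) s := by
    intro s _
    have h1 : HasDerivAt (fun s => β * (t - s)) (-β) s := by
      simpa using ((hasDerivAt_id s).const_sub t).const_mul β
    have h2 := h1.exp.neg.div_const β
    rwa [mul_neg, neg_neg, mul_div_assoc, div_self hβ.ne', mul_one] at h2
  have hc : Continuous fun s => Real.exp (β * (t - s)) := by fun_prop
  have hI := intervalIntegral.integral_eq_sub_of_hasDerivAt hd (hc.intervalIntegrable _ _)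
  rw [intervalIntegral.integral_of_le ht] at hI
  rw [← ofReal_integral_eq_lintegral_ofReal, hI]
  · refine ENNReal.ofReal_le_ofReal ?_
    simp only [sub_self, mul_zero, Real.exp_zero, sub_zero]
    have : 0 < 1 / β := by positivity
    have h2 : -1 / β - -Real.exp (β * t) / β = Real.exp (β * t) / β - 1 / β := by ring
    rw [h2]
    linarith
  · exact hc.integrableOn_Ioc
  · exact ae_of_all _ fun s => (Real.exp_pos _).le

/-- In the norm weighted by `exp (growth * t)`, the mean offspring operator shrinks functions at
least by the factor `1 / 2`. -/
theorem MomentBound.contraction (hK : X.MomentBound k K) (hk : 1 ≤ k) {t : ℝ} (ht : 0 ≤ t)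
    {a : ℝ≥0∞} {h : ℝ → E → ℝ≥0∞}
    (hh : ∀ r, 0 ≤ r → r ≤ t → ∀ y, h r y ≤ a * ENNReal.ofReal (Real.exp (X.growth K * r))) (x : E) :
    ∫⁻ b in {b | b.1.1 ≤ t}, ∑ i, h (t - b.1.1) (b.2.2 i) ∂(X.branchEvent x) ≤
      a / 2 * ENNReal.ofReal (Real.exp (X.growth K * t)) := by
  have hβ := X.growth_pos K
  calc _ ≤ ∫⁻ b in {b | b.1.1 ≤ t}, (a * ENNReal.ofReal (Real.exp (X.growth K * (t - b.1.1)))) *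
        (b.2.1 : ℝ≥0∞) ^ 1 ∂(X.branchEvent x) := by
        refine lintegral_mono_ae ?_
        filter_upwards [ae_restrict_mem (X.measurableSet_time_le t),
          ae_restrict_of_ae (X.ae_time_pos x)] with b hb hb0
        rw [pow_one, mul_comm]
        refine (Finset.sum_le_card_nsmul _ _ _ fun i _ =>
          hh (t - b.1.1) (sub_nonneg.2 hb) (by linarith) (b.2.2 i)).trans ?_
        rw [Finset.card_univ, Fintype.card_fin, nsmul_eq_mul]
    _ ≤ ENNReal.ofReal X.rateBound * K * ∫⁻ s in Set.Ioc 0 t,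
          a * ENNReal.ofReal (Real.exp (X.growth K * (t - s))) :=
        hK.lintegral_event_le hk x t (h := fun s => a * ENNReal.ofReal
          (Real.exp (X.growth K * (t - s)))) (by fun_prop)
    _ ≤ ENNReal.ofReal X.rateBound * K *
          (a * ENNReal.ofReal (Real.exp (X.growth K * t) / X.growth K)) := by
        rw [lintegral_const_mul _ (by fun_prop)]
        gcongr
        exact lintegral_exp_le hβ ht
    _ = a * ENNReal.ofReal (X.rateBound * K * (Real.exp (X.growth K * t) / X.growth K)) := by
        rw [ENNReal.ofReal_mul (p := X.rateBound * K) (mul_nonneg X.rateBound_nonneg K.2),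
          ENNReal.ofReal_mul X.rateBound_nonneg, ENNReal.ofReal_coe_nnreal]
        ring
    _ ≤ a * ENNReal.ofReal (Real.exp (X.growth K * t) / 2) := by
        gcongr
        have h0 : 0 ≤ X.rateBound * K := mul_nonneg X.rateBound_nonneg K.2
        have h1 := Real.exp_pos (X.growth K * t)
        rw [← mul_div_assoc, div_le_div_iff₀ hβ two_pos]
        have h2 : X.rateBound * K * 2 ≤ X.growth K := by unfold growth; linarith
        nlinarith
    _ = _ := by
        rw [ENNReal.ofReal_div_of_pos two_pos]
        simp only [ENNReal.ofReal_ofNat, div_eq_mul_inv]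
        ring

/-- Gronwall's lemma for the mean offspring operator. -/
theorem MomentBound.eq_zero_of_le (hK : X.MomentBound k K) (hk : 1 ≤ k) {T : ℝ} {M : ℝ≥0∞}
    (hM : M ≠ ⊤) {h : ℝ → E → ℝ≥0∞} (hbd : ∀ t, 0 ≤ t → t ≤ T → ∀ x, h t x ≤ M)
    (hle : ∀ t, 0 ≤ t → t ≤ T → ∀ x,
      h t x ≤ ∫⁻ b in {b | b.1.1 ≤ t}, ∑ i, h (t - b.1.1) (b.2.2 i) ∂(X.branchEvent x)) :
    ∀ t, 0 ≤ t → t ≤ T → ∀ x, h t x = 0 := by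
  have hβ := X.growth_pos K
  have key : ∀ n : ℕ, ∀ t, 0 ≤ t → t ≤ T → ∀ x,
      h t x ≤ M / 2 ^ n * ENNReal.ofReal (Real.exp (X.growth K * t)) := by
    intro n
    induction n with
    | zero =>
      intro t ht htT x
      refine (hbd t ht htT x).trans ?_
      simp only [pow_zero, div_one]
      refine le_mul_of_one_le_right' ?_
      rw [ENNReal.one_le_ofReal]
      exact Real.one_le_exp (by positivity)
    | succ n ih =>
      intro t ht htT x
      refine ((hle t ht htT x).trans (hK.contraction hk ht
        (fun r hr hrt y => ih r hr (hrt.trans htT) y) x)).trans_eq ?_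
      congr 1
      rw [pow_succ, div_eq_mul_inv, div_eq_mul_inv, div_eq_mul_inv, ENNReal.mul_inv (by simp)
        (by simp), mul_assoc]
  intro t ht htT x
  have hlim : Tendsto (fun n : ℕ => M / 2 ^ n * ENNReal.ofReal (Real.exp (X.growth K * t))) atTop
      (𝓝 0) := by
    have h1 : Tendsto (fun n : ℕ => M * (2⁻¹ : ℝ≥0∞) ^ n) atTop (𝓝 (M * 0)) :=
      ENNReal.Tendsto.const_mul (ENNReal.tendsto_pow_atTop_nhds_zero_of_lt_one (by simp))
        (Or.inr hM)
    have h2 := ENNReal.Tendsto.mul_const (b := ENNReal.ofReal (Real.exp (X.growth K * t))) h1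
      (Or.inr (by simp))
    simp only [mul_zero, zero_mul] at h2
    simpa [div_eq_mul_inv, ENNReal.inv_pow] using h2
  exact le_antisymm (ge_of_tendsto' hlim fun n => key n t ht htT x) (zero_le)

/-- The particles do not explode: the law has full mass. The defect `1 - law(univ)` is dominated
by its image under the mean offspring operator, since a population has full mass as soon as all
the offspring populations do; by Gronwall it vanishes. -/
theorem MomentBound.isProbabilityMeasure (hK : X.MomentBound k K) (hk : 1 ≤ k) {t : ℝ} (ht : 0 ≤ t)
    (x : E) : IsProbabilityMeasure (X.limLaw t x) := by
  have hq := X.subLaw_limLaw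
  have hfin := hq.isFinite
  -- the union bound: the defect of a product of numbers in `[0, 1]` is at most the sum of the
  -- defects
  have hone : ∀ n (m : Fin n → ℝ≥0∞), (∀ i, m i ≤ 1) → 1 ≤ ∏ i, m i + ∑ i, (1 - m i) := by
    intro n
    induction n with
    | zero => intro m _; simp
    | succ n ih =>
      intro m hm
      rw [Fin.prod_univ_succ, Fin.sum_univ_succ]
      have h1 := ih (fun i => m i.succ) fun i => hm _
      calc (1 : ℝ≥0∞) = m 0 * 1 + (1 - m 0) := by rw [mul_one, add_tsub_cancel_of_le (hm 0)]
        _ ≤ m 0 * (∏ i : Fin n, m i.succ + ∑ i : Fin n, (1 - m i.succ)) + (1 - m 0) := by gcongr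
        _ ≤ m 0 * ∏ i : Fin n, m i.succ + 1 * ∑ i : Fin n, (1 - m i.succ) + (1 - m 0) := by
            rw [mul_add]
            gcongr
            exact hm 0
        _ = _ := by ring
  have h0 := hK.eq_zero_of_le hk (T := t) (M := 1) ENNReal.one_ne_top
    (h := fun t x => 1 - X.limLaw t x Set.univ) (fun t _ _ x => tsub_le_self) (by
      intro t ht _ x
      rw [tsub_le_iff_left]
      conv_rhs => rw [X.limLaw_eq_next, next_apply hq t x MeasurableSet.univ, max_eq_left ht]
      refine (lintegral_survival_add (X := X) t ht x).symm.le.trans ?_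
      rw [add_assoc]
      refine add_le_add (by simp) ?_
      rw [← lintegral_add_left
        (by exact (Measure.measurable_coe MeasurableSet.univ).comp (measurable_family_event hq t)),
        ← setLIntegral_one]
      refine lintegral_mono fun b => ?_
      have : family X.limLaw (t - b.1.1) b.2 Set.univ =
          ∏ i, X.limLaw (t - b.1.1) (b.2.2 i) Set.univ := by
        rw [family, Measure.map_apply measurable_sum_measure MeasurableSet.univ, Set.preimage_univ,
          Measure.pi_univ]
      rw [this]
      exact hone _ _ fun i => hq.mass _ _) t ht le_rfl x
  exact ⟨le_antisymm (hq.mass t x) (tsub_eq_zero_iff_le.1 h0)⟩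

open Classical in
/-- The nonnegative version of `norm_zetaSum_le`, with the same count of injections. -/
theorem zetaSum_le {ι E : Type*} {A : Finset ι} (hA : A.Nonempty) {g : Finset ι → E → ℝ≥0∞}
    {C : ℝ≥0∞} (hC : 1 ≤ C) (hg : ∀ B, B.Nonempty → B ⊂ A → ∀ y, g B y ≤ C) (hk : A.card ≤ k)
    (c : Σ n : ℕ, (Fin n → E)) :
    zetaSum A g c ≤ numPartitions A * C ^ k * (c.1 : ℝ≥0∞) ^ k := by
  unfold zetaSum partitionTerm
  have h1 : ∀ σ ∈ (Finset.univ : Finset (Finpartition A)).filter (fun σ => σ.parts ≠ {A}),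
      ∑ e : {B // B ∈ σ.parts} ↪ Fin c.1, ∏ B : {B // B ∈ σ.parts}, g B (c.2 (e B))
        ≤ C ^ k * (c.1 : ℝ≥0∞) ^ k := by
    intro σ hσ
    have h2 : ∀ e ∈ (Finset.univ : Finset ({B // B ∈ σ.parts} ↪ Fin c.1)),
        ∏ B : {B // B ∈ σ.parts}, g B (c.2 (e B)) ≤ C ^ k := by
      intro e _
      refine (Finset.prod_le_pow_card _ _ C fun B _ => hg _ (σ.nonempty_of_mem_parts B.2)
        (block_ssubset (Finset.mem_filter.1 hσ).2 B.2) _).trans (pow_le_pow_right₀ hC ?_)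
      rw [Finset.card_univ, Fintype.card_coe]
      exact σ.card_parts_le_card.trans hk
    refine (Finset.sum_le_card_nsmul _ _ _ h2).trans ?_
    rw [nsmul_eq_mul, mul_comm, Finset.card_univ]
    gcongr
    exact_mod_cast (card_embeddings_le σ c.1).trans (card_parts_pow_le hA σ c.1 k hk)
  refine (Finset.sum_le_card_nsmul _ _ _ h1).trans ?_
  rw [nsmul_eq_mul, mul_assoc]
  gcongr
  exact (Finset.card_filter_le _ _).trans_eq (by rw [numPartitions, Finset.card_univ])

/-- Coordinates outside the range of `e` contribute their total mass, which is at most `1`; hence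
an inequality. -/
theorem SubLaw.lintegral_prod_embedding_le {q : ℝ → E → Measure (Measure E)} (hq : SubLaw q)
    {κ : Type*} [Fintype κ] {n : ℕ} (e : κ ↪ Fin n) {G : κ → Measure E → ℝ≥0∞}
    (hG : ∀ B, Measurable (G B)) (r : ℝ) (y : Fin n → E) :
    ∫⁻ ν, ∏ B, G B (ν (e B)) ∂(Measure.pi fun i => q r (y i)) ≤
      ∏ B, ∫⁻ μ, G B μ ∂(q r (y (e B))) := by
  classical
  have := hq.isFinite
  -- the factor attached to each coordinate, which is `1` outside the range of `e`
  let H : Fin n → Measure E → ℝ≥0∞ := fun i => if h : ∃ B, e B = i then G h.choose else fun _ => 1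
  have hHe : ∀ B, H (e B) = G B := by
    intro B
    have h : ∃ B', e B' = e B := ⟨B, rfl⟩
    simp only [H, dif_pos h, e.injective h.choose_spec]
  have hHn : ∀ i ∉ Set.range e, H i = fun _ => 1 := by
    intro i hi
    have h : ¬ ∃ B, e B = i := hi
    simp only [H, dif_neg h]
  have hHm : ∀ i, Measurable (H i) := by
    intro i
    by_cases h : i ∈ Set.range e
    · obtain ⟨B, rfl⟩ := h
      rw [hHe]
      exact hG B
    · rw [hHn i h]
      exact measurable_const
  have h1 : ∀ ν : Fin n → Measure E, ∏ B, G B (ν (e B)) = ∏ i, H i (ν i) := fun ν =>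
    Fintype.prod_of_injective e e.injective _ _ (fun i hi => by rw [hHn i hi])
      fun B => by rw [hHe]
  simp_rw [h1]
  rw [lintegral_pi_prod hHm]
  let T : Fin n → ℝ≥0∞ := fun i => if i ∈ Set.range e then ∫⁻ μ, H i μ ∂(q r (y i)) else 1
  calc _ ≤ ∏ i, T i := by
        refine Finset.prod_le_prod' fun i _ => ?_
        by_cases h : i ∈ Set.range e
        · simp only [T, if_pos h, le_refl]
        · simp only [T, if_neg h, hHn i h, lintegral_one]
          exact hq.mass _ _
    _ = _ := by
        symm
        refine Fintype.prod_of_injective e e.injective _ _ (fun i hi => by simp only [T, if_neg hi])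
          fun B => ?_
        simp only [T, if_pos (Set.mem_range_self B), hHe]

open Classical in
/-- Expansion of the moments of a family into the moments of its members. -/
theorem SubLaw.lintegral_family_pow_le {q : ℝ → E → Measure (Measure E)} (hq : SubLaw q)
    {ι : Type*} {A : Finset ι} (hA : A.Nonempty) (r : ℝ) (c : Σ n : ℕ, (Fin n → E)) :
    ∫⁻ μ, μ Set.univ ^ A.card ∂(family q r c) ≤
      ∑ i, ∫⁻ μ, μ Set.univ ^ A.card ∂(q r (c.2 i)) +
        zetaSum A (fun B y => ∫⁻ μ, μ Set.univ ^ B.card ∂(q r y)) c := by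
  have hm : ∀ j : ℕ, Measurable fun μ : Measure E => μ Set.univ ^ j := fun j =>
    (Measure.measurable_coe MeasurableSet.univ).pow_const j
  have h1 := sum_partitionTerm A hA (fun B y => ∫⁻ μ, μ Set.univ ^ B.card ∂(q r y)) c
  rw [← h1, SubLaw.lintegral_family r c (hm _)]
  have h2 : ∀ ν : Fin c.1 → Measure E, (∑ i, ν i) Set.univ ^ A.card =
      ∑ σ : Finpartition A, ∑ e : {B // B ∈ σ.parts} ↪ Fin c.1,
        ∏ B : {B // B ∈ σ.parts}, ν (e B) Set.univ ^ B.1.card := by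
    intro ν
    have h3 := prod_sum_eq_sum_finpartition A c.1 (fun _ i => ν i Set.univ)
    simp only [Finset.prod_const] at h3
    rw [← h3, Measure.finsetSum_apply]
  simp_rw [h2]
  have hterm : ∀ σ : Finpartition A,
      ∀ e : {B // B ∈ σ.parts} ↪ Fin c.1, Measurable fun ν : Fin c.1 → Measure E =>
        ∏ B : {B // B ∈ σ.parts}, ν (e B) Set.univ ^ B.1.card := fun σ e =>
    Finset.measurable_fun_prod _ fun B _ => (hm _).comp (measurable_pi_apply (e B))
  rw [lintegral_finsetSum _ fun σ _ => Finset.measurable_fun_sum _ fun e _ => hterm σ e]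
  refine Finset.sum_le_sum fun σ _ => ?_
  rw [lintegral_finsetSum _ fun e _ => hterm σ e]
  refine Finset.sum_le_sum fun e _ => ?_
  exact hq.lintegral_prod_embedding_le e (G := fun B μ => μ Set.univ ^ B.1.card)
    (fun B => hm _) r c.2

theorem pointMass_univ_le (z : E ⊕ Unit) : pointMass z Set.univ ≤ 1 := by
  rcases z with y | y <;> simp [pointMass]

/-- The moments of the total mass are bounded, uniformly on bounded time intervals and over the
iterates. By induction on the order `j`: the moments of lower order bound the contribution of two
or more offspring populations, and the moment of order `j` itself enters linearly, through a
contraction. -/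
theorem MomentBound.exists_lintegral_pow_le (hK : X.MomentBound k K) (hk : 1 ≤ k) (T : ℝ) (j : ℕ)
    (hj : j ≤ k) : ∃ M : NNReal, 1 ≤ M ∧ ∀ n t, t ≤ T → ∀ x,
      ∫⁻ μ, μ Set.univ ^ j ∂(X.genLaw n t x) ≤ M := by
  induction j using Nat.strong_induction_on with
  | _ j ih =>
    rcases Nat.eq_zero_or_pos j with rfl | hj0
    · exact ⟨1, le_rfl, fun n t _ x => by simpa using (X.subLaw_genLaw n).mass t x⟩
    have hm : Measurable fun μ : Measure E => μ Set.univ ^ j :=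
      (Measure.measurable_coe MeasurableSet.univ).pow_const j
    choose! M hM1 hM using fun i (hi : i < j) => ih i hi (hi.le.trans hj)
    let C : NNReal := 1 + ∑ i ∈ Finset.range j, M i
    have hC1 : (1 : ℝ≥0∞) ≤ (C : ℝ≥0∞) := by
      exact_mod_cast (le_add_of_nonneg_right (by positivity) : (1 : NNReal) ≤ C)
    have hCM : ∀ i < j, (M i : ℝ≥0∞) ≤ (C : ℝ≥0∞) := by
      intro i hi
      have : M i ≤ C := (Finset.single_le_sum (f := M) (fun _ _ => by positivity)
        (Finset.mem_range.2 hi)).trans (le_add_of_nonneg_left (by positivity))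
      exact_mod_cast this
    let Z : ℝ≥0∞ := numPartitions (Finset.univ : Finset (Fin j)) * (C : ℝ≥0∞) ^ k
    -- `a` bounds the terms without the moment of order `j`. The bound `2 * a` is preserved by the
    -- recursion, because the contraction turns it into `a`.
    let a : ℝ≥0∞ := 1 + ENNReal.ofReal X.rateBound * K * (Z * ENNReal.ofReal T)
    have ha : a ≠ ⊤ := by
      simp only [a, Z]
      finiteness
    have hβ := X.growth_pos K
    have key : ∀ n t, t ≤ T → ∀ x, ∫⁻ μ, μ Set.univ ^ j ∂(X.genLaw n t x) ≤
        2 * a * ENNReal.ofReal (Real.exp (X.growth K * max t 0)) := by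
      intro n
      induction n with
      | zero => intro t _ x; simp [genLaw]
      | succ n ihn =>
        intro t htT x
        have hq := X.subLaw_genLaw n
        rcases lt_or_ge t 0 with ht | ht
        · have hz : ∫⁻ b in {b | b.1.1 ≤ max t 0}, ∫⁻ μ, μ Set.univ ^ j ∂(family (X.genLaw n)
              (max t 0 - b.1.1) b.2) ∂(X.branchEvent x) = 0 := by
            rw [setLIntegral_measure_zero]
            rw [max_eq_right ht.le, measure_eq_zero_iff_ae_notMem]
            filter_upwards [X.ae_time_pos x] with b hb
            simpa using hb
          rw [genLaw, lintegral_next hq t x hm, hz, add_zero]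
          calc _ ≤ ∫⁻ ω, 1 ∂(X.P x) := by
                refine lintegral_mono fun ω => mul_le_one' ?_ (pow_le_one' (pointMass_univ_le _) _)
                rw [ENNReal.ofReal_le_one]
                exact X.survival_le_one (le_max_right _ _) ω
            _ = 1 * 1 := by simp
            _ ≤ _ := by
                refine mul_le_mul' ?_ ?_
                · exact (le_mul_of_one_le_left' (a := a) (by norm_num)).trans' (le_add_of_nonneg_right zero_le)
                · rw [ENNReal.one_le_ofReal]
                  exact Real.one_le_exp (by positivity)
        · rw [genLaw, lintegral_next hq t x hm, max_eq_left ht]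
          have h1 : ∫⁻ ω, ENNReal.ofReal (X.survival t ω) *
              pointMass (X.ξ t ω) Set.univ ^ j ∂(X.P x) ≤ 1 := by
            calc _ ≤ ∫⁻ ω, 1 ∂(X.P x) := by
                  refine lintegral_mono fun ω =>
                    mul_le_one' ?_ (pow_le_one' (pointMass_univ_le _) _)
                  rw [ENNReal.ofReal_le_one]
                  exact X.survival_le_one ht ω
              _ = 1 := by simp
          have h2 : ∫⁻ b in {b | b.1.1 ≤ t}, ∫⁻ μ, μ Set.univ ^ j ∂(family (X.genLaw n)
              (t - b.1.1) b.2) ∂(X.branchEvent x) ≤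
              ∫⁻ b in {b | b.1.1 ≤ t}, (Z * (b.2.1 : ℝ≥0∞) ^ k + ∑ i,
                ∫⁻ μ, μ Set.univ ^ j ∂(X.genLaw n (t - b.1.1) (b.2.2 i))) ∂(X.branchEvent x) := by
            refine lintegral_mono_ae ?_
            filter_upwards [ae_restrict_of_ae (X.ae_time_pos x)] with b hb0
            rw [add_comm]
            have hA : (Finset.univ : Finset (Fin j)).Nonempty := ⟨⟨0, hj0⟩, Finset.mem_univ _⟩
            have hexp := hq.lintegral_family_pow_le hA (t - b.1.1) b.2
            rw [Finset.card_univ, Fintype.card_fin] at hexp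
            refine hexp.trans (add_le_add le_rfl ?_)
            refine zetaSum_le hA hC1 ?_ (by simpa using hj) _
            intro B _ hBA y
            have hBc : B.card < j := by simpa using Finset.card_lt_card hBA
            exact (hM _ hBc n _ (by linarith) y).trans (hCM _ hBc)
          have h3 : ∫⁻ b in {b | b.1.1 ≤ t}, Z * (b.2.1 : ℝ≥0∞) ^ k ∂(X.branchEvent x) ≤
              ENNReal.ofReal X.rateBound * K * (Z * ENNReal.ofReal T) := by
            refine (hK.lintegral_event_le le_rfl x t (h := fun _ => Z) measurable_const).trans ?_
            gcongr
            rw [setLIntegral_const, Real.volume_Ioc, sub_zero]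
            gcongr
          have h4 := hK.contraction hk ht (h := fun t x => ∫⁻ μ, μ Set.univ ^ j ∂(X.genLaw n t x))
            (a := 2 * a) (fun r hr hrt y => by
              simpa [max_eq_left hr] using ihn r (hrt.trans htT) y) x
          have h5 : 2 * a / 2 = a := by
            rw [mul_comm]
            exact ENNReal.mul_div_cancel_right (by simp) (by simp)
          rw [h5] at h4
          have hmN : Measurable fun b : (ℝ × X.Ω) × (Σ n : ℕ, (Fin n → E)) =>
              Z * (b.2.1 : ℝ≥0∞) ^ k :=
            ((measurable_card.comp measurable_snd).pow_const k).const_mul Z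
          calc _ ≤ 1 + (ENNReal.ofReal X.rateBound * K * (Z * ENNReal.ofReal T) +
                a * ENNReal.ofReal (Real.exp (X.growth K * t))) := by
                refine add_le_add h1 (h2.trans ?_)
                rw [lintegral_add_left hmN]
                exact add_le_add h3 h4
            _ = a * 1 + a * ENNReal.ofReal (Real.exp (X.growth K * t)) := by
                rw [← add_assoc, mul_one]
            _ ≤ a * ENNReal.ofReal (Real.exp (X.growth K * t)) +
                a * ENNReal.ofReal (Real.exp (X.growth K * t)) := by
                gcongr
                rw [ENNReal.one_le_ofReal]
                exact Real.one_le_exp (by positivity)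
            _ = _ := by ring
    let M' : ℝ≥0∞ := 1 + 2 * a * ENNReal.ofReal (Real.exp (X.growth K * max T 0))
    have hM' : M' ≠ ⊤ := by
      simp only [M']
      finiteness
    refine ⟨M'.toNNReal, ?_, fun n t ht x => ?_⟩
    · rw [← ENNReal.coe_le_coe, ENNReal.coe_toNNReal hM']
      exact le_add_of_nonneg_right zero_le
    · rw [ENNReal.coe_toNNReal hM']
      refine (key n t ht x).trans ((mul_le_mul' le_rfl (ENNReal.ofReal_le_ofReal
        (Real.exp_le_exp.2 ?_))).trans (le_add_of_nonneg_left zero_le))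
      gcongr

/-- The moment bounds pass from the iterates to the law by monotone convergence. -/
theorem MomentBound.exists_limLaw_pow_le (hK : X.MomentBound k K) (hk : 1 ≤ k) (T : ℝ) {j : ℕ}
    (hj : j ≤ k) : ∃ M : NNReal, 1 ≤ M ∧ ∀ t, t ≤ T → ∀ x,
      ∫⁻ μ, μ Set.univ ^ j ∂(X.limLaw t x) ≤ M := by
  obtain ⟨M, hM1, hM⟩ := hK.exists_lintegral_pow_le hk T j hj
  refine ⟨M, hM1, fun t ht x => ?_⟩
  rw [limLaw, lintegral_iSup_measure (X.genLaw_mono t x)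
    ((Measure.measurable_coe MeasurableSet.univ).pow_const j)]
  exact iSup_le fun n => hM n t ht x

end Data

end BMP

namespace BMP

variable {E : Type u} [MeasurableSpace E]

/-! ### Complex product moments -/

/-- Normalisation `μ ↦ μ / μ(E)` as a kernel. It makes integrals against a random finite measure
measurable functions of that measure. -/
def normKernel (E : Type u) [MeasurableSpace E] : Kernel (Measure E) E where
  toFun μ := (μ Set.univ)⁻¹ • μ
  measurable' := by
    refine Measure.measurable_of_measurable_coe _ fun S hS => ?_
    simp_rw [Measure.smul_apply, smul_eq_mul]
    exact (Measure.measurable_coe MeasurableSet.univ).inv.mul (Measure.measurable_coe hS)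

theorem normKernel_univ_le (μ : Measure E) : normKernel E μ Set.univ ≤ 1 := by
  change (μ Set.univ)⁻¹ * μ Set.univ ≤ 1
  exact ENNReal.inv_mul_le_one _

instance : IsFiniteKernel (normKernel E) := ⟨1, ENNReal.one_lt_top, normKernel_univ_le⟩

/-- `∫ f dμ` for finite measures `μ`, in a form that is a measurable function of `μ`. -/
def pairing (f : E → ℂ) (μ : Measure E) : ℂ := (μ Set.univ).toReal * ∫ y, f y ∂(normKernel E μ)

theorem pairing_eq (f : E → ℂ) (μ : Measure E) [IsFiniteMeasure μ] :
    pairing f μ = ∫ y, f y ∂μ := by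
  rw [pairing]
  change ((μ Set.univ).toReal : ℂ) * ∫ y, f y ∂((μ Set.univ)⁻¹ • μ) = _
  by_cases h : μ Set.univ = 0
  · rw [Measure.measure_univ_eq_zero.1 h]
    simp
  · rw [integral_smul_measure, ENNReal.toReal_inv, Complex.real_smul, ← mul_assoc,
      ← Complex.ofReal_mul, mul_inv_cancel₀, Complex.ofReal_one, one_mul]
    exact ENNReal.toReal_ne_zero.2 ⟨h, measure_ne_top μ _⟩

theorem measurable_pairing_prod {T : Type*} [MeasurableSpace T] {g : T → E → ℂ}
    (hg : Measurable fun p : T × E => g p.1 p.2) :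
    Measurable fun p : T × Measure E => pairing (g p.1) p.2 := by
  have h1 : StronglyMeasurable fun q : (T × Measure E) × E => g q.1.1 q.2 :=
    (hg.comp ((measurable_fst.comp measurable_fst).prodMk measurable_snd)).stronglyMeasurable
  have h2 := h1.integral_kernel_prod_right'
    (κ := (normKernel E).comap (Prod.snd : T × Measure E → Measure E) measurable_snd)
  have h3 : Measurable fun p : T × Measure E => (((p.2 Set.univ).toReal : ℝ) : ℂ) :=
    Complex.measurable_ofReal.comp
      ((Measure.measurable_coe MeasurableSet.univ).comp measurable_snd).ennreal_toReal
  exact h3.mul h2.measurable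

theorem measurable_pairing {f : E → ℂ} (hf : Measurable f) : Measurable (pairing f) :=
  (measurable_pairing_prod (T := Unit) (g := fun _ => f) (hf.comp measurable_snd)).comp
    (measurable_const.prodMk measurable_id : Measurable fun μ => ((), μ))

theorem norm_pairing_le {f : E → ℂ} {C : ℝ} (hC : ∀ y, ‖f y‖ ≤ C) (hC0 : 0 ≤ C) (μ : Measure E) :
    ‖pairing f μ‖ ≤ C * (μ Set.univ).toReal := by
  rw [pairing, norm_mul, Complex.norm_real, Real.norm_of_nonneg ENNReal.toReal_nonneg, mul_comm]
  refine mul_le_mul_of_nonneg_right ?_ ENNReal.toReal_nonneg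
  refine (norm_integral_le_of_norm_le_const (ae_of_all _ hC)).trans ?_
  refine mul_le_of_le_one_right hC0 ?_
  exact ENNReal.toReal_mono ENNReal.one_ne_top (normKernel_univ_le μ)

namespace Data

variable {X : Data.{u, v} E} {k : ℕ} {K : NNReal}

theorem limLaw_max (t : ℝ) (x : E) : X.limLaw (max t 0) x = X.limLaw t x := by
  rw [X.limLaw_eq_next (max t 0) x, X.limLaw_eq_next t x, next, next]
  simp

theorem MomentBound.isProb (hK : X.MomentBound k K) (hk : 1 ≤ k) (t : ℝ) (x : E) :
    IsProbabilityMeasure (X.limLaw t x) := by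
  rw [← limLaw_max]
  exact hK.isProbabilityMeasure hk (le_max_right _ _) x

theorem MomentBound.ae_isFiniteMeasure (hK : X.MomentBound k K) (hk : 1 ≤ k) (t : ℝ) (x : E) :
    ∀ᵐ μ ∂(X.limLaw t x), IsFiniteMeasure μ := by
  obtain ⟨M, -, hM⟩ := hK.exists_limLaw_pow_le hk t hk
  have h := hM t le_rfl x
  simp only [pow_one] at h
  filter_upwards [ae_lt_top (Measure.measurable_coe MeasurableSet.univ)
    (h.trans_lt ENNReal.coe_lt_top).ne] with μ hμ
  exact ⟨hμ⟩

variable (X) in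
/-- The law as a kernel. -/
def lawKernel : Kernel (ℝ × E) (Measure E) where
  toFun p := X.limLaw p.1 p.2
  measurable' := X.subLaw_limLaw.meas

instance : IsFiniteKernel X.lawKernel :=
  ⟨1, ENNReal.one_lt_top, fun p => X.subLaw_limLaw.mass p.1 p.2⟩

variable {ι : Type*}

variable (X) in
/-- The product moments `𝔼[∏_{i ∈ A} X_t[f_i]]`. -/
def mom (f : ι → E → ℂ) (A : Finset ι) (t : ℝ) (x : E) : ℂ :=
  ∫ μ, ∏ i ∈ A, pairing (f i) μ ∂(X.limLaw t x)

variable (X) in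
/-- The expectation semigroup, for all times. -/
def sg (t : ℝ) (f : E → ℂ) (x : E) : ℂ := ∫ μ, pairing f μ ∂(X.limLaw t x)

theorem mom_singleton (f : ι → E → ℂ) (i : ι) (t : ℝ) (x : E) :
    X.mom f {i} t x = X.sg t (f i) x := by
  simp [mom, sg]

theorem measurable_prod_pairing {f : ι → E → ℂ} (hf : ∀ i, Measurable (f i)) (A : Finset ι) :
    Measurable fun μ => ∏ i ∈ A, pairing (f i) μ :=
  Finset.measurable_fun_prod _ fun i _ => measurable_pairing (hf i)

theorem norm_prod_pairing_le {f : ι → E → ℂ} {C : ℝ} (hC : ∀ i y, ‖f i y‖ ≤ C) (hC0 : 0 ≤ C)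
    (A : Finset ι) (μ : Measure E) :
    ‖∏ i ∈ A, pairing (f i) μ‖ ≤ C ^ A.card * (μ Set.univ).toReal ^ A.card := by
  rw [norm_prod, ← mul_pow]
  refine (Finset.prod_le_prod (fun _ _ => norm_nonneg _) fun i _ =>
    norm_pairing_le (hC i) hC0 μ).trans_eq ?_
  rw [Finset.prod_const]

theorem MomentBound.integrable_mass_pow (hK : X.MomentBound k K) (hk : 1 ≤ k) {j : ℕ} (hj : j ≤ k)
    (t : ℝ) (x : E) : Integrable (fun μ : Measure E => (μ Set.univ).toReal ^ j) (X.limLaw t x) := by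
  obtain ⟨M, -, hM⟩ := hK.exists_limLaw_pow_le hk t hj
  have h2 := integrable_toReal_of_lintegral_ne_top
    ((Measure.measurable_coe (α := E) MeasurableSet.univ).pow_const j).aemeasurable
    ((hM t le_rfl x).trans_lt ENNReal.coe_lt_top).ne
  simpa [ENNReal.toReal_pow] using h2

theorem MomentBound.integrable_prod_pairing (hK : X.MomentBound k K) (hk : 1 ≤ k)
    {f : ι → E → ℂ} (hf : ∀ i, Measurable (f i)) {C : ℝ} (hC : ∀ i y, ‖f i y‖ ≤ C) (hC0 : 0 ≤ C)
    {A : Finset ι} (hA : A.card ≤ k) (t : ℝ) (x : E) :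
    Integrable (fun μ => ∏ i ∈ A, pairing (f i) μ) (X.limLaw t x) :=
  ((hK.integrable_mass_pow hk hA t x).const_mul (C ^ A.card)).mono'
    (measurable_prod_pairing hf A).aestronglyMeasurable
    (ae_of_all _ fun μ => norm_prod_pairing_le hC hC0 A μ)

theorem MomentBound.exists_norm_mom_le (hK : X.MomentBound k K) (hk : 1 ≤ k) (T : ℝ)
    {C : ℝ} (hC0 : 0 ≤ C) : ∃ M : ℝ, 0 ≤ M ∧ ∀ (ι : Type) (f : ι → E → ℂ), (∀ i y, ‖f i y‖ ≤ C) →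
      ∀ A : Finset ι, A.card ≤ k → ∀ t, t ≤ T → ∀ x, ‖X.mom f A t x‖ ≤ M := by
  choose! M hM1 hM using fun j (hj : j ≤ k) => hK.exists_limLaw_pow_le hk T hj
  have hpos : ∀ j ∈ Finset.range (k + 1), 0 ≤ C ^ j * (M j : ℝ) := fun j _ => by positivity
  refine ⟨∑ j ∈ Finset.range (k + 1), C ^ j * M j, Finset.sum_nonneg hpos,
    fun ι f hC A hA t ht x => ?_⟩
  refine le_trans ?_ (Finset.single_le_sum hpos (Finset.mem_range.2 (Nat.lt_succ_of_le hA)))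
  refine (norm_integral_le_of_norm_le ((hK.integrable_mass_pow hk hA t x).const_mul (C ^ A.card))
    (ae_of_all _ fun μ => norm_prod_pairing_le hC hC0 A μ)).trans ?_
  rw [integral_const_mul]
  refine mul_le_mul_of_nonneg_left ?_ (by positivity)
  have h2 : ∫ μ : Measure E, (μ Set.univ).toReal ^ A.card ∂(X.limLaw t x) =
      (∫⁻ μ, μ Set.univ ^ A.card ∂(X.limLaw t x)).toReal := by
    rw [← integral_toReal ((Measure.measurable_coe MeasurableSet.univ).pow_const _).aemeasurable]
    · simp [ENNReal.toReal_pow]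
    · exact ae_lt_top ((Measure.measurable_coe MeasurableSet.univ).pow_const _)
        ((hM _ hA t ht x).trans_lt ENNReal.coe_lt_top).ne
  rw [h2]
  exact ENNReal.toReal_mono ENNReal.coe_ne_top (hM _ hA t ht x)

theorem measurable_mom {f : ι → E → ℂ} (hf : ∀ i, Measurable (f i)) (A : Finset ι) :
    Measurable fun p : ℝ × E => X.mom f A p.1 p.2 :=
  (StronglyMeasurable.integral_kernel (κ := X.lawKernel)
    (measurable_prod_pairing hf A).stronglyMeasurable).measurable

/-- Joint measurability of `(a, s, x) ↦ ψ_s[g_a](x)`. -/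
theorem measurable_sg {T : Type*} [MeasurableSpace T] {g : T → E → ℂ}
    (hg : Measurable fun p : T × E => g p.1 p.2) :
    Measurable fun p : T × (ℝ × E) => X.sg p.2.1 (g p.1) p.2.2 := by
  have h1 : StronglyMeasurable fun q : (T × (ℝ × E)) × Measure E => pairing (g q.1.1) q.2 :=
    ((measurable_pairing_prod hg).comp
      ((measurable_fst.comp measurable_fst).prodMk measurable_snd)).stronglyMeasurable
  exact (h1.integral_kernel_prod_right' (κ := X.lawKernel.comap
    (Prod.snd : T × (ℝ × E) → ℝ × E) measurable_snd)).measurable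

theorem MomentBound.exists_norm_sg_le (hK : X.MomentBound k K) (hk : 1 ≤ k) (T : ℝ) :
    ∃ M : ℝ, 0 ≤ M ∧ ∀ (f : E → ℂ) (C : ℝ), 0 ≤ C → (∀ y, ‖f y‖ ≤ C) →
      ∀ t, t ≤ T → ∀ x, ‖X.sg t f x‖ ≤ M * C := by
  obtain ⟨M, hM0, hM⟩ := hK.exists_limLaw_pow_le hk T hk
  refine ⟨M, by positivity, fun f C hC0 hC t ht x => ?_⟩
  refine (norm_integral_le_of_norm_le ((hK.integrable_mass_pow hk hk t x).const_mul C)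
    (ae_of_all _ fun μ => by simpa using norm_pairing_le hC hC0 μ)).trans ?_
  rw [integral_const_mul, mul_comm]
  refine mul_le_mul_of_nonneg_right ?_ hC0
  have h2 : ∫ μ : Measure E, (μ Set.univ).toReal ^ 1 ∂(X.limLaw t x) =
      (∫⁻ μ, μ Set.univ ^ 1 ∂(X.limLaw t x)).toReal := by
    rw [← integral_toReal ((Measure.measurable_coe MeasurableSet.univ).pow_const _).aemeasurable]
    · simp
    · exact ae_lt_top ((Measure.measurable_coe MeasurableSet.univ).pow_const _)
        ((hM t ht x).trans_lt ENNReal.coe_lt_top).ne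
  rw [h2]
  exact ENNReal.toReal_mono ENNReal.coe_ne_top (hM t ht x)

theorem MomentBound.sg_eq_integral (hK : X.MomentBound k K) (hk : 1 ≤ k) (t : ℝ) (f : E → ℂ)
    (x : E) : X.sg t f x = ∫ μ, (∫ y, f y ∂μ) ∂(X.limLaw t x) := by
  refine integral_congr_ae ?_
  filter_upwards [hK.ae_isFiniteMeasure hk t x] with μ hμ
  exact pairing_eq f μ

theorem MomentBound.ψ_eq (hK : X.MomentBound k K) (hk : 1 ≤ k) {t : ℝ} (ht : 0 ≤ t) (f : E → ℂ)
    (x : E) : X.ψ t f x = X.sg t f x := by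
  rw [hK.sg_eq_integral hk, ψ, X.law_eq ht]

theorem MomentBound.ψProd_eq (hK : X.MomentBound k K) (hk : 1 ≤ k) {ℓ : ℕ} {t : ℝ} (ht : 0 ≤ t)
    (f : Fin ℓ → E → ℂ) (x : E) : X.ψProd t f x = X.mom f Finset.univ t x := by
  rw [ψProd, X.law_eq ht, mom]
  refine integral_congr_ae ?_
  filter_upwards [hK.ae_isFiniteMeasure hk t x] with μ hμ
  exact Finset.prod_congr rfl fun i _ => (pairing_eq _ μ).symm

theorem MomentBound.integrable_pairing (hK : X.MomentBound k K) (hk : 1 ≤ k) {f : E → ℂ}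
    (hf : f ∈ BddFun E) (t : ℝ) (x : E) : Integrable (pairing f) (X.limLaw t x) := by
  obtain ⟨hm, C, hC⟩ := hf
  have := hK.integrable_prod_pairing hk (ι := Unit) (f := fun _ => f) (fun _ => hm) (C := max C 0)
    (fun _ y => (hC y).trans (le_max_left _ _)) (le_max_right _ _) (A := {()}) (by simpa) t x
  simpa using this

theorem integrable_of_mem_bddFun {f : E → ℂ} (hf : f ∈ BddFun E) (μ : Measure E)
    [IsFiniteMeasure μ] : Integrable f μ := by
  obtain ⟨hm, C, hC⟩ := hf
  exact (integrable_const C).mono' hm.aestronglyMeasurable (ae_of_all _ hC)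

theorem MomentBound.sg_sub (hK : X.MomentBound k K) (hk : 1 ≤ k) {f g : E → ℂ}
    (hf : f ∈ BddFun E) (hg : g ∈ BddFun E) (t : ℝ) (x : E) :
    X.sg t (fun y => f y - g y) x = X.sg t f x - X.sg t g x := by
  rw [sg, sg, sg, ← integral_sub (hK.integrable_pairing hk hf t x)
    (hK.integrable_pairing hk hg t x)]
  refine integral_congr_ae ?_
  filter_upwards [hK.ae_isFiniteMeasure hk t x] with μ hμ
  rw [pairing_eq, pairing_eq, pairing_eq, integral_sub (integrable_of_mem_bddFun hf μ)
    (integrable_of_mem_bddFun hg μ)]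

theorem sg_const_mul (c : ℂ) (f : E → ℂ) (t : ℝ) (x : E) :
    X.sg t (fun y => c * f y) x = c * X.sg t f x := by
  rw [sg, sg, ← integral_const_mul]
  refine integral_congr_ae (ae_of_all _ fun μ => ?_)
  simp only [pairing]
  rw [integral_const_mul]
  ring

end Data

end BMP

namespace BMP

/-! ### The moment equation -/

/-- Integrals over a product of probability spaces of products of functions of distinct
coordinates. -/
theorem integral_prod_embedding {S : Type*} [MeasurableSpace S] {n : ℕ} (P : Fin n → Measure S)
    [∀ i, IsProbabilityMeasure (P i)] {κ : Type*} [Fintype κ] (e : κ ↪ Fin n) {G : κ → S → ℂ}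
    (hG : ∀ B, Integrable (G B) (P (e B))) :
    Integrable (fun ν : Fin n → S => ∏ B, G B (ν (e B))) (Measure.pi P) ∧
      ∫ ν, ∏ B, G B (ν (e B)) ∂(Measure.pi P) = ∏ B, ∫ μ, G B μ ∂(P (e B)) := by
  classical
  -- the factor attached to each coordinate, which is `1` outside the range of `e`
  let H : Fin n → S → ℂ := fun i => if h : ∃ B, e B = i then G h.choose else fun _ => 1
  have hHe : ∀ B, H (e B) = G B := by
    intro B
    have h : ∃ B', e B' = e B := ⟨B, rfl⟩
    simp only [H, dif_pos h, e.injective h.choose_spec]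
  have hHn : ∀ i ∉ Set.range e, H i = fun _ => 1 := by
    intro i hi
    have h : ¬ ∃ B, e B = i := hi
    simp only [H, dif_neg h]
  have hHi : ∀ i, Integrable (H i) (P i) := by
    intro i
    by_cases h : i ∈ Set.range e
    · obtain ⟨B, rfl⟩ := h
      rw [hHe]
      exact hG B
    · rw [hHn i h]
      exact integrable_const 1
  have h1 : ∀ ν : Fin n → S, ∏ B, G B (ν (e B)) = ∏ i, H i (ν i) := fun ν =>
    Fintype.prod_of_injective e e.injective _ _ (fun i hi => by rw [hHn i hi])
      fun B => by rw [hHe]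
  simp_rw [h1]
  refine ⟨Integrable.fintype_prod hHi, ?_⟩
  rw [integral_fintype_prod_eq_prod]
  symm
  exact Fintype.prod_of_injective e e.injective _ _ (fun i hi => by simp [hHn i hi])
    fun B => by rw [hHe]

variable {E : Type u} [MeasurableSpace E]

theorem pairing_sum {n : ℕ} {f : E → ℂ} (hf : f ∈ BddFun E) (ν : Fin n → Measure E)
    (hν : ∀ i, IsFiniteMeasure (ν i)) : pairing f (∑ i, ν i) = ∑ i, pairing f (ν i) := by
  rw [pairing_eq, integral_finsetSum_measure fun i _ => Data.integrable_of_mem_bddFun hf (ν i)]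
  exact Finset.sum_congr rfl fun i _ => (pairing_eq f (ν i)).symm

theorem pairing_pointMass {f : E → ℂ} (hf : Measurable f) (z : E ⊕ Unit) :
    pairing f (pointMass z) = Sum.elim f (fun _ => 0) z := by
  rcases z with y | y
  · change pairing f (Measure.dirac y) = f y
    rw [pairing_eq, integral_dirac' _ _ hf.stronglyMeasurable]
  · change pairing f 0 = 0
    simp [pairing]

namespace Data

variable {X : Data.{u, v} E} {k : ℕ} {K : NNReal} {ι : Type}

open Classical in
/-- The branching property for moments: the offspring populations evolve independently. -/
theorem MomentBound.integral_family (hK : X.MomentBound k K) (hk : 1 ≤ k) {f : ι → E → ℂ}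
    (hf : ∀ i, Measurable (f i)) {C : ℝ} (hC : ∀ i y, ‖f i y‖ ≤ C) (hC0 : 0 ≤ C) {A : Finset ι}
    (hA : A.Nonempty) (hAk : A.card ≤ k) (r : ℝ) (c : Σ n : ℕ, (Fin n → E)) :
    ∫ μ, ∏ i ∈ A, pairing (f i) μ ∂(family X.limLaw r c) =
      ∑ i, X.mom f A r (c.2 i) + zetaSum A (fun B => X.mom f B r) c := by
  have hprob := hK.isProb hk
  rw [family, integral_map measurable_sum_measure.aemeasurable
    (measurable_prod_pairing hf A).aestronglyMeasurable]
  have h4 := sum_partitionTerm A hA (fun B => X.mom f B r) c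
  rw [← h4]
  have h1 : ∀ᵐ ν ∂(Measure.pi fun i => X.limLaw r (c.2 i)), ∏ i ∈ A, pairing (f i) (∑ j, ν j) =
      ∑ σ : Finpartition A, ∑ e : {B // B ∈ σ.parts} ↪ Fin c.1,
        ∏ B : {B // B ∈ σ.parts}, ∏ j ∈ B.1, pairing (f j) (ν (e B)) := by
    have h2 : ∀ᵐ ν ∂(Measure.pi fun i => X.limLaw r (c.2 i)), ∀ i, IsFiniteMeasure (ν i) := by
      rw [ae_all_iff]
      exact fun i => (measurePreserving_eval (fun i => X.limLaw r (c.2 i)) i).quasiMeasurePreserving.ae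
        (hK.ae_isFiniteMeasure hk r (c.2 i))
    filter_upwards [h2] with ν hν
    rw [← prod_sum_eq_sum_finpartition A c.1 fun i j => pairing (f i) (ν j)]
    exact Finset.prod_congr rfl fun i _ => pairing_sum ⟨hf i, C, hC i⟩ ν hν
  rw [integral_congr_ae h1]
  have h3 : ∀ (σ : Finpartition A) (e : {B // B ∈ σ.parts} ↪ Fin c.1), _ := fun σ e =>
    integral_prod_embedding (fun i => X.limLaw r (c.2 i)) e
      (G := fun B μ => ∏ j ∈ B.1, pairing (f j) μ) fun B =>
        hK.integrable_prod_pairing hk hf hC hC0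
          ((Finset.card_le_card (σ.le B.2)).trans hAk) r (c.2 (e B))
  rw [integral_finsetSum _ fun σ _ => integrable_finsetSum _ fun e _ => (h3 σ e).1]
  refine Finset.sum_congr rfl fun σ _ => ?_
  rw [integral_finsetSum _ fun e _ => (h3 σ e).1]
  exact Finset.sum_congr rfl fun e _ => (h3 σ e).2

variable (X) in
/-- The contribution to `ψ_t[h](x)` of the event that the first particle has not yet branched. -/
def unbranched (t : ℝ) (h : E → ℂ) (x : E) : ℂ :=
  ∫ ω, (X.survival t ω : ℂ) * Sum.elim h (fun _ => 0) (X.ξ t ω) ∂(X.P x)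

variable (X) in
/-- The law of the population after the first branching event, as a kernel. -/
def familyKernel (t : ℝ) : Kernel ((ℝ × X.Ω) × (Σ n : ℕ, (Fin n → E))) (Measure E) where
  toFun b := family X.limLaw (t - b.1.1) b.2
  measurable' := measurable_family_event X.subLaw_limLaw t

/-- Integration against the law of the population, split according to whether the first particle
has branched by time `t`. -/
theorem integral_limLaw {t : ℝ} (ht : 0 ≤ t) (x : E) {G : Measure E → ℂ} (hG : Measurable G)
    (hi : Integrable G (X.limLaw t x)) :
    ∫ μ, G μ ∂(X.limLaw t x) = ∫ ω, (X.survival t ω : ℂ) * G (pointMass (X.ξ t ω)) ∂(X.P x) +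
      ∫ b in {b | b.1.1 ≤ t}, (∫ μ, G μ ∂(family X.limLaw (t - b.1.1) b.2)) ∂(X.branchEvent x) := by
  have hp : Measurable fun ω => pointMass (X.ξ t ω) :=
    measurable_pointMass.comp (X.measurable_ξ_time _)
  have hs : Measurable fun ω => X.survival t ω :=
    X.measurable_survival.comp (measurable_const.prodMk measurable_id)
  have h0 : X.limLaw t x = ((X.P x).withDensity fun ω => ((X.survival t ω).toNNReal : ℝ≥0∞)).map
      (fun ω => pointMass (X.ξ t ω)) +
      (X.familyKernel t ∘ₖ Kernel.const Unit ((X.branchEvent x).restrict {b | b.1.1 ≤ t})) () := by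
    rw [← Measure.comp_eq_comp_const_apply]
    conv_lhs => rw [X.limLaw_eq_next, next, max_eq_left ht]
    rfl
  rw [h0] at hi ⊢
  rw [integrable_add_measure] at hi
  rw [integral_add_measure hi.1 hi.2, integral_map hp.aemeasurable hG.aestronglyMeasurable,
    integral_withDensity_eq_integral_smul hs.real_toNNReal, Kernel.integral_comp hi.2]
  congr 1
  refine integral_congr_ae (ae_of_all _ fun ω => ?_)
  simp only [NNReal.smul_def, Real.coe_toNNReal _ (X.survival_pos t ω).le, Complex.real_smul]

/-- The moments solve the equation obtained by conditioning on the first branching event. -/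
theorem MomentBound.mom_eq (hK : X.MomentBound k K) (hk : 1 ≤ k) {f : ι → E → ℂ}
    (hf : ∀ i, Measurable (f i)) {C : ℝ} (hC : ∀ i y, ‖f i y‖ ≤ C) (hC0 : 0 ≤ C) {A : Finset ι}
    (hA : A.Nonempty) (hAk : A.card ≤ k) {t : ℝ} (ht : 0 ≤ t) (x : E) :
    X.mom f A t x = X.unbranched t (fun y => ∏ i ∈ A, f i y) x +
      ∫ b in {b | b.1.1 ≤ t}, (∑ i, X.mom f A (t - b.1.1) (b.2.2 i) +
        zetaSum A (fun B => X.mom f B (t - b.1.1)) b.2) ∂(X.branchEvent x) := by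
  rw [mom, integral_limLaw ht x (measurable_prod_pairing hf A)
    (hK.integrable_prod_pairing hk hf hC hC0 hAk t x)]
  congr 1
  · refine integral_congr_ae (ae_of_all _ fun ω => ?_)
    simp only
    congr 1
    rw [Finset.prod_congr rfl fun i _ => pairing_pointMass (hf i) (X.ξ t ω)]
    rcases X.ξ t ω with y | y
    · rfl
    · exact Finset.prod_eq_zero hA.choose_spec rfl
  · refine integral_congr_ae (ae_of_all _ fun b => ?_)
    exact hK.integral_family hk hf hC hC0 hA hAk _ _

/-- A singleton has no partition other than the one into a single block. -/
theorem zetaSum_singleton {E R : Type*} [CommSemiring R] (a : ι) (g : Finset ι → E → R)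
    (c : Σ n : ℕ, (Fin n → E)) : zetaSum {a} g c = 0 := by
  classical
  unfold zetaSum
  rw [Finset.filter_false_of_mem, Finset.sum_empty]
  intro σ _
  simp only [ne_eq, not_not]
  have h1 : ∀ B ∈ σ.parts, B = {a} := fun B hB =>
    (Finset.subset_singleton_iff.1 (σ.le hB)).resolve_left (σ.nonempty_of_mem_parts hB).ne_empty
  have h2 : σ.parts.Nonempty := σ.parts_nonempty (Finset.singleton_ne_empty a)
  exact Finset.eq_singleton_iff_nonempty_unique_mem.2 ⟨h2, h1⟩

/-- The moment equation for a single factor, where no offspring populations interact. -/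
theorem MomentBound.sg_eq (hK : X.MomentBound k K) (hk : 1 ≤ k) {h : E → ℂ} (hh : h ∈ BddFun E)
    {t : ℝ} (ht : 0 ≤ t) (x : E) :
    X.sg t h x = X.unbranched t h x +
      ∫ b in {b | b.1.1 ≤ t}, ∑ i, X.sg (t - b.1.1) h (b.2.2 i) ∂(X.branchEvent x) := by
  obtain ⟨hm, C, hC⟩ := hh
  have := hK.mom_eq hk (ι := Unit) (f := fun _ => h) (fun _ => hm) (C := max C 0)
    (fun _ y => (hC y).trans (le_max_left _ _)) (le_max_right _ _) (A := {()}) (by simp) (by simpa)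
    ht x
  simpa only [mom_singleton, zetaSum_singleton, add_zero, Finset.prod_singleton] using this

theorem MomentBound.integrableOn_event (hK : X.MomentBound k K) {j : ℕ} (hj : j ≤ k) (t : ℝ) (x : E)
    {F : (ℝ × X.Ω) × (Σ n : ℕ, (Fin n → E)) → ℂ} (hF : Measurable F) {M : ℝ}
    (hM : ∀ b, 0 < b.1.1 → b.1.1 ≤ t → ‖F b‖ ≤ M * (b.2.1 : ℝ) ^ j) :
    IntegrableOn F {b | b.1.1 ≤ t} (X.branchEvent x) := by
  refine ⟨hF.aestronglyMeasurable, ?_⟩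
  have h1 := hK.lintegral_event_le hj x t (h := fun _ => ENNReal.ofReal M) measurable_const
  refine lt_of_le_of_lt ?_ (h1.trans_lt (by
    rw [setLIntegral_const, Real.volume_Ioc]
    finiteness))
  refine lintegral_mono_ae ?_
  filter_upwards [ae_restrict_of_ae (X.ae_time_pos x),
    ae_restrict_mem (X.measurableSet_time_le t)] with b hb0 hbt
  have h2 := hM b hb0 hbt
  rw [← ofReal_norm]
  refine (ENNReal.ofReal_le_ofReal h2).trans_eq ?_
  rw [ENNReal.ofReal_mul' (by positivity), ENNReal.ofReal_pow (by positivity),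
    ENNReal.ofReal_natCast]

/-- Integration over the first branching event, with the time variable outermost. -/
theorem MomentBound.setIntegral_branchEvent (hK : X.MomentBound k K) {j : ℕ} (hj : j ≤ k) (t : ℝ)
    (x : E) {F : ℝ × (Σ n : ℕ, (Fin n → E)) → ℂ} (hF : Measurable F) {M : ℝ}
    (hM : ∀ b : ℝ × (Σ n : ℕ, (Fin n → E)), 0 < b.1 → b.1 ≤ t → ‖F b‖ ≤ M * (b.2.1 : ℝ) ^ j) :
    ∫ b in {b | b.1.1 ≤ t}, F (b.1.1, b.2) ∂(X.branchEvent x) =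
      ∫ s in Set.Ioc 0 t,
        X.unbranched s (fun z => (X.γ z : ℂ) * ∫ c, F (s, c) ∂(X.offspring z)) x := by
  have hS := X.measurableSet_time_le t
  have hF' : Measurable fun b : (ℝ × X.Ω) × (Σ n : ℕ, (Fin n → E)) => F (b.1.1, b.2) :=
    hF.comp ((measurable_fst.comp measurable_fst).prodMk measurable_snd)
  have h1 := hK.integrableOn_event hj t x hF' (fun b => hM (b.1.1, b.2))
  rw [← integrable_indicator_iff hS] at h1
  rw [← integral_indicator hS]
  rw [branchEvent] at h1 ⊢
  rw [ProbabilityTheory.integral_compProd h1]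
  have h2 := h1.integral_compProd
  have hd : Measurable (Function.uncurry fun (_ : E) (p : ℝ × X.Ω) => X.branchDensity p) :=
    X.measurable_branchDensity.comp measurable_snd
  rw [branchPath, Kernel.withDensity_apply _ hd.coe_nnreal_ennreal,
    integrable_withDensity_iff_integrable_smul X.measurable_branchDensity, Kernel.prod_apply,
    Kernel.const_apply] at h2
  rw [branchPath, Kernel.integral_withDensity hd, Kernel.prod_apply, Kernel.const_apply,
    integral_prod _ h2, ← integral_indicator measurableSet_Ioi,
    ← integral_indicator measurableSet_Ioc]
  refine integral_congr_ae (ae_of_all _ fun s => ?_)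
  by_cases hs0 : 0 < s
  · by_cases hst : s ≤ t
    · rw [Set.indicator_of_mem (by exact hs0), Set.indicator_of_mem (by exact ⟨hs0, hst⟩)]
      refine integral_congr_ae (ae_of_all _ fun ω => ?_)
      have h3 : ∀ c, {b : (ℝ × X.Ω) × (Σ n : ℕ, (Fin n → E)) | b.1.1 ≤ t}.indicator
          (fun b => F (b.1.1, b.2)) ((s, ω), c) = F (s, c) := fun c =>
        Set.indicator_of_mem (by exact hst) _
      simp only [h3, Kernel.prodMkLeft_apply, Kernel.comap_apply]
      rw [branchDensity, NNReal.smul_def, Real.coe_toNNReal _ (mul_nonneg (X.rate_nonneg _)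
        (X.survival_pos _ _).le), Complex.real_smul]
      rcases X.ξ s ω with y | y
      · simp only [rate, Sum.elim_inl, offspringCem, Kernel.coe_mk, Complex.ofReal_mul]
        ring
      · simp [rate]
    · rw [Set.indicator_of_mem (by exact hs0), Set.indicator_of_notMem (by exact fun h => hst h.2)]
      have h3 : ∀ ω c, {b : (ℝ × X.Ω) × (Σ n : ℕ, (Fin n → E)) | b.1.1 ≤ t}.indicator
          (fun b => F (b.1.1, b.2)) ((s, ω), c) = 0 := fun ω c =>
        Set.indicator_of_notMem (by exact hst) _
      simp [h3]
  · rw [Set.indicator_of_notMem (by exact hs0),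
      Set.indicator_of_notMem (by exact fun h => hs0 h.1)]

end Data

end BMP

namespace BMP

namespace Data

variable {E : Type u} [MeasurableSpace E] {X : Data.{u, v} E} {k : ℕ} {K : NNReal} {ι : Type}

/-! ### The branching operator -/

variable (X) in
/-- The function `γ ζ_A[g]`. -/
def branching (A : Finset ι) (g : Finset ι → E → ℂ) (z : E) : ℂ := (X.γ z : ℂ) * X.ζ A g z

theorem ζ_eq (A : Finset ι) (g : Finset ι → E → ℂ) (z : E) :
    X.ζ A g z = ∫ c, zetaSum A g c ∂(X.offspring z) := rfl

theorem branching_congr {A : Finset ι} {g g' : Finset ι → E → ℂ}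
    (h : ∀ B, B.Nonempty → B ⊂ A → g B = g' B) : X.branching A g = X.branching A g' := by
  funext z
  rw [branching, branching, ζ_eq, ζ_eq]
  congr 2
  funext c
  exact zetaSum_congr h c

theorem branching_mul (A : Finset ι) (d : ι → ℂ) (g : Finset ι → E → ℂ) (z : E) :
    X.branching A (fun B y => (∏ j ∈ B, d j) * g B y) z = (∏ j ∈ A, d j) * X.branching A g z := by
  rw [branching, branching, ζ_eq, ζ_eq]
  simp_rw [zetaSum_mul]
  rw [integral_const_mul]
  ring

theorem measurable_branching {T : Type*} [MeasurableSpace T] {A : Finset ι}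
    {g : T → Finset ι → E → ℂ}
    (hg : ∀ B, B.Nonempty → B ⊂ A → Measurable fun p : T × E => g p.1 B p.2) :
    Measurable fun p : T × E => X.branching A (g p.1) p.2 := by
  have h1 : StronglyMeasurable fun q : (T × E) × (Σ n : ℕ, (Fin n → E)) => zetaSum A (g q.1.1) q.2 :=
    ((measurable_zetaSum hg).comp
      ((measurable_fst.comp measurable_fst).prodMk measurable_snd)).stronglyMeasurable
  have h2 := h1.integral_kernel_prod_right'
    (κ := X.offspring.comap (Prod.snd : T × E → E) measurable_snd)
  exact (Complex.measurable_ofReal.comp (X.measurable_γ.comp measurable_snd)).mul h2.measurable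

theorem MomentBound.integrable_card_pow (hK : X.MomentBound k K) {j : ℕ} (hj : j ≤ k) (z : E) :
    Integrable (fun c : (Σ n : ℕ, (Fin n → E)) => (c.1 : ℝ) ^ j) (X.offspring z) ∧
      ∫ c, (c.1 : ℝ) ^ j ∂(X.offspring z) ≤ K := by
  have h1 : ∀ c : (Σ n : ℕ, (Fin n → E)), (c.1 : ℝ) ^ j = ((c.1 : ℝ≥0∞) ^ j).toReal := by
    intro c
    simp
  have h2 : Measurable fun c : (Σ n : ℕ, (Fin n → E)) => (c.1 : ℝ≥0∞) ^ j :=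
    measurable_card.pow_const j
  simp_rw [h1]
  refine ⟨integrable_toReal_of_lintegral_ne_top h2.aemeasurable
    ((hK j hj z).trans_lt ENNReal.coe_lt_top).ne, ?_⟩
  rw [integral_toReal h2.aemeasurable (ae_lt_top h2 ((hK j hj z).trans_lt ENNReal.coe_lt_top).ne)]
  exact ENNReal.toReal_mono ENNReal.coe_ne_top (hK j hj z)

theorem MomentBound.integrable_zetaSum (hK : X.MomentBound k K) {A : Finset ι} (hA : A.Nonempty)
    (hAk : A.card ≤ k) {g : Finset ι → E → ℂ} {C : ℝ} (hC : 1 ≤ C)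
    (hgm : ∀ B, B.Nonempty → B ⊂ A → Measurable (g B))
    (hg : ∀ B, B.Nonempty → B ⊂ A → ∀ y, ‖g B y‖ ≤ C) (z : E) :
    Integrable (fun c => zetaSum A g c) (X.offspring z) := by
  refine ((hK.integrable_card_pow le_rfl z).1.const_mul _).mono' ?_
    (ae_of_all _ fun c => norm_zetaSum_le hA hC hg hAk c)
  exact ((measurable_zetaSum (T := Unit) (g := fun _ => g) fun B hB hBA =>
    (hgm B hB hBA).comp measurable_snd).comp
    (measurable_const.prodMk measurable_id : Measurable fun c => ((), c))).aestronglyMeasurable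

theorem MomentBound.norm_branching_le (hK : X.MomentBound k K) {A : Finset ι} (hA : A.Nonempty)
    (hAk : A.card ≤ k) {g : Finset ι → E → ℂ} {C : ℝ} (hC : 1 ≤ C)
    (hg : ∀ B, B.Nonempty → B ⊂ A → ∀ y, ‖g B y‖ ≤ C) (z : E) :
    ‖X.branching A g z‖ ≤ X.rateBound * (numPartitions A * (k * C ^ k * C) * K) := by
  rw [branching, norm_mul, Complex.norm_real, Real.norm_of_nonneg (X.γ_nonneg z)]
  refine mul_le_mul (X.γ_le z) ?_ (norm_nonneg _) X.rateBound_nonneg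
  refine (norm_integral_le_of_norm_le ((hK.integrable_card_pow le_rfl z).1.const_mul _)
    (ae_of_all _ fun c => norm_zetaSum_le hA hC hg hAk c)).trans ?_
  rw [integral_const_mul]
  exact mul_le_mul_of_nonneg_left (hK.integrable_card_pow le_rfl z).2 (by positivity)

theorem MomentBound.norm_branching_sub_le (hK : X.MomentBound k K) {A : Finset ι} (hA : A.Nonempty)
    (hAk : A.card ≤ k) {g g' : Finset ι → E → ℂ} {C ε : ℝ} (hC : 1 ≤ C) (hε : 0 ≤ ε)
    (hgm : ∀ B, B.Nonempty → B ⊂ A → Measurable (g B))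
    (hgm' : ∀ B, B.Nonempty → B ⊂ A → Measurable (g' B))
    (hg : ∀ B, B.Nonempty → B ⊂ A → ∀ y, ‖g B y‖ ≤ C)
    (hg' : ∀ B, B.Nonempty → B ⊂ A → ∀ y, ‖g' B y‖ ≤ C)
    (hgg : ∀ B, B.Nonempty → B ⊂ A → ∀ y, ‖g B y - g' B y‖ ≤ ε) (z : E) :
    ‖X.branching A g z - X.branching A g' z‖ ≤
      X.rateBound * (numPartitions A * (k * C ^ k * ε) * K) := by
  rw [branching, branching, ← mul_sub, norm_mul, Complex.norm_real,
    Real.norm_of_nonneg (X.γ_nonneg z), ζ_eq, ζ_eq,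
    ← integral_sub (hK.integrable_zetaSum hA hAk hC hgm hg z)
      (hK.integrable_zetaSum hA hAk hC hgm' hg' z)]
  refine mul_le_mul (X.γ_le z) ?_ (norm_nonneg _) X.rateBound_nonneg
  refine (norm_integral_le_of_norm_le ((hK.integrable_card_pow le_rfl z).1.const_mul _)
    (ae_of_all _ fun c => norm_zetaSum_sub_le hA hC hε hg hg' hgg hAk c)).trans ?_
  rw [integral_const_mul]
  exact mul_le_mul_of_nonneg_left (hK.integrable_card_pow le_rfl z).2 (by positivity)

/-! ### The many-to-few formula -/

variable (X) in
/-- The convolution `∫_0^t ψ_s[g_{t-s}](x) ds`. -/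
def duhamel (g : ℝ → E → ℂ) (t : ℝ) (x : E) : ℂ := ∫ s in Set.Ioc 0 t, X.sg s (g (t - s)) x

theorem measurable_sg_comp {S : Type*} [MeasurableSpace S] {g : ℝ → E → ℂ}
    (hg : Measurable fun p : ℝ × E => g p.1 p.2) {a b : S → ℝ} {y : S → E} (ha : Measurable a)
    (hb : Measurable b) (hy : Measurable y) : Measurable fun s => X.sg (a s) (g (b s)) (y s) := by
  have h1 := measurable_sg (X := X) (T := ℝ) (g := g) hg
  have h2 : Measurable fun s => (b s, (a s, y s)) := hb.prodMk (ha.prodMk hy)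
  have h3 := h1.comp h2
  exact h3

theorem MomentBound.integrableOn_sg (hK : X.MomentBound k K) (hk : 1 ≤ k) {g : ℝ → E → ℂ}
    (hg : Measurable fun p : ℝ × E => g p.1 p.2) {T G : ℝ} (hG0 : 0 ≤ G)
    (hG : ∀ r, r ≤ T → ∀ y, ‖g r y‖ ≤ G) {t : ℝ} (htT : t ≤ T) (x : E) :
    IntegrableOn (fun s => X.sg s (g (t - s)) x) (Set.Ioc 0 t) := by
  obtain ⟨M, hM0, hM⟩ := hK.exists_norm_sg_le hk T
  refine Measure.integrableOn_of_bounded (M := M * G) (by simp)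
    (measurable_sg_comp (X := X) (a := fun s => s) (b := fun s => t - s) (y := fun _ => x) hg
      (by fun_prop) (by fun_prop) measurable_const).aestronglyMeasurable ?_
  filter_upwards [ae_restrict_mem measurableSet_Ioc] with s hs
  exact hM _ G hG0 (hG _ (by linarith [hs.1])) s (hs.2.trans htT) x

theorem MomentBound.exists_norm_duhamel_le (hK : X.MomentBound k K) (hk : 1 ≤ k) {g : ℝ → E → ℂ}
    {T G : ℝ} (hG0 : 0 ≤ G) (hG : ∀ r, r ≤ T → ∀ y, ‖g r y‖ ≤ G) :
    ∃ M : ℝ, 0 ≤ M ∧ ∀ t, 0 ≤ t → t ≤ T → ∀ x, ‖X.duhamel g t x‖ ≤ M := by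
  obtain ⟨M, hM0, hM⟩ := hK.exists_norm_sg_le hk T
  refine ⟨M * G * |T|, by positivity, fun t ht htT x => ?_⟩
  refine (norm_setIntegral_le_of_norm_le_const (C := M * G) (by simp) fun s hs =>
    hM _ G hG0 (hG _ (by linarith [hs.1])) s (hs.2.trans htT) x).trans ?_
  refine mul_le_mul_of_nonneg_left ?_ (by positivity)
  rw [Measure.real, Real.volume_Ioc, ENNReal.toReal_ofReal (by linarith)]
  linarith [le_abs_self T]

/-- The convolution solves the equation obtained by conditioning on the first branching event.
This is the equation of `ψ_s`, integrated over `s`, after exchanging the integral over `s` with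
that over the branching event. -/
theorem MomentBound.duhamel_eq (hK : X.MomentBound k K) (hk : 1 ≤ k) {g : ℝ → E → ℂ}
    (hg : Measurable fun p : ℝ × E => g p.1 p.2) {T G : ℝ} (hG0 : 0 ≤ G)
    (hG : ∀ r, r ≤ T → ∀ y, ‖g r y‖ ≤ G) {t : ℝ} (htT : t ≤ T) (x : E) :
    X.duhamel g t x = (∫ s in Set.Ioc 0 t, X.unbranched s (g (t - s)) x) +
      ∫ b in {b | b.1.1 ≤ t}, ∑ i, X.duhamel g (t - b.1.1) (b.2.2 i) ∂(X.branchEvent x) := by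
  obtain ⟨M, hM0, hM⟩ := hK.exists_norm_sg_le hk T
  have hgr : ∀ r, Measurable (g r) := fun r => hg.comp (measurable_const.prodMk measurable_id)
  set ν := (X.branchEvent x).restrict {b | b.1.1 ≤ t} with hν
  -- the contribution of the branching event `b` to `ψ_q[g_{t-q}]`; it counts for the branching
  -- times before `q`
  let F : ℝ → (ℝ × X.Ω) × (Σ n : ℕ, (Fin n → E)) → ℂ := fun q b =>
    ∑ i, X.sg (q - b.1.1) (g (t - q)) (b.2.2 i)
  have hFm : Measurable fun p : ℝ × ((ℝ × X.Ω) × (Σ n : ℕ, (Fin n → E))) => F p.1 p.2 := by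
    have h1 : Measurable fun p : (ℝ × ℝ) × E => X.sg (p.1.1 - p.1.2) (g (t - p.1.1)) p.2 :=
      measurable_sg_comp (X := X) (S := (ℝ × ℝ) × E) (a := fun p => p.1.1 - p.1.2)
        (b := fun p => t - p.1.1) (y := Prod.snd) hg (by fun_prop) (by fun_prop) measurable_snd
    exact (measurable_sum_children (T := ℝ × ℝ)
      (h := fun p y => X.sg (p.1 - p.2) (g (t - p.1)) y) h1).comp
      ((measurable_fst.prodMk (measurable_fst.comp (measurable_fst.comp measurable_snd))).prodMk
        (measurable_snd.comp measurable_snd))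
  let S : Set (ℝ × ((ℝ × X.Ω) × (Σ n : ℕ, (Fin n → E)))) :=
    {p | 0 < p.2.1.1 ∧ p.2.1.1 ≤ p.1 ∧ p.1 ≤ t}
  have hS : MeasurableSet S := by
    have hs : Measurable fun p : ℝ × ((ℝ × X.Ω) × (Σ n : ℕ, (Fin n → E))) => p.2.1.1 :=
      measurable_fst.comp (measurable_fst.comp measurable_snd)
    exact (measurableSet_lt measurable_const hs).inter ((measurableSet_le hs measurable_fst).inter
      (measurableSet_le measurable_fst measurable_const))
  let H : ℝ × ((ℝ × X.Ω) × (Σ n : ℕ, (Fin n → E))) → ℂ := S.indicator fun p => F p.1 p.2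
  have hN : Integrable (fun b : (ℝ × X.Ω) × (Σ n : ℕ, (Fin n → E)) => M * G * (b.2.1 : ℝ)) ν := by
    have h1 := hK.integrableOn_event (j := 1) hk t x (M := 1)
      (F := fun b => ((b.2.1 : ℝ) : ℂ)) (by
        have : Measurable fun n : ℕ => ((n : ℝ) : ℂ) := measurable_of_countable _
        exact this.comp (measurable_sigma_fst.comp measurable_snd)) (by simp)
    simpa using h1.norm.const_mul (M * G)
  have hH : Integrable H ((volume.restrict (Set.Ioc 0 t)).prod ν) := by
    refine (hN.comp_snd (volume.restrict (Set.Ioc 0 t))).mono'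
      (hFm.indicator hS).aestronglyMeasurable (ae_of_all _ fun p => ?_)
    by_cases hp : p ∈ S
    · simp only [H, Set.indicator_of_mem hp, F]
      refine (norm_sum_le _ _).trans ?_
      refine (Finset.sum_le_card_nsmul _ _ (M * G) fun i _ => ?_).trans_eq ?_
      · obtain ⟨h1, h2, h3⟩ := hp
        exact hM _ G hG0 (hG _ (by linarith)) _ (by linarith) _
      · simp [mul_comm]
    · simp only [H, Set.indicator_of_notMem hp, norm_zero]
      positivity
  have h1 : ∀ q ∈ Set.Ioc 0 t, ∫ b, H (q, b) ∂ν =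
      ∫ b in {b | b.1.1 ≤ q}, F q b ∂(X.branchEvent x) := by
    intro q hq
    have hsub : {b : (ℝ × X.Ω) × (Σ n : ℕ, (Fin n → E)) | b.1.1 ≤ q} ⊆ {b | b.1.1 ≤ t} :=
      fun b hb => le_trans (by exact hb) hq.2
    rw [hν, ← Set.inter_eq_self_of_subset_right hsub, ← setIntegral_indicator
      (X.measurableSet_time_le q)]
    refine integral_congr_ae (ae_restrict_of_ae ?_)
    filter_upwards [X.ae_time_pos x] with b hb
    by_cases hbq : b.1.1 ≤ q
    · rw [Set.indicator_of_mem (by exact hbq)]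
      exact Set.indicator_of_mem (s := S) (by exact ⟨hb, hbq, hq.2⟩) _
    · rw [Set.indicator_of_notMem (by exact hbq)]
      exact Set.indicator_of_notMem (s := S) (by exact fun h => hbq h.2.1) _
  have h2 : ∀ b, 0 < b.1.1 → b.1.1 ≤ t → ∫ q in Set.Ioc 0 t, H (q, b) =
      ∑ i, X.duhamel g (t - b.1.1) (b.2.2 i) := by
    intro b hb0 hbt
    have h3 : ∀ q ∈ Set.Ioc 0 t, H (q, b) = (Set.Ici b.1.1).indicator (fun q => F q b) q := by
      intro q hq
      by_cases hbq : b.1.1 ≤ q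
      · rw [Set.indicator_of_mem (by exact hbq)]
        exact Set.indicator_of_mem (s := S) (by exact ⟨hb0, hbq, hq.2⟩) _
      · rw [Set.indicator_of_notMem (by exact hbq)]
        exact Set.indicator_of_notMem (s := S) (by exact fun h => hbq h.2.1) _
    have h4 : Set.Ioc 0 t ∩ Set.Ici b.1.1 = Set.Icc b.1.1 t := by
      ext q
      simp only [Set.mem_inter_iff, Set.mem_Ioc, Set.mem_Ici, Set.mem_Icc]
      constructor
      · rintro ⟨⟨-, h⟩, h'⟩
        exact ⟨h', h⟩
      · rintro ⟨h, h'⟩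
        exact ⟨⟨by linarith, h'⟩, h⟩
    -- shift the time variable by the branching time
    rw [setIntegral_congr_fun measurableSet_Ioc h3, setIntegral_indicator measurableSet_Ici, h4,
      integral_Icc_eq_integral_Ioc, ← intervalIntegral.integral_of_le hbt]
    have h5 := intervalIntegral.integral_comp_add_right (a := 0) (b := t - b.1.1)
      (fun q => F q b) b.1.1
    rw [zero_add, sub_add_cancel] at h5
    rw [← h5, intervalIntegral.integral_of_le (by linarith)]
    simp only [F, duhamel, add_sub_cancel_right]
    have h6 : ∀ q : ℝ, t - (q + b.1.1) = t - b.1.1 - q := fun q => by ring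
    simp only [h6]
    exact integral_finsetSum _ fun i _ => hK.integrableOn_sg hk hg hG0 hG (by linarith) _
  have hI := hK.integrableOn_sg hk hg hG0 hG htT x
  have hJ : IntegrableOn (fun q => ∫ b, H (q, b) ∂ν) (Set.Ioc 0 t) := hH.integral_prod_left
  have h7 : ∀ q ∈ Set.Ioc 0 t, X.unbranched q (g (t - q)) x =
      X.sg q (g (t - q)) x - ∫ b, H (q, b) ∂ν := by
    intro q hq
    rw [hK.sg_eq hk ⟨hgr _, G, hG _ (by linarith [hq.1])⟩ hq.1.le x, h1 q hq, add_sub_cancel_right]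
  rw [setIntegral_congr_fun measurableSet_Ioc h7, integral_sub hI hJ, duhamel,
    integral_integral_swap (f := fun q b => H (q, b)) hH]
  have h8 : ∫ b, (∫ q in Set.Ioc 0 t, H (q, b)) ∂ν =
      ∫ b in {b | b.1.1 ≤ t}, ∑ i, X.duhamel g (t - b.1.1) (b.2.2 i) ∂(X.branchEvent x) := by
    rw [hν]
    refine integral_congr_ae ?_
    filter_upwards [ae_restrict_of_ae (X.ae_time_pos x),
      ae_restrict_mem (X.measurableSet_time_le t)] with b hb0 hbt
    exact h2 b hb0 hbt
  rw [h8, sub_add_cancel]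

end Data

end BMP

namespace BMP

namespace Data

variable {E : Type u} [MeasurableSpace E] {X : Data.{u, v} E} {k : ℕ} {K : NNReal} {ι : Type}

theorem measurable_duhamel {g : ℝ → E → ℂ} (hg : Measurable fun p : ℝ × E => g p.1 p.2) :
    Measurable fun p : ℝ × E => X.duhamel g p.1 p.2 := by
  have h1 : ∀ p : ℝ × E, X.duhamel g p.1 p.2 =
      ∫ s, {q : (ℝ × E) × ℝ | 0 < q.2 ∧ q.2 ≤ q.1.1}.indicator
        (fun q => X.sg q.2 (g (q.1.1 - q.2)) q.1.2) (p, s) := by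
    intro p
    rw [duhamel, ← integral_indicator measurableSet_Ioc]
    rfl
  simp_rw [h1]
  refine (StronglyMeasurable.integral_prod_right (ν := volume) ?_).measurable
  refine Measurable.stronglyMeasurable (Measurable.indicator ?_ ?_)
  · exact measurable_sg_comp (X := X) (S := (ℝ × E) × ℝ) (a := fun q => q.2)
      (b := fun q => q.1.1 - q.2) (y := fun q => q.1.2) hg (by fun_prop) (by fun_prop)
      (measurable_snd.comp measurable_fst)
  · exact (measurableSet_lt measurable_const measurable_snd).inter
      (measurableSet_le measurable_snd (measurable_fst.comp measurable_fst))

theorem MomentBound.integrableOn_children (hK : X.MomentBound k K) (hk : 1 ≤ k) {h : ℝ → E → ℂ}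
    (hh : Measurable fun p : ℝ × E => h p.1 p.2) {T M : ℝ}
    (hM : ∀ r, 0 ≤ r → r ≤ T → ∀ y, ‖h r y‖ ≤ M) {t : ℝ} (htT : t ≤ T) (x : E) :
    IntegrableOn (fun b => ∑ i, h (t - b.1.1) (b.2.2 i)) {b | b.1.1 ≤ t} (X.branchEvent x) := by
  refine hK.integrableOn_event (j := 1) hk t x (M := M) ?_ fun b hb0 hbt => ?_
  · exact (measurable_sum_children hh).comp
      ((measurable_const.sub (measurable_fst.comp measurable_fst)).prodMk measurable_snd)
  · refine (norm_sum_le _ _).trans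
      ((Finset.sum_le_card_nsmul _ _ M fun i _ => hM _ (by linarith) (by linarith) _).trans_eq ?_)
    simp [mul_comm]

theorem prod_mem_bddFun {f : ι → E → ℂ} (hf : ∀ i, Measurable (f i)) {C : ℝ}
    (hC : ∀ i y, ‖f i y‖ ≤ C) (A : Finset ι) :
    (fun y => ∏ i ∈ A, f i y) ∈ BddFun E ∧ ∀ y, ‖∏ i ∈ A, f i y‖ ≤ C ^ A.card := by
  have h1 : ∀ y, ‖∏ i ∈ A, f i y‖ ≤ C ^ A.card := by
    intro y
    rw [norm_prod, ← Finset.prod_const]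
    exact Finset.prod_le_prod (fun _ _ => norm_nonneg _) fun i _ => hC i y
  exact ⟨⟨Finset.measurable_fun_prod _ fun i _ => hf i, _, h1⟩, h1⟩

/-- The many-to-few formula: conditioning on the first branching event after which the particles
counted by the product descend from at least two different children. It holds because both
sides solve the same linear equation, which has only one locally bounded solution. -/
theorem MomentBound.mom_eq_sg_add_duhamel (hK : X.MomentBound k K) (hk : 1 ≤ k) {f : ι → E → ℂ}
    (hf : ∀ i, Measurable (f i)) {C : ℝ} (hC : ∀ i y, ‖f i y‖ ≤ C) (hC0 : 0 ≤ C) {A : Finset ι}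
    (hA : A.Nonempty) (hAk : A.card ≤ k) {t : ℝ} (ht : 0 ≤ t) (x : E) :
    X.mom f A t x = X.sg t (fun y => ∏ i ∈ A, f i y) x +
      X.duhamel (fun r => X.branching A fun B => X.mom f B r) t x := by
  set T := t with hT
  set h : E → ℂ := fun y => ∏ i ∈ A, f i y with hh
  set g : ℝ → E → ℂ := fun r => X.branching A fun B => X.mom f B r with hg
  obtain ⟨hhb, hhC⟩ := prod_mem_bddFun hf hC A
  obtain ⟨M, hM0, hM⟩ := hK.exists_norm_mom_le hk T hC0
  have hmomC : ∀ r, r ≤ T → ∀ B : Finset ι, B ⊂ A → ∀ y, ‖X.mom f B r y‖ ≤ max 1 M :=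
    fun r hr B hB y => (hM ι f hC B ((Finset.card_le_card hB.1).trans hAk) r hr y).trans
      (le_max_right _ _)
  obtain ⟨G, hG0, hG⟩ : ∃ G : ℝ, 0 ≤ G ∧ ∀ r, r ≤ T → ∀ y, ‖g r y‖ ≤ G := by
    refine ⟨X.rateBound * (numPartitions A * (k * max 1 M ^ k * max 1 M) * K), ?_, fun r hr y =>
      hK.norm_branching_le hA hAk (le_max_left _ _) (fun B _ hB y => hmomC r hr B hB y) y⟩
    have := X.rateBound_nonneg
    positivity
  have hgm : Measurable fun p : ℝ × E => g p.1 p.2 :=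
    measurable_branching (g := fun r B => X.mom f B r) fun B _ _ => measurable_mom hf B
  have hsgm : Measurable fun p : ℝ × E => X.sg p.1 h p.2 :=
    measurable_sg_comp (X := X) (g := fun _ => h) (a := Prod.fst) (b := fun _ => 0)
      (y := Prod.snd) (hhb.1.comp measurable_snd)
      measurable_fst measurable_const measurable_snd
  obtain ⟨M1, hM10, hM1⟩ := hK.exists_norm_sg_le hk T
  obtain ⟨M2, hM20, hM2⟩ := hK.exists_norm_duhamel_le hk hG0 hG
  have hsgb : ∀ r, 0 ≤ r → r ≤ T → ∀ y, ‖X.sg r h y‖ ≤ M1 * C ^ A.card := fun r _ hr y =>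
    hM1 h _ (by positivity) hhC r hr y
  have hmb : ∀ r, 0 ≤ r → r ≤ T → ∀ y, ‖X.mom f A r y‖ ≤ M := fun r _ hr y =>
    hM ι f hC A hAk r hr y
  -- The inhomogeneous terms of the two equations cancel in the difference.
  have key : ∀ r, 0 ≤ r → r ≤ T → ∀ y,
      X.mom f A r y - (X.sg r h y + X.duhamel g r y) =
        ∫ b in {b | b.1.1 ≤ r}, ∑ i, (X.mom f A (r - b.1.1) (b.2.2 i) -
          (X.sg (r - b.1.1) h (b.2.2 i) + X.duhamel g (r - b.1.1) (b.2.2 i)))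
          ∂(X.branchEvent y) := by
    intro r hr0 hrT y
    have i1 := hK.integrableOn_children hk (h := fun r => X.mom f A r) (measurable_mom hf A) hmb
      hrT y
    have i2 := hK.integrableOn_children hk (h := fun r => X.sg r h) hsgm hsgb hrT y
    have i3 := hK.integrableOn_children hk (h := fun r => X.duhamel g r)
      (measurable_duhamel (X := X) hgm) hM2 hrT y
    let F : ℝ × (Σ n : ℕ, (Fin n → E)) → ℂ := fun b =>
      zetaSum A (fun B => X.mom f B (r - b.1)) b.2
    have hFm : Measurable F := by
      have h1 : Measurable fun p : ℝ × (Σ n : ℕ, (Fin n → E)) =>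
          zetaSum A (fun B => X.mom f B p.1) p.2 :=
            measurable_zetaSum (g := fun r B => X.mom f B r) fun B _ _ => measurable_mom hf B
      have h2 : Measurable fun b : ℝ × (Σ n : ℕ, (Fin n → E)) => (r - b.1, b.2) :=
        (measurable_const.sub measurable_fst).prodMk measurable_snd
      have h3 := h1.comp h2
      exact h3
    have hFb : ∀ b : ℝ × (Σ n : ℕ, (Fin n → E)), 0 < b.1 → b.1 ≤ r → ‖F b‖ ≤
        numPartitions A * (k * max 1 M ^ k * max 1 M) * (b.2.1 : ℝ) ^ k := fun b hb0 hbr =>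
      norm_zetaSum_le hA (le_max_left _ _) (fun B _ hB z => hmomC _ (by linarith) B hB z) hAk b.2
    have hF2 : Measurable fun b : (ℝ × X.Ω) × (Σ n : ℕ, (Fin n → E)) => F (b.1.1, b.2) := by
      have h2 : Measurable fun b : (ℝ × X.Ω) × (Σ n : ℕ, (Fin n → E)) => (b.1.1, b.2) :=
        (measurable_fst.comp measurable_fst).prodMk measurable_snd
      have h3 := hFm.comp h2
      exact h3
    have i4 : IntegrableOn (fun b => F (b.1.1, b.2)) {b | b.1.1 ≤ r} (X.branchEvent y) :=
      hK.integrableOn_event le_rfl r y hF2 fun b => hFb (b.1.1, b.2)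
    have e1 := hK.mom_eq hk hf hC hC0 hA hAk hr0 y
    have e2 := hK.sg_eq hk hhb hr0 y
    have e3 := hK.duhamel_eq hk hgm hG0 hG hrT y
    have e4 := hK.setIntegral_branchEvent le_rfl r y hFm hFb
    have e5 : ∫ b in {b | b.1.1 ≤ r}, (∑ i, X.mom f A (r - b.1.1) (b.2.2 i) +
        zetaSum A (fun B => X.mom f B (r - b.1.1)) b.2) ∂(X.branchEvent y) =
        ∫ b in {b | b.1.1 ≤ r}, ∑ i, X.mom f A (r - b.1.1) (b.2.2 i) ∂(X.branchEvent y) +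
        ∫ b in {b | b.1.1 ≤ r}, F (b.1.1, b.2) ∂(X.branchEvent y) := integral_add i1 i4
    have e6 : ∫ s in Set.Ioc 0 r, X.unbranched s (g (r - s)) y =
        ∫ b in {b | b.1.1 ≤ r}, F (b.1.1, b.2) ∂(X.branchEvent y) := e4.symm
    simp_rw [Finset.sum_sub_distrib, Finset.sum_add_distrib]
    have i5 := i2.add i3
    have e7 := integral_sub i1 i5
    simp only [Pi.add_apply] at e7
    rw [e7, integral_add i2 i3, e1, e2, e3, e5, e6]
    ring
  -- so that the difference is zero by Gronwall
  have hzero := hK.eq_zero_of_le hk (T := T)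
    (M := ENNReal.ofReal (M + (M1 * C ^ A.card + M2))) ENNReal.ofReal_ne_top
    (h := fun r y => ‖X.mom f A r y - (X.sg r h y + X.duhamel g r y)‖ₑ)
    (fun r hr0 hrT y => by
      rw [← ofReal_norm]
      refine ENNReal.ofReal_le_ofReal ((norm_sub_le _ _).trans (add_le_add (hmb r hr0 hrT y) ?_))
      exact (norm_add_le _ _).trans (add_le_add (hsgb r hr0 hrT y) (hM2 r hr0 hrT y)))
    (fun r hr0 hrT y => by
      rw [key r hr0 hrT y]
      refine (enorm_integral_le_lintegral_enorm _).trans (lintegral_mono fun b => ?_)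
      exact enorm_sum_le _ _) t ht le_rfl x
  exact sub_eq_zero.1 (enorm_eq_zero.1 hzero)

end Data

end BMP

namespace BMP

/-! ### Algebra of the nilpotent operator -/

namespace Spectrum

variable {E : Type u} [MeasurableSpace E] (D : Spectrum E) {X : Data.{u, v} E}

/-- `Φ_i` as a linear map. -/
def proj (i : Fin D.m) : Module.End ℂ (BddFun E) :=
  ∑ j ∈ Finset.Icc 1 (D.p i), ∑ k ∈ Finset.Icc 1 (D.mult i j),
    (D.φ' i j k).smulRight (D.φ i j k)

theorem proj_apply (i : Fin D.m) (f : BddFun E) : D.proj i f =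
    ∑ j ∈ Finset.Icc 1 (D.p i), ∑ k ∈ Finset.Icc 1 (D.mult i j), D.φ' i j k f • D.φ i j k := by
  simp [proj, LinearMap.sum_apply]

theorem Φ_eq_proj (i : Fin D.m) (f : BddFun E) : D.Φ i f = D.proj i f := by
  rw [proj_apply]
  rfl

variable {D}

theorem idx_of_mem {i : Fin D.m} {j k : ℕ} (hj : j ∈ Finset.Icc 1 (D.p i))
    (hk : k ∈ Finset.Icc 1 (D.mult i j)) : D.Idx i j k := by
  rw [Finset.mem_Icc] at hj hk
  exact ⟨hj.1, hj.2, hk.1, hk.2⟩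

/-- Extraction of one coefficient from a linear combination of the `φ_{l,n}^{(q)}`. -/
theorem H1.sum_coeff (hH : D.H1 X) (c : Fin D.m → ℕ → ℕ → ℂ) {i : Fin D.m} {j k : ℕ}
    (h : D.Idx i j k) :
    ∑ l, ∑ n ∈ Finset.Icc 1 (D.p l), ∑ q ∈ Finset.Icc 1 (D.mult l n),
      c l n q * D.φ' i j k (D.φ l n q) = c i j k := by
  obtain ⟨h1, h2, h3, h4⟩ := h
  have hj : j ∈ Finset.Icc 1 (D.p i) := Finset.mem_Icc.2 ⟨h1, h2⟩
  have hk : k ∈ Finset.Icc 1 (D.mult i j) := Finset.mem_Icc.2 ⟨h3, h4⟩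
  rw [Finset.sum_eq_single i, Finset.sum_eq_single j, Finset.sum_eq_single k,
    hH.dual_self i j k ⟨h1, h2, h3, h4⟩, mul_one]
  · intro q hq hne
    rw [hH.dual_ne _ _ _ _ _ _ ⟨h1, h2, h3, h4⟩ (idx_of_mem hj hq)
      (by simpa using hne.symm), mul_zero]
  · exact fun hn => absurd hk hn
  · intro n hn hne
    refine Finset.sum_eq_zero fun q hq => ?_
    rw [hH.dual_ne _ _ _ _ _ _ ⟨h1, h2, h3, h4⟩ (idx_of_mem hn hq)
      (by simp [hne.symm]), mul_zero]
  · exact fun hn => absurd hj hn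
  · intro l _ hne
    refine Finset.sum_eq_zero fun n hn => Finset.sum_eq_zero fun q hq => ?_
    rw [hH.dual_ne _ _ _ _ _ _ ⟨h1, h2, h3, h4⟩ (idx_of_mem hn hq)
      (by simp [hne.symm]), mul_zero]
  · exact fun hn => absurd (Finset.mem_univ i) hn

theorem H1.dual_proj (hH : D.H1 X) {i : Fin D.m} {j k : ℕ} (h : D.Idx i j k) (l : Fin D.m)
    (f : BddFun E) : D.φ' i j k (D.proj l f) = if l = i then D.φ' i j k f else 0 := by
  have h1 := hH.sum_coeff (fun l' n q => if l' = l then D.φ' l' n q f else 0) h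
  rw [Finset.sum_eq_single l (fun l' _ hne => by simp [hne]) (by simp)] at h1
  simp only [if_true] at h1
  rw [proj_apply]
  simp only [map_sum, map_smul, smul_eq_mul]
  rw [h1]
  by_cases hl : i = l
  · simp [hl]
  · simp [hl, Ne.symm hl]

/-- `𝒩` only sees the spectral components: the rest of `f` is annihilated by all functionals. -/
theorem H1.nil_eq_sum (hH : D.H1 X) (f : BddFun E) : D.nil f = ∑ l, D.nil (D.proj l f) := by
  have h1 : D.nil (f - ∑ l, D.proj l f) = 0 := by
    refine hH.nil_ker _ fun i j k h => ?_
    rw [map_sub, map_sum, Finset.sum_congr rfl fun l _ => hH.dual_proj h l f,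
      Finset.sum_ite_eq' Finset.univ i, if_pos (Finset.mem_univ i), sub_self]
  rwa [map_sub, sub_eq_zero, map_sum] at h1

/-- `𝒩` lowers the level `j` in the Jordan chains by one. -/
theorem H1.nil_pow_φ (hH : D.H1 X) (i : Fin D.m) : ∀ j k, D.Idx i j k → ∀ n, j ≤ n →
    (D.nil ^ n) (D.φ i j k) = 0 := by
  intro j
  induction j with
  | zero => exact fun k h => absurd h.1 (by norm_num)
  | succ j ih =>
    intro k h n hn
    obtain ⟨n, rfl⟩ : ∃ n', n = n' + 1 := ⟨n - 1, by omega⟩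
    rw [pow_succ, Module.End.mul_apply]
    rcases Nat.eq_zero_or_pos j with rfl | hj
    · rw [hH.nil_one i k h, map_zero]
    · obtain ⟨ks, -, hks⟩ := hH.nil_succ i (j + 1) (by omega) h.2.1
      obtain ⟨h1, h2, h3⟩ := hks k h.2.2.1 h.2.2.2
      rw [h3]
      exact ih _ ⟨hj, (Nat.le_succ j).trans h.2.1, h1, h2⟩ n (by omega)

theorem H1.nil_pow_proj (hH : D.H1 X) (i : Fin D.m) {n : ℕ} (hn : D.p i ≤ n) (f : BddFun E) :
    (D.nil ^ n) (D.proj i f) = 0 := by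
  rw [proj_apply]
  simp only [map_sum, map_smul]
  refine Finset.sum_eq_zero fun j hj => Finset.sum_eq_zero fun k hk => ?_
  rw [hH.nil_pow_φ i j k (idx_of_mem hj hk) n ((Finset.mem_Icc.1 hj).2.trans hn), smul_zero]

variable (D) in
/-- An exponent for which the power of `𝒩` vanishes. -/
def height : ℕ := ∑ i, D.p i

theorem p_le_height (i : Fin D.m) : D.p i ≤ D.height :=
  Finset.single_le_sum (f := D.p) (fun _ _ => Nat.zero_le _) (Finset.mem_univ i)

theorem H1.height_pos (hH : D.H1 X) : 1 ≤ D.height := (hH.p_pos 0).trans (p_le_height 0)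

theorem H1.nil_pow_height (hH : D.H1 X) : D.nil ^ D.height = 0 := by
  ext1 f
  obtain ⟨n, hn⟩ : ∃ n, D.height = n + 1 := ⟨D.height - 1, by have := hH.height_pos; omega⟩
  rw [hn, pow_succ, Module.End.mul_apply, hH.nil_eq_sum, map_sum, LinearMap.zero_apply]
  refine Finset.sum_eq_zero fun l _ => ?_
  rw [← Module.End.mul_apply, ← pow_succ, ← hn]
  exact hH.nil_pow_proj l (p_le_height l) f

theorem H1.expNil_apply (hH : D.H1 X) (t : ℝ) (f : BddFun E) :
    D.expNil t f = ∑ n ∈ Finset.range D.height,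
      ((t : ℂ) ^ n / (n.factorial : ℂ)) • (D.nil ^ n) f := by
  have h1 : ((t : ℂ) • D.nil) ^ D.height = 0 := by
    rw [smul_pow, hH.nil_pow_height, smul_zero]
  rw [expNil, IsNilpotent.exp_eq_sum h1, LinearMap.sum_apply]
  refine Finset.sum_congr rfl fun n _ => ?_
  rw [smul_pow, LinearMap.smul_apply, LinearMap.smul_apply, ← Rat.cast_smul_eq_qsmul ℂ, smul_smul]
  congr 1
  push_cast
  rw [div_eq_mul_inv, mul_comm]

theorem H1.proj_φ (hH : D.H1 X) {i : Fin D.m} {j k : ℕ} (h : D.Idx i j k) (l : Fin D.m) :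
    D.proj l (D.φ i j k) = if l = i then D.φ i j k else 0 := by
  rw [proj_apply]
  obtain ⟨h1, h2, h3, h4⟩ := h
  by_cases hl : l = i
  · subst hl
    rw [if_pos rfl, Finset.sum_eq_single j, Finset.sum_eq_single k,
      hH.dual_self _ _ _ ⟨h1, h2, h3, h4⟩, one_smul]
    · intro q hq hne
      rw [hH.dual_ne _ _ _ _ _ _ (idx_of_mem (Finset.mem_Icc.2 ⟨h1, h2⟩) hq) ⟨h1, h2, h3, h4⟩
        (by simpa using hne), zero_smul]
    · exact fun hn => absurd (Finset.mem_Icc.2 ⟨h3, h4⟩) hn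
    · intro n hn hne
      refine Finset.sum_eq_zero fun q hq => ?_
      rw [hH.dual_ne _ _ _ _ _ _ (idx_of_mem hn hq) ⟨h1, h2, h3, h4⟩ (by simp [hne]), zero_smul]
    · exact fun hn => absurd (Finset.mem_Icc.2 ⟨h1, h2⟩) hn
  · rw [if_neg hl]
    refine Finset.sum_eq_zero fun n hn => Finset.sum_eq_zero fun q hq => ?_
    rw [hH.dual_ne _ _ _ _ _ _ (idx_of_mem hn hq) ⟨h1, h2, h3, h4⟩ (by simp [hl]), zero_smul]

theorem H1.proj_nil_φ (hH : D.H1 X) {i : Fin D.m} {j k : ℕ} (h : D.Idx i j k) (l : Fin D.m) :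
    D.proj l (D.nil (D.φ i j k)) = if l = i then D.nil (D.φ i j k) else 0 := by
  rcases Nat.lt_or_ge 1 j with hj | hj
  · obtain ⟨ks, -, hks⟩ := hH.nil_succ i j hj h.2.1
    obtain ⟨h1, h2, h3⟩ := hks k h.2.2.1 h.2.2.2
    rw [h3]
    exact hH.proj_φ ⟨by omega, (Nat.sub_le j 1).trans h.2.1, h1, h2⟩ l
  · obtain rfl : j = 1 := le_antisymm hj h.1
    rw [hH.nil_one i k h, map_zero, ite_self]

/-- `𝒩` maps each of the spaces spanned by the `φ_{i,j}^{(k)}`, for fixed `i`, into itself. -/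
theorem H1.proj_nil (hH : D.H1 X) (l : Fin D.m) (f : BddFun E) :
    D.proj l (D.nil f) = D.nil (D.proj l f) := by
  have h1 : ∀ i, D.proj l (D.nil (D.proj i f)) = if i = l then D.nil (D.proj l f) else 0 := by
    intro i
    by_cases hi : i = l
    · subst hi
      rw [if_pos rfl]
      rw [proj_apply (i := i) (f := f)]
      simp only [map_sum, map_smul]
      refine Finset.sum_congr rfl fun j hj => Finset.sum_congr rfl fun k hk => ?_
      rw [hH.proj_nil_φ (idx_of_mem hj hk), if_pos rfl]
    · rw [if_neg hi, proj_apply (i := i) (f := f)]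
      simp only [map_sum, map_smul]
      refine Finset.sum_eq_zero fun j hj => Finset.sum_eq_zero fun k hk => ?_
      rw [hH.proj_nil_φ (idx_of_mem hj hk), if_neg (Ne.symm hi), smul_zero]
  rw [hH.nil_eq_sum, map_sum, Finset.sum_congr rfl fun i _ => h1 i,
    Finset.sum_ite_eq' Finset.univ l, if_pos (Finset.mem_univ l)]

theorem H1.proj_nil_pow (hH : D.H1 X) (l : Fin D.m) (n : ℕ) (f : BddFun E) :
    D.proj l ((D.nil ^ n) f) = (D.nil ^ n) (D.proj l f) := by
  induction n generalizing f with
  | zero => rfl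
  | succ n ih => rw [pow_succ, Module.End.mul_apply, Module.End.mul_apply, ih, hH.proj_nil]

/-- A component that is killed by `𝒩` lies in the first level of the Jordan chains. -/
theorem H1.proj_eq_Φ₂ (hH : D.H1 X) (i : Fin D.m) {f : BddFun E} (h : D.nil (D.proj i f) = 0) :
    D.proj i f = D.Φ₂ i 1 f := by
  -- The coefficient of `f` at `(j, k)`, `j ≥ 2`, is that of `𝒩 Φ_i[f]` at the image of the index
  -- under `𝒩`; injectivity of `k ↦ k*` separates the images within a level.
  have key : ∀ j k, D.Idx i j k → 2 ≤ j → D.φ' i j k f = 0 := by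
    intro j k hjk hj
    obtain ⟨ks, hinj, hks⟩ := hH.nil_succ i j hj hjk.2.1
    obtain ⟨h1, h2, h3⟩ := hks k hjk.2.2.1 hjk.2.2.2
    have hid : D.Idx i (j - 1) (ks k) := ⟨by omega, (Nat.sub_le j 1).trans hjk.2.1, h1, h2⟩
    have h4 : D.φ' i (j - 1) (ks k) (D.nil (D.proj i f)) = D.φ' i j k f := by
      rw [proj_apply]
      simp only [map_sum, map_smul, smul_eq_mul]
      rw [Finset.sum_eq_single j, Finset.sum_eq_single k, h3, hH.dual_self _ _ _ hid, mul_one]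
      · intro q hq hne
        obtain ⟨g1, g2, g3⟩ := hks q (Finset.mem_Icc.1 hq).1 (Finset.mem_Icc.1 hq).2
        rw [g3, hH.dual_ne _ _ _ _ _ _ hid ⟨hid.1, hid.2.1, g1, g2⟩, mul_zero]
        simp only [ne_eq, Prod.mk.injEq, true_and]
        exact fun he => hne (hinj (Finset.mem_Icc.1 hq) ⟨hjk.2.2.1, hjk.2.2.2⟩ he.symm)
      · exact fun hn => absurd (Finset.mem_Icc.2 ⟨hjk.2.2.1, hjk.2.2.2⟩) hn
      · intro n hn hne
        refine Finset.sum_eq_zero fun q hq => ?_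
        have hn' := Finset.mem_Icc.1 hn
        rcases Nat.lt_or_ge 1 n with hn1 | hn1
        · obtain ⟨ks', -, hks'⟩ := hH.nil_succ i n hn1 hn'.2
          obtain ⟨g1, g2, g3⟩ := hks' q (Finset.mem_Icc.1 hq).1 (Finset.mem_Icc.1 hq).2
          rw [g3, hH.dual_ne _ _ _ _ _ _ hid ⟨by omega, (Nat.sub_le n 1).trans hn'.2, g1, g2⟩,
            mul_zero]
          simp only [ne_eq, Prod.mk.injEq, true_and, not_and]
          intro he
          omega
        · obtain rfl : n = 1 := le_antisymm hn1 hn'.1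
          rw [hH.nil_one i q (idx_of_mem hn hq), map_zero, mul_zero]
      · exact fun hn => absurd (Finset.mem_Icc.2 ⟨hjk.1, hjk.2.1⟩) hn
    rw [← h4, h, map_zero]
  rw [proj_apply, Finset.sum_eq_single 1]
  · rfl
  · intro j hj hne
    have hj' := Finset.mem_Icc.1 hj
    refine Finset.sum_eq_zero fun k hk => ?_
    rw [key j k (idx_of_mem hj hk) (by omega), zero_smul]
  · exact fun hn => absurd (Finset.mem_Icc.2 ⟨le_rfl, hH.p_pos i⟩) hn

/-- The operators `𝒩^n Φ_i` are bounded. -/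
theorem H1.exists_bound_nil_proj (hH : D.H1 X) (i : Fin D.m) (n : ℕ) : ∃ C : ℝ, 0 ≤ C ∧
    ∀ f : BddFun E, (∀ y, ‖f.1 y‖ ≤ 1) → ∀ x, ‖((D.nil ^ n) (D.proj i f)).1 x‖ ≤ C := by
  choose! C hC using fun j k (h : D.Idx i j k) => hH.bounded i j k h
  choose C' hC' using fun j k => ((D.nil ^ n) (D.φ i j k)).2.2
  refine ⟨∑ j ∈ Finset.Icc 1 (D.p i), ∑ k ∈ Finset.Icc 1 (D.mult i j), |C j k| * |C' j k|,
    by positivity, fun f hf x => ?_⟩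
  rw [proj_apply]
  simp only [map_sum, map_smul]
  rw [Submodule.coe_sum, Finset.sum_apply]
  refine (norm_sum_le _ _).trans (Finset.sum_le_sum fun j hj => ?_)
  rw [Submodule.coe_sum, Finset.sum_apply]
  refine (norm_sum_le _ _).trans (Finset.sum_le_sum fun k hk => ?_)
  change ‖D.φ' i j k f * ((D.nil ^ n) (D.φ i j k)).1 x‖ ≤ _
  rw [norm_mul]
  exact mul_le_mul ((hC j k (idx_of_mem hj hk) f hf).trans (le_abs_self _))
    ((hC' j k x).trans (le_abs_self _)) (norm_nonneg _) (abs_nonneg _)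

/-! ### The functions in the critical eigenspaces -/

/-- A function belongs to at most one of the sets `Ei(λ_i)`: of two of them, the one with the
smaller real part excludes the other. -/
theorem H1.ν_eq (hH : D.H1 X) {f : BddFun E} {i : Fin D.m} (hf : f ∈ D.Ei i) : D.ν f = i := by
  have huniq : ∀ i j, f ∈ D.Ei i → f ∈ D.Ei j → (D.eig i).re ≤ (D.eig j).re → j = i := by
    intro i j hi hj hle
    by_contra hne
    exact hi.2 j hle (fun he => hne (hH.eig_injective he)) hj.1
  have hex : ∃ i, f ∈ D.Ei i := ⟨i, hf⟩
  rw [ν, dif_pos hex]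
  rcases le_total (D.eig i).re (D.eig hex.choose).re with h | h
  · exact huniq _ _ hf hex.choose_spec h
  · exact (huniq _ _ hex.choose_spec hf h).symm

theorem H1.mem_ei_ν (hH : D.H1 X) {f : BddFun E} (hf : f ∈ D.EiCrit) :
    f ∈ D.Ei (D.ν f) ∧ 2 * (D.lam f).re = D.lam1 := by
  obtain ⟨i, hi, hfi⟩ := hf
  have := hH.ν_eq hfi
  rw [lam, this]
  exact ⟨hfi, hi⟩

theorem proj_eq_zero_of_mem_ei {f : BddFun E} {i : Fin D.m} (hH : D.H1 X) (hf : f ∈ D.Ei i)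
    {l : Fin D.m} (hl : l ≠ i) (hre : (D.eig i).re ≤ (D.eig l).re) : D.proj l f = 0 := by
  have h1 : f ∉ D.EiStar l := hf.2 l hre fun he => hl (hH.eig_injective he)
  simp only [EiStar, Set.mem_ofPred_eq, not_exists, not_and, not_not] at h1
  rw [← Φ_eq_proj, Φ]
  exact Finset.sum_eq_zero fun j hj => h1 j (Finset.mem_Icc.1 hj).1 (Finset.mem_Icc.1 hj).2

/-- The set whose supremum defines `p(f)` is nonempty and bounded by `height`, so that `p(f)` is
its maximum. -/
theorem H1.pOf_spec (hH : D.H1 X) {f : BddFun E} (hf : f ∈ D.EiCrit) :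
    1 ≤ D.pOf f ∧ D.pOf f ≤ D.height ∧ (D.nil ^ D.pOf f) f = 0 := by
  obtain ⟨i, -, ⟨j, -, -, hj⟩, -⟩ := hf
  have hf0 : f ≠ 0 := by
    rintro rfl
    exact hj (by simp [Φ₂])
  set S : Set ℕ := {i : ℕ | 1 ≤ i ∧ (D.nil ^ (i - 1)) f ≠ 0} with hS
  have hbd : ∀ n ∈ S, n ≤ D.height := by
    rintro n ⟨hn1, hn⟩
    by_contra! hlt
    refine hn ?_
    obtain ⟨d, hd⟩ := Nat.exists_eq_add_of_le (Nat.le_sub_one_of_lt hlt)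
    rw [hd, pow_add, hH.nil_pow_height, zero_mul, LinearMap.zero_apply]
  have h1 : 1 ∈ S := ⟨le_rfl, by simpa using hf0⟩
  have hBdd : BddAbove S := ⟨D.height, hbd⟩
  refine ⟨le_csSup hBdd h1, csSup_le ⟨1, h1⟩ hbd, ?_⟩
  by_contra hne
  have : D.pOf f + 1 ∈ S := ⟨by omega, by simpa using hne⟩
  have := le_csSup hBdd this
  change D.pOf f + 1 ≤ D.pOf f at this
  omega

end Spectrum

end BMP

namespace BMP

/-! ### Uniform rates of convergence -/

/-- A bound that tends to `0` as `t → ∞`. Uniform convergence, with uniform boundedness for all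
`t ≥ 0`, is expressed by such bounds. They are decreasing so that they are measurable and
bounded on `[0, ∞)` by their value at `0`. -/
structure IsRate (ε : ℝ → ℝ) : Prop where
  anti : Antitone ε
  nonneg : ∀ t, 0 ≤ ε t
  lim : Tendsto ε atTop (𝓝 0)

namespace IsRate

variable {ε ε' : ℝ → ℝ}

theorem zero : IsRate fun _ => 0 := ⟨antitone_const, fun _ => le_rfl, tendsto_const_nhds⟩

theorem add (h : IsRate ε) (h' : IsRate ε') : IsRate fun t => ε t + ε' t :=
  ⟨h.anti.add h'.anti, fun t => add_nonneg (h.nonneg t) (h'.nonneg t), by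
    simpa using h.lim.add h'.lim⟩

theorem const_mul (h : IsRate ε) {c : ℝ} (hc : 0 ≤ c) : IsRate fun t => c * ε t :=
  ⟨h.anti.const_mul hc, fun t => mul_nonneg hc (h.nonneg t), by simpa using h.lim.const_mul c⟩

theorem sum {α : Type*} (s : Finset α) {ε : α → ℝ → ℝ} (h : ∀ a ∈ s, IsRate (ε a)) :
    IsRate fun t => ∑ a ∈ s, ε a t := by
  classical
  induction s using Finset.induction_on with
  | empty => simpa using zero
  | insert a s ha ih =>
    simp_rw [Finset.sum_insert ha]
    exact (h a (Finset.mem_insert_self a s)).add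
      (ih fun b hb => h b (Finset.mem_insert_of_mem hb))

theorem measurable (h : IsRate ε) : Measurable ε := h.anti.measurable

theorem le_zero (h : IsRate ε) {t : ℝ} (ht : 0 ≤ t) : ε t ≤ ε 0 := h.anti ht

end IsRate

/-- Uniform local boundedness and uniform smallness for large times give a rate: the supremum over
all members and all later times. -/
theorem exists_isRate {α : Type*} (F : α → ℝ → ℝ)
    (hloc : ∀ T, ∃ M, ∀ a t, 0 ≤ t → t ≤ T → F a t ≤ M)
    (hlim : ∀ δ, 0 < δ → ∃ T, ∀ a t, T ≤ t → F a t ≤ δ) :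
    ∃ ε, IsRate ε ∧ ∀ a t, 0 ≤ t → F a t ≤ ε t := by
  let S : ℝ → Set ℝ := fun t => insert 0 {y | ∃ a s, 0 ≤ s ∧ t ≤ s ∧ y = F a s}
  have hbdd : ∀ t, BddAbove (S t) := by
    intro t
    obtain ⟨T, hT⟩ := hlim 1 one_pos
    obtain ⟨M, hM⟩ := hloc T
    refine ⟨max (max M 1) 0, ?_⟩
    rintro y (rfl | ⟨a, s, hs0, -, rfl⟩)
    · exact le_max_right _ _
    · refine le_trans ?_ (le_max_left _ _)
      rcases le_total s T with h | h
      · exact (hM a s hs0 h).trans (le_max_left _ _)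
      · exact (hT a s h).trans (le_max_right _ _)
  have hne : ∀ t, (S t).Nonempty := fun t => ⟨0, Set.mem_insert _ _⟩
  have hnn : ∀ t, 0 ≤ sSup (S t) := fun t => le_csSup (hbdd t) (Set.mem_insert _ _)
  refine ⟨fun t => sSup (S t), ⟨?_, hnn, ?_⟩, ?_⟩
  · intro t t' htt
    refine csSup_le_csSup (hbdd t) (hne t') (Set.insert_subset_insert ?_)
    rintro y ⟨a, s, hs0, hs, rfl⟩
    exact ⟨a, s, hs0, htt.trans hs, rfl⟩
  · rw [Metric.tendsto_atTop]
    intro δ hδ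
    obtain ⟨T, hT⟩ := hlim (δ / 2) (by linarith)
    refine ⟨T, fun t ht => ?_⟩
    rw [Real.dist_eq, sub_zero, abs_of_nonneg (hnn t)]
    refine lt_of_le_of_lt (csSup_le (hne t) ?_) (half_lt_self hδ)
    rintro y (rfl | ⟨a, s, -, hs, rfl⟩)
    · linarith
    · exact hT a s (ht.trans hs)
  · intro a t ht
    exact le_csSup (hbdd t) (Set.mem_insert_of_mem _ ⟨a, t, ht, le_rfl, rfl⟩)

theorem exists_isRate_of_tendsto {g : ℝ → ℝ} (hg : ContinuousOn g (Set.Ici 0))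
    (hlim : Tendsto g atTop (𝓝 0)) : ∃ ε, IsRate ε ∧ ∀ t, 0 ≤ t → g t ≤ ε t := by
  obtain ⟨ε, hε, h⟩ := exists_isRate (fun _ : Unit => g) (fun T => by
    obtain ⟨M, hM⟩ := (isCompact_Icc.image_of_continuousOn
      (hg.mono fun x (hx : x ∈ Set.Icc 0 T) => hx.1)).bddAbove
    exact ⟨M, fun _ t h0 hT => hM ⟨t, ⟨h0, hT⟩, rfl⟩⟩) (fun δ hδ => by
    obtain ⟨T, hT⟩ := eventually_atTop.1 (hlim.eventually_le_const hδ)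
    exact ⟨T, fun _ t ht => hT t ht⟩)
  exact ⟨ε, hε, fun t ht => h () t ht⟩

theorem tendsto_pow_mul_exp_neg (n : ℕ) {δ : ℝ} (hδ : 0 < δ) :
    Tendsto (fun t : ℝ => t ^ n * Real.exp (-(δ * t))) atTop (𝓝 0) := by
  have h1 := (Real.tendsto_pow_mul_exp_neg_atTop_nhds_zero n).comp
    (tendsto_id.const_mul_atTop hδ)
  have h2 := h1.const_mul ((δ ^ n)⁻¹)
  rw [mul_zero] at h2
  refine h2.congr fun t => ?_
  simp only [Function.comp_apply, id_eq, mul_pow]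
  field_simp

theorem tendsto_pow_div_one_add_pow {n q : ℕ} (h : n ≤ q) :
    Tendsto (fun t : ℝ => t ^ n / (1 + t) ^ q - if n = q then 1 else 0) atTop (𝓝 0) := by
  have h0 : Tendsto (fun t : ℝ => (1 + t)⁻¹) atTop (𝓝 0) :=
    tendsto_inv_atTop_zero.comp (tendsto_atTop_add_const_left _ 1 tendsto_id)
  have h1 : Tendsto (fun t : ℝ => t / (1 + t)) atTop (𝓝 1) := by
    have h2 : Tendsto (fun t : ℝ => 1 - (1 + t)⁻¹) atTop (𝓝 1) := by simpa using h0.const_sub 1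
    refine h2.congr' ?_
    filter_upwards [eventually_ge_atTop 0] with t ht
    have : (1 + t) ≠ 0 := by positivity
    field_simp
    ring
  have h3 : Tendsto (fun t : ℝ => (t / (1 + t)) ^ n * (1 + t)⁻¹ ^ (q - n)) atTop
      (𝓝 (if n = q then 1 else 0)) := by
    have := (h1.pow n).mul (h0.pow (q - n))
    rw [one_pow, one_mul] at this
    convert this using 2
    rcases h.eq_or_lt with rfl | hlt
    · simp
    · rw [if_neg hlt.ne, zero_pow (by omega)]
  have h4 := h3.sub_const (if n = q then (1 : ℝ) else 0)
  rw [sub_self] at h4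
  refine h4.congr' ?_
  filter_upwards [eventually_ge_atTop 0] with t ht
  have : (1 + t) ≠ 0 := by positivity
  obtain ⟨d, rfl⟩ := Nat.exists_eq_add_of_le h
  have e : (t / (1 + t)) ^ n * (1 + t)⁻¹ ^ d = t ^ n / (1 + t) ^ (n + d) := by
    rw [div_pow, inv_pow, pow_add]
    field_simp
  rw [Nat.add_sub_cancel_left, e]

namespace Spectrum

variable {E : Type u} [MeasurableSpace E] {D : Spectrum E} {X : Data.{u, v} E} {k : ℕ} {K : NNReal}

/-- The spectral expansion of the semigroup, for the semigroup at all times. -/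
theorem H1.eventually_remainder_le (hH : D.H1 X) (hK : X.MomentBound k K) (hk : 1 ≤ k)
    (i : Fin D.m) {δ : ℝ} (hδ : 0 < δ) : ∀ᶠ t : ℝ in atTop, ∀ f : BddFun E, (∀ y, ‖f.1 y‖ ≤ 1) →
      ∀ x, Real.exp (-(D.eig i).re * t) * ‖X.sg t f.1 x -
        ∑ l, Complex.exp (D.eig l * t) * (D.expNil t (D.proj l f)).1 x‖ ≤ δ := by
  obtain ⟨last, hlast⟩ : ∃ last : Fin D.m, ∀ i, i ≤ last := by
    have : Nonempty (Fin D.m) := ⟨0⟩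
    exact Finite.exists_max id
  have h1 := hH.asymptotics last hlast
  filter_upwards [h1.eventually_le_const (ENNReal.ofReal_pos.2 hδ), eventually_ge_atTop 0]
    with t ht ht0 f hf x
  have h2 := ((le_iSup_of_le x (le_iSup_of_le f (le_iSup_of_le hf le_rfl))).trans ht)
  rw [← ofReal_norm, ENNReal.ofReal_le_ofReal_iff hδ.le, norm_mul, Complex.norm_real,
    Real.norm_of_nonneg (Real.exp_pos _).le, hK.ψ_eq hk ht0] at h2
  simp_rw [Φ_eq_proj] at h2
  refine le_trans (mul_le_mul_of_nonneg_right (Real.exp_le_exp.2 ?_) (norm_nonneg _)) h2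
  have := mul_le_mul_of_nonneg_right (hH.re_anti i last (hlast i)) ht0
  linarith

theorem norm_cexp_mul_ofReal (z : ℂ) (t : ℝ) : ‖Complex.exp (z * t)‖ = Real.exp (z.re * t) := by
  rw [Complex.norm_exp]
  simp

/-- Asymptotics of the semigroup on functions whose leading component is `Φ_i[f]`, with
`𝒩^p Φ_i[f] = 0`. -/
theorem H1.exists_rate_sg (hH : D.H1 X) (hK : X.MomentBound k K) (hk : 1 ≤ k)
    (i : Fin D.m) {p : ℕ} (hp : 1 ≤ p) (hpP : p ≤ D.height) : ∃ ε, IsRate ε ∧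
      ∀ f : BddFun E, (∀ y, ‖f.1 y‖ ≤ 1) →
      (∀ l, l ≠ i → (D.eig i).re ≤ (D.eig l).re → D.proj l f = 0) →
      (D.nil ^ p) (D.proj i f) = 0 → ∀ t : ℝ, 0 ≤ t → ∀ x,
      ‖Complex.exp (-D.eig i * t) * (((1 + t) ^ (p - 1))⁻¹ : ℝ) * X.sg t f.1 x -
        ((p - 1).factorial : ℂ)⁻¹ * ((D.nil ^ (p - 1)) (D.proj i f)).1 x‖ ≤ ε t := by
  choose C hC0 hC using fun l n => hH.exists_bound_nil_proj l n
  let α := {f : BddFun E // (∀ y, ‖f.1 y‖ ≤ 1) ∧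
    (∀ l, l ≠ i → (D.eig i).re ≤ (D.eig l).re → D.proj l f = 0) ∧
    (D.nil ^ p) (D.proj i f) = 0} × E
  have hpow : ∀ t : ℝ, 0 ≤ t → ((1 + t) ^ (p - 1))⁻¹ ≤ 1 := fun t ht =>
    inv_le_one_of_one_le₀ (one_le_pow₀ (by linarith))
  have hpow0 : ∀ t : ℝ, 0 ≤ t → 0 ≤ ((1 + t) ^ (p - 1))⁻¹ := fun t ht => by positivity
  let F : α → ℝ → ℝ := fun a t =>
    ‖Complex.exp (-D.eig i * t) * (((1 + t) ^ (p - 1))⁻¹ : ℝ) * X.sg t a.1.1.1 a.2 -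
      ((p - 1).factorial : ℂ)⁻¹ * ((D.nil ^ (p - 1)) (D.proj i a.1.1)).1 a.2‖
  suffices hF : (∀ T, ∃ M, ∀ a t, 0 ≤ t → t ≤ T → F a t ≤ M) ∧
      ∀ δ, 0 < δ → ∃ T, ∀ a t, T ≤ t → F a t ≤ δ by
    obtain ⟨ε, hε, h⟩ := exists_isRate F hF.1 hF.2
    exact ⟨ε, hε, fun f h1 h2 h3 t ht x => h (⟨f, h1, h2, h3⟩, x) t ht⟩
  constructor
  · intro T
    obtain ⟨M, hM0, hM⟩ := hK.exists_norm_sg_le hk T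
    refine ⟨Real.exp (|(D.eig i).re| * T) * M + C i (p - 1), ?_⟩
    rintro ⟨⟨f, h1, h2, h3⟩, x⟩ t ht0 htT
    refine (norm_sub_le _ _).trans (add_le_add ?_ ?_)
    · rw [norm_mul, norm_mul, norm_cexp_mul_ofReal, Complex.norm_real,
        Real.norm_of_nonneg (hpow0 t ht0)]
      refine mul_le_mul ?_ ((hM f.1 1 zero_le_one h1 t htT x).trans_eq (mul_one M)) (norm_nonneg _)
        (by positivity)
      refine (mul_le_of_le_one_right (Real.exp_pos _).le (hpow t ht0)).trans ?_
      refine Real.exp_le_exp.2 (mul_le_mul ?_ htT ht0 (abs_nonneg _))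
      rw [Complex.neg_re]
      exact neg_le_abs _
    · rw [norm_mul, norm_inv, Complex.norm_natCast]
      refine (mul_le_of_le_one_left (norm_nonneg _) (inv_le_one_of_one_le₀ ?_)).trans
        (hC i (p - 1) f h1 x)
      exact_mod_cast (Nat.factorial_pos _)
  · -- the three contributions: the remainder, the smaller eigenvalues, and the powers of `t`
    -- other than the leading one
    let S : Finset (Fin D.m) := Finset.univ.filter fun l => (D.eig l).re < (D.eig i).re
    let B : ℝ → ℝ := fun t =>
      ∑ l ∈ S, ∑ n ∈ Finset.range D.height,
        C l n * (t ^ n * Real.exp (-(((D.eig i).re - (D.eig l).re) * t))) +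
      ∑ n ∈ Finset.range p, C i n * |t ^ n / (1 + t) ^ (p - 1) - if n = p - 1 then 1 else 0|
    have hB : Tendsto B atTop (𝓝 0) := by
      have h1 : Tendsto (fun t : ℝ => ∑ l ∈ S, ∑ n ∈ Finset.range D.height,
          C l n * (t ^ n * Real.exp (-(((D.eig i).re - (D.eig l).re) * t)))) atTop
          (𝓝 (∑ l ∈ S, ∑ n ∈ Finset.range D.height, C l n * 0)) := by
        refine tendsto_finsetSum _ fun l hl => tendsto_finsetSum _ fun n _ => ?_
        exact (tendsto_pow_mul_exp_neg n (sub_pos.2 (Finset.mem_filter.1 hl).2)).const_mul _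
      have h2 : Tendsto (fun t : ℝ => ∑ n ∈ Finset.range p,
          C i n * |t ^ n / (1 + t) ^ (p - 1) - if n = p - 1 then 1 else 0|) atTop
          (𝓝 (∑ n ∈ Finset.range p, C i n * |0|)) := by
        refine tendsto_finsetSum _ fun n hn => ?_
        exact (tendsto_pow_div_one_add_pow
          (Nat.le_sub_one_of_lt (Finset.mem_range.1 hn))).abs.const_mul _
      simpa using h1.add h2
    intro δ hδ
    have hev := (hH.eventually_remainder_le hK hk i (half_pos hδ)).and
      ((hB.eventually_le_const (half_pos hδ)).and (eventually_ge_atTop 0))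
    obtain ⟨T, hT⟩ := eventually_atTop.1 hev
    refine ⟨T, ?_⟩
    rintro ⟨⟨f, h1, h2, h3⟩, x⟩ t ht
    obtain ⟨hr, hb, ht0⟩ := hT t ht
    have hr := hr f h1 x
    set R : ℂ := X.sg t f.1 x -
        ∑ l, Complex.exp (D.eig l * t) * (D.expNil t (D.proj l f)).1 x with hR
    have hfac : ∀ n : ℕ, ‖((n.factorial : ℂ))⁻¹‖ ≤ 1 := fun n => by
      rw [norm_inv, Complex.norm_natCast]
      exact inv_le_one_of_one_le₀ (by exact_mod_cast (Nat.factorial_pos _))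
    set V : Fin D.m → ℕ → ℂ := fun l n => (n.factorial : ℂ)⁻¹ * ((D.nil ^ n) (D.proj l f)).1 x
      with hV
    have hVC : ∀ l n, ‖V l n‖ ≤ C l n := fun l n => by
      rw [hV, norm_mul]
      exact (mul_le_of_le_one_left (norm_nonneg _) (hfac n)).trans (hC l n f h1 x)
    have hexp : ∀ l, (D.expNil t (D.proj l f)).1 x =
        ∑ n ∈ Finset.range D.height, (t : ℂ) ^ n * V l n := by
      intro l
      rw [hH.expNil_apply, Submodule.coe_sum, Finset.sum_apply]
      refine Finset.sum_congr rfl fun n _ => ?_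
      change ((t : ℂ) ^ n / (n.factorial : ℂ)) * ((D.nil ^ n) (D.proj l f)).1 x = _
      rw [hV]
      ring
    set w : ℂ := ((((1 + t) ^ (p - 1))⁻¹ : ℝ) : ℂ) with hw
    have hwn : ‖w‖ ≤ 1 := by
      rw [hw, Complex.norm_real, Real.norm_of_nonneg (hpow0 t ht0)]
      exact hpow t ht0
    have hi : w * (D.expNil t (D.proj i f)).1 x - V i (p - 1) = ∑ n ∈ Finset.range p,
        ((t ^ n / (1 + t) ^ (p - 1) - if n = p - 1 then 1 else 0 : ℝ) : ℂ) * V i n := by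
      rw [hexp i, ← Finset.sum_subset (Finset.range_subset_range.2 hpP)]
      · have hterm : ∀ n, ((t ^ n / (1 + t) ^ (p - 1) - if n = p - 1 then 1 else 0 : ℝ) : ℂ) *
            V i n = w * ((t : ℂ) ^ n * V i n) - if n = p - 1 then V i n else 0 := by
          intro n
          rw [hw]
          split_ifs <;> (push_cast; ring)
        simp_rw [hterm]
        rw [Finset.sum_sub_distrib, ← Finset.mul_sum, Finset.sum_ite_eq' (Finset.range p),
          if_pos (Finset.mem_range.2 (by omega))]
      · intro n _ hn
        obtain ⟨d, rfl⟩ := Nat.exists_eq_add_of_le (not_lt.1 fun h => hn (Finset.mem_range.2 h))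
        have h4 : (D.nil ^ (p + d)) (D.proj i f) = 0 := by
          rw [add_comm, pow_add, Module.End.mul_apply, h3, map_zero]
        simp only [hV, h4]
        simp
    have hl : ∀ l ∈ S, ‖Complex.exp (-D.eig i * t) * w *
        (Complex.exp (D.eig l * t) * (D.expNil t (D.proj l f)).1 x)‖ ≤
        ∑ n ∈ Finset.range D.height,
          C l n * (t ^ n * Real.exp (-(((D.eig i).re - (D.eig l).re) * t))) := by
      intro l _
      have e1 : Complex.exp (-D.eig i * t) * w *
          (Complex.exp (D.eig l * t) * (D.expNil t (D.proj l f)).1 x) =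
          w * (Complex.exp ((D.eig l - D.eig i) * t) * (D.expNil t (D.proj l f)).1 x) := by
        rw [sub_mul, sub_eq_add_neg, Complex.exp_add, neg_mul]
        ring
      rw [e1, norm_mul]
      refine (mul_le_of_le_one_left (norm_nonneg _) hwn).trans ?_
      rw [norm_mul, norm_cexp_mul_ofReal, hexp l, Complex.sub_re]
      refine (mul_le_mul_of_nonneg_left (norm_sum_le _ _) (Real.exp_pos _).le).trans ?_
      rw [Finset.mul_sum]
      refine Finset.sum_le_sum fun n _ => ?_
      rw [norm_mul, norm_pow, Complex.norm_real, Real.norm_of_nonneg ht0]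
      have e2 : -(((D.eig i).re - (D.eig l).re) * t) = ((D.eig l).re - (D.eig i).re) * t := by ring
      rw [e2]
      calc _ = ‖V l n‖ * (t ^ n * Real.exp (((D.eig l).re - (D.eig i).re) * t)) := by ring
        _ ≤ _ := mul_le_mul_of_nonneg_right (hVC l n) (by positivity)
    have hdecomp : Complex.exp (-D.eig i * t) * w * X.sg t f.1 x - V i (p - 1) =
        Complex.exp (-D.eig i * t) * w * R +
        (∑ l ∈ S, Complex.exp (-D.eig i * t) * w *
          (Complex.exp (D.eig l * t) * (D.expNil t (D.proj l f)).1 x) +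
        (w * (D.expNil t (D.proj i f)).1 x - V i (p - 1))) := by
      have e1 : ∑ l, Complex.exp (D.eig l * t) * (D.expNil t (D.proj l f)).1 x =
          ∑ l ∈ S, Complex.exp (D.eig l * t) * (D.expNil t (D.proj l f)).1 x +
          Complex.exp (D.eig i * t) * (D.expNil t (D.proj i f)).1 x := by
        have hiS : i ∉ S := fun h => lt_irrefl _ (Finset.mem_filter.1 h).2
        have e0 := Finset.sum_insert (f := fun l : Fin D.m =>
          Complex.exp (D.eig l * t) * (D.expNil t (D.proj l f)).1 x) hiS
        rw [add_comm, ← e0]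
        symm
        refine Finset.sum_subset (Finset.subset_univ _) fun l _ hlS => ?_
        rw [Finset.mem_insert, not_or] at hlS
        have hre : (D.eig i).re ≤ (D.eig l).re := not_lt.1 fun h =>
          hlS.2 (Finset.mem_filter.2 ⟨Finset.mem_univ l, h⟩)
        rw [h2 l hlS.1 hre, map_zero]
        simp
      have e2 : Complex.exp (-D.eig i * t) * Complex.exp (D.eig i * t) = 1 := by
        rw [← Complex.exp_add, neg_mul, neg_add_cancel, Complex.exp_zero]
      rw [hR, e1, ← Finset.mul_sum]
      linear_combination (w * (D.expNil t (D.proj i f)).1 x) * e2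
    change ‖Complex.exp (-D.eig i * t) * w * X.sg t f.1 x - V i (p - 1)‖ ≤ δ
    rw [hdecomp]
    refine (norm_add_le _ _).trans ((add_le_add ?_ ?_).trans (add_halves δ).le)
    · rw [norm_mul, norm_mul, norm_cexp_mul_ofReal, Complex.neg_re]
      refine le_trans ?_ hr
      exact mul_le_mul_of_nonneg_right (mul_le_of_le_one_right (Real.exp_pos _).le hwn)
        (norm_nonneg _)
    · refine le_trans ((norm_add_le _ _).trans (add_le_add ?_ ?_)) hb
      · exact (norm_sum_le _ _).trans (Finset.sum_le_sum hl)
      · rw [hi]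
        refine (norm_sum_le _ _).trans (Finset.sum_le_sum fun n _ => ?_)
        rw [norm_mul, Complex.norm_real, Real.norm_eq_abs, mul_comm]
        exact mul_le_mul_of_nonneg_right (hVC i n) (abs_nonneg _)

end Spectrum

end BMP

namespace BMP

/-! ### Limits of integrals -/

/-- A rate for a single function that is bounded on `[0, ∞)`, without a continuity assumption. -/
theorem exists_isRate_unit (g : ℝ → ℝ) {M : ℝ} (hM : ∀ t, 0 ≤ t → g t ≤ M)
    (hlim : ∀ δ, 0 < δ → ∀ᶠ t in atTop, g t ≤ δ) : ∃ ε, IsRate ε ∧ ∀ t, 0 ≤ t → g t ≤ ε t := by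
  obtain ⟨ε, hε, h⟩ := exists_isRate (fun _ : Unit => g) (fun T => ⟨M, fun _ t h0 _ => hM t h0⟩)
    (fun δ hδ => by
      obtain ⟨T, hT⟩ := eventually_atTop.1 (hlim δ hδ)
      exact ⟨T, fun _ t ht => hT t ht⟩)
  exact ⟨ε, hε, fun t ht => h () t ht⟩

theorem IsRate.integrableOn {ε : ℝ → ℝ} (h : IsRate ε) (t : ℝ) :
    IntegrableOn ε (Set.Ioc 0 t) :=
  Measure.integrableOn_of_bounded (M := ε 0) (by simp) h.measurable.aestronglyMeasurable (by
    filter_upwards [ae_restrict_mem measurableSet_Ioc] with s hs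
    rw [Real.norm_of_nonneg (h.nonneg s)]
    exact h.le_zero hs.1.le)

/-- Averages of a rate form a rate. -/
theorem IsRate.average {ε : ℝ → ℝ} (h : IsRate ε) :
    ∃ ε', IsRate ε' ∧ ∀ t, 0 ≤ t → (1 + t)⁻¹ * ∫ s in Set.Ioc 0 t, ε s ≤ ε' t := by
  -- split the integral at the time `a` after which `ε` is at most `b`
  have hint : ∀ {a b t : ℝ}, 0 ≤ a → 0 ≤ t → (∀ s ∈ Set.Ioc 0 t, ε s ≤ (Set.Iic a).indicator
      (fun _ => ε 0) s + b) → ∫ s in Set.Ioc 0 t, ε s ≤ ε 0 * a + b * t := by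
    intro a b t ha ht hs
    have i1 : IntegrableOn ((Set.Iic a).indicator fun _ : ℝ => ε 0) (Set.Ioc 0 t) :=
      (integrable_const _).indicator measurableSet_Iic
    have i2 : IntegrableOn (fun _ : ℝ => b) (Set.Ioc 0 t) := integrable_const _
    refine (setIntegral_mono_on (h.integrableOn t) (i1.add i2) measurableSet_Ioc hs).trans ?_
    simp only [Pi.add_apply]
    rw [integral_add i1 i2, setIntegral_indicator measurableSet_Iic, setIntegral_const,
      setIntegral_const, smul_eq_mul, smul_eq_mul, mul_comm, mul_comm b]
    refine add_le_add (mul_le_mul_of_nonneg_left ?_ (h.nonneg 0)) (le_of_eq ?_)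
    · have hsub : Set.Ioc 0 t ∩ Set.Iic a ⊆ Set.Ioc 0 a := fun s hs => ⟨hs.1.1, hs.2⟩
      refine (measureReal_mono hsub (by simp)).trans_eq ?_
      simp [Measure.real, ha]
    · simp [Measure.real, ht]
  refine exists_isRate_unit _ (M := ε 0) ?_ ?_
  · intro t ht
    have h1 := hint (a := 0) (b := ε 0) (t := t) le_rfl ht fun s hs => by
      have : 0 ≤ (Set.Iic (0 : ℝ)).indicator (fun _ => ε 0) s :=
        Set.indicator_nonneg (fun _ _ => h.nonneg 0) s
      linarith [h.le_zero hs.1.le]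
    rw [inv_mul_le_iff₀ (by positivity)]
    have := h.nonneg 0
    nlinarith
  · intro δ hδ
    obtain ⟨T, hT⟩ := eventually_atTop.1 (h.lim.eventually_le_const (half_pos hδ))
    have h2 : Tendsto (fun t : ℝ => ε 0 * max T 0 * (1 + t)⁻¹) atTop (𝓝 0) := by
      simpa using (tendsto_inv_atTop_zero.comp
        (tendsto_atTop_add_const_left _ (1 : ℝ) tendsto_id)).const_mul (ε 0 * max T 0)
    filter_upwards [h2.eventually_le_const (half_pos hδ), eventually_ge_atTop 0] with t ht ht0
    have h1 := hint (a := max T 0) (b := δ / 2) (t := t) (le_max_right _ _) ht0 fun s hs => by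
      by_cases hsT : s ≤ max T 0
      · rw [Set.indicator_of_mem (by exact hsT)]
        linarith [h.le_zero hs.1.le]
      · rw [Set.indicator_of_notMem (by exact hsT), zero_add]
        exact hT s ((le_max_left _ _).trans (not_le.1 hsT).le)
    have hpos : (0 : ℝ) < 1 + t := by positivity
    calc (1 + t)⁻¹ * ∫ s in Set.Ioc 0 t, ε s
        ≤ (1 + t)⁻¹ * (ε 0 * max T 0 + δ / 2 * t) := by gcongr
      _ = ε 0 * max T 0 * (1 + t)⁻¹ + δ / 2 * (t / (1 + t)) := by
          field_simp
      _ ≤ δ / 2 + δ / 2 * 1 := by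
          gcongr
          rw [div_le_one hpos]
          linarith
      _ = δ := by ring

/-- The weight that bounds the error in the convergence of a convolution with weights of order
`N`, at the convolution time `s`: the error `ε` at the remaining time `t - s`, plus the change of
the polynomial factor between `t - s` and `t`. For `s > t` there is no convolution to compare
with, and the weight is `1`. -/
def convWeight (ε : ℝ → ℝ) (N : ℕ) (t s : ℝ) : ℝ :=
  if s ≤ t then ε (t - s) + (1 - ((1 + (t - s)) / (1 + t)) ^ N) else 1

theorem convWeight_bounds {ε : ℝ → ℝ} (h : IsRate ε) (N : ℕ) {t s : ℝ} (ht : 0 ≤ t) (hs : 0 ≤ s) :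
    0 ≤ convWeight ε N t s ∧ convWeight ε N t s ≤ ε 0 + 1 := by
  have h0 := h.nonneg 0
  unfold convWeight
  split_ifs with hst
  · have h1 : 0 ≤ (1 + (t - s)) / (1 + t) := div_nonneg (by linarith) (by linarith)
    have h2 : (1 + (t - s)) / (1 + t) ≤ 1 := by
      rw [div_le_one (by linarith)]
      linarith
    have h3 := pow_le_one₀ (n := N) h1 h2
    have h4 := pow_nonneg h1 N
    have h5 := h.le_zero (sub_nonneg.2 hst)
    have h6 := h.nonneg (t - s)
    constructor <;> linarith
  · constructor <;> linarith

theorem measurable_convWeight {ε : ℝ → ℝ} (h : IsRate ε) (N : ℕ) (t : ℝ) :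
    Measurable (convWeight ε N t) := by
  unfold convWeight
  refine Measurable.ite measurableSet_Iic ?_ measurable_const
  exact (h.measurable.comp (measurable_const.sub measurable_id)).add (by fun_prop)

/-- `convWeight` is bounded, and tends to `0` as `t → ∞` for fixed `s`; dominated convergence
gives a rate for its integral against `H`. -/
theorem exists_rate_conv {ε : ℝ → ℝ} (h : IsRate ε) (N : ℕ) {H : ℝ → ℝ}
    (hH : IntegrableOn H (Set.Ioi 0)) (hH0 : ∀ s, 0 < s → 0 ≤ H s) :
    ∃ ε', IsRate ε' ∧ ∀ t, 0 ≤ t → IntegrableOn (fun s => H s * convWeight ε N t s) (Set.Ioi 0) ∧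
      ∫ s in Set.Ioi 0, H s * convWeight ε N t s ≤ ε' t := by
  have hdom : ∀ t, 0 ≤ t → ∀ᵐ s ∂(volume.restrict (Set.Ioi (0 : ℝ))),
      ‖H s * convWeight ε N t s‖ ≤ H s * (ε 0 + 1) := by
    intro t ht
    filter_upwards [ae_restrict_mem measurableSet_Ioi] with s hs
    obtain ⟨h1, h2⟩ := convWeight_bounds h N ht (Set.mem_Ioi.1 hs).le
    rw [norm_mul, Real.norm_of_nonneg (hH0 s hs), Real.norm_of_nonneg h1]
    exact mul_le_mul_of_nonneg_left h2 (hH0 s hs)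
  have hmeas : ∀ t, AEStronglyMeasurable (fun s => H s * convWeight ε N t s)
      (volume.restrict (Set.Ioi (0 : ℝ))) := fun t =>
    hH.aestronglyMeasurable.mul (measurable_convWeight h N t).aestronglyMeasurable
  have hint : ∀ t, 0 ≤ t → IntegrableOn (fun s => H s * convWeight ε N t s) (Set.Ioi 0) :=
    fun t ht => (hH.mul_const (ε 0 + 1)).mono' (hmeas t) (hdom t ht)
  have hlim : Tendsto (fun t => ∫ s in Set.Ioi 0, H s * convWeight ε N t s) atTop
      (𝓝 (∫ s in Set.Ioi (0 : ℝ), H s * 0)) := by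
    refine tendsto_integral_filter_of_dominated_convergence (fun s => H s * (ε 0 + 1))
      (Eventually.of_forall hmeas) ?_ (hH.mul_const _) ?_
    · filter_upwards [eventually_ge_atTop 0] with t ht using hdom t ht
    · refine ae_of_all _ fun s => Tendsto.const_mul _ ?_
      have h1 : Tendsto (fun t => ε (t - s)) atTop (𝓝 0) :=
        h.lim.comp (tendsto_atTop_add_const_right _ (-s) tendsto_id)
      have h2 : Tendsto (fun t : ℝ => 1 - (1 - s * (1 + t)⁻¹) ^ N) atTop (𝓝 (1 - (1 - s * 0) ^ N)) :=
        ((((tendsto_inv_atTop_zero.comp (tendsto_atTop_add_const_left _ (1 : ℝ)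
          tendsto_id)).const_mul s).const_sub 1).pow N).const_sub 1
      have h3 := h1.add h2
      simp only [mul_zero, sub_zero, one_pow, sub_self, add_zero] at h3
      refine h3.congr' ?_
      filter_upwards [eventually_ge_atTop s, eventually_ge_atTop 0] with t hts ht
      rw [convWeight, if_pos hts]
      have : (1 + t) ≠ 0 := by positivity
      congr 3
      field_simp
      ring
  simp only [mul_zero, integral_zero] at hlim
  obtain ⟨ε', h1, h2⟩ := exists_isRate_unit (fun t => ∫ s in Set.Ioi 0, H s * convWeight ε N t s)
    (M := ∫ s in Set.Ioi 0, H s * (ε 0 + 1)) (fun t ht => by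
      refine integral_mono_ae (hint t ht) (hH.mul_const _) ?_
      filter_upwards [hdom t ht] with s hs using (le_abs_self _).trans hs)
    (fun δ hδ => hlim.eventually_le_const hδ)
  exact ⟨ε', h1, fun t ht => ⟨hint t ht, h2 t ht⟩⟩

/-! ### The Beta integral -/

/-- The oscillating Beta integral, divided by its order of growth `(1 + t) ^ (m + n + 1)`. The
frequency `θ` is carried by `t - s`. -/
def betaInt (θ : ℝ) (m n : ℕ) (t : ℝ) : ℂ :=
  (((1 + t) ^ (m + n + 1))⁻¹ : ℝ) * ∫ s in (0 : ℝ)..t,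
    Complex.exp (θ * (t - s) * Complex.I) * (((1 + (t - s)) ^ n * (1 + s) ^ m : ℝ) : ℂ)

theorem norm_betaInt_le (θ : ℝ) (m n : ℕ) {t : ℝ} (ht : 0 ≤ t) : ‖betaInt θ m n t‖ ≤ 1 := by
  have h1 : ‖∫ s in (0 : ℝ)..t, Complex.exp (θ * (t - s) * Complex.I) *
      (((1 + (t - s)) ^ n * (1 + s) ^ m : ℝ) : ℂ)‖ ≤ ((1 + t) ^ n * (1 + t) ^ m) * |t - 0| := by
    refine intervalIntegral.norm_integral_le_of_norm_le_const fun s hs => ?_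
    rw [Set.uIoc_of_le ht] at hs
    have h0 : 0 ≤ 1 + (t - s) := by linarith [hs.2]
    have h0' : 0 ≤ 1 + s := by linarith [hs.1]
    rw [norm_mul, ← Complex.ofReal_sub, ← Complex.ofReal_mul, Complex.norm_exp_ofReal_mul_I, one_mul,
      Complex.norm_real, Real.norm_of_nonneg (by positivity)]
    have h2 : 1 + (t - s) ≤ 1 + t := by linarith [hs.1]
    have h3 : 1 + s ≤ 1 + t := by linarith [hs.2]
    gcongr
  rw [betaInt, norm_mul, Complex.norm_real, Real.norm_of_nonneg (by positivity),
    inv_mul_le_iff₀ (by positivity), mul_one]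
  refine h1.trans ?_
  rw [sub_zero, abs_of_nonneg ht, ← pow_add, pow_succ, add_comm n m]
  gcongr
  linarith

theorem tendsto_inv_one_add_pow {n : ℕ} (hn : 1 ≤ n) :
    Tendsto (fun t : ℝ => ((1 + t) ^ n)⁻¹) atTop (𝓝 0) := by
  have h0 : Tendsto (fun t : ℝ => (1 + t)⁻¹) atTop (𝓝 0) :=
    tendsto_inv_atTop_zero.comp (tendsto_atTop_add_const_left _ 1 tendsto_id)
  have := h0.pow n
  rw [zero_pow (by omega)] at this
  exact this.congr fun t => by rw [inv_pow]

theorem hasDerivAt_one_add_pow (m : ℕ) (s : ℝ) :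
    HasDerivAt (fun s : ℝ => (1 + s) ^ (m + 1) / (m + 1)) ((1 + s) ^ m) s := by
  have h1 := ((hasDerivAt_id s).const_add 1).pow (m + 1)
  have h2 := h1.div_const ((m : ℝ) + 1)
  refine h2.congr_deriv ?_
  have : (m : ℝ) + 1 ≠ 0 := by positivity
  simp only [id_eq, Nat.add_sub_cancel, mul_one, Nat.cast_add, Nat.cast_one]
  field_simp

theorem hasDerivAt_one_add_sub_pow (n : ℕ) (t s : ℝ) :
    HasDerivAt (fun s : ℝ => (1 + (t - s)) ^ n) (-(n * (1 + (t - s)) ^ (n - 1))) s := by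
  have h1 := (((hasDerivAt_id s).const_sub t).const_add 1).pow n
  refine h1.congr_deriv ?_
  simp

/-- Without oscillation, the normalised integral converges to the Beta function `B(m + 1, n + 1)`.
By induction on `n` and integration by parts; the boundary terms are of lower order. -/
theorem tendsto_beta_real (n : ℕ) : ∀ m : ℕ, Tendsto (fun t : ℝ => ((1 + t) ^ (m + n + 1))⁻¹ *
    ∫ s in (0 : ℝ)..t, (1 + (t - s)) ^ n * (1 + s) ^ m) atTop
    (𝓝 ((m.factorial * n.factorial : ℝ) / (m + n + 1).factorial)) := by
  induction n with
  | zero =>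
    intro m
    have h1 : Tendsto (fun t : ℝ => (1 - ((1 + t) ^ (m + 1))⁻¹) / (m + 1)) atTop
        (𝓝 ((1 - 0) / (m + 1))) :=
      ((tendsto_inv_one_add_pow (Nat.le_add_left 1 m)).const_sub 1).div_const _
    have h2 : ((m.factorial * Nat.factorial 0 : ℝ) / (m + 0 + 1).factorial) = (1 - 0) / (m + 1) := by
      rw [add_zero, Nat.factorial_succ, Nat.factorial_zero]
      have : (m.factorial : ℝ) ≠ 0 := by exact_mod_cast m.factorial_ne_zero
      push_cast
      field_simp
      ring
    rw [h2]
    refine h1.congr' ?_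
    filter_upwards [eventually_ge_atTop 0] with t ht
    have h3 : ∫ s in (0 : ℝ)..t, (1 + (t - s)) ^ 0 * (1 + s) ^ m =
        (1 + t) ^ (m + 1) / (m + 1) - (1 + 0) ^ (m + 1) / (m + 1) := by
      simp only [pow_zero, one_mul]
      exact intervalIntegral.integral_eq_sub_of_hasDerivAt
        (fun s _ => hasDerivAt_one_add_pow m s) (Continuous.intervalIntegrable (by fun_prop) _ _)
    rw [h3, add_zero, add_zero, one_pow]
    have : (1 + t) ≠ 0 := by positivity
    field_simp
  | succ n ih =>
    intro m
    have hparts : ∀ t : ℝ, ∫ s in (0 : ℝ)..t, (1 + (t - s)) ^ (n + 1) * (1 + s) ^ m =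
        ((1 + t) ^ (m + 1) - (1 + t) ^ (n + 1)) / (m + 1) +
        (n + 1) / (m + 1) * ∫ s in (0 : ℝ)..t, (1 + (t - s)) ^ n * (1 + s) ^ (m + 1) := by
      intro t
      rw [intervalIntegral.integral_mul_deriv_eq_deriv_mul
        (fun s _ => hasDerivAt_one_add_sub_pow (n + 1) t s) (fun s _ => hasDerivAt_one_add_pow m s)
        (Continuous.intervalIntegrable (by fun_prop) _ _)
        (Continuous.intervalIntegrable (by fun_prop) _ _), ← intervalIntegral.integral_const_mul]
      have h4 : ∀ s : ℝ, -(((n + 1 : ℕ) : ℝ) * (1 + (t - s)) ^ (n + 1 - 1)) *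
          ((1 + s) ^ (m + 1) / (m + 1)) =
          -((n + 1) / (m + 1) * ((1 + (t - s)) ^ n * (1 + s) ^ (m + 1))) := by
        intro s
        rw [Nat.add_sub_cancel]
        push_cast
        ring
      simp_rw [h4]
      rw [intervalIntegral.integral_neg]
      simp only [sub_self, add_zero, one_pow, sub_zero]
      ring
    have h1 := (((tendsto_inv_one_add_pow (Nat.le_add_left 1 n)).sub
      (tendsto_inv_one_add_pow (Nat.le_add_left 1 m))).div_const ((m : ℝ) + 1)).add
      ((ih (m + 1)).const_mul (((n : ℝ) + 1) / (m + 1)))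
    have h2 : ((m.factorial * (n + 1).factorial : ℝ) / (m + (n + 1) + 1).factorial) =
        (0 - 0) / ((m : ℝ) + 1) + ((n : ℝ) + 1) / (m + 1) *
          (((m + 1).factorial * n.factorial : ℝ) / (m + 1 + n + 1).factorial) := by
      rw [show m + 1 + n + 1 = m + (n + 1) + 1 by ring, Nat.factorial_succ n, Nat.factorial_succ m]
      have : ((m + (n + 1) + 1).factorial : ℝ) ≠ 0 := by exact_mod_cast Nat.factorial_ne_zero _
      push_cast
      field_simp
      ring
    rw [h2]
    refine h1.congr' ?_
    filter_upwards [eventually_ge_atTop 0] with t ht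
    rw [hparts, show m + 1 + n + 1 = m + (n + 1) + 1 by ring]
    have : (1 + t) ≠ 0 := by positivity
    have e0 : (1 + t) ^ (m + (n + 1) + 1) = (1 + t) ^ (n + 1) * (1 + t) ^ (m + 1) := by ring
    have e1 : ((1 + t) ^ (n + 1))⁻¹ = ((1 + t) ^ (m + (n + 1) + 1))⁻¹ * (1 + t) ^ (m + 1) := by
      rw [e0, mul_inv, mul_assoc, inv_mul_cancel₀ (by positivity), mul_one]
    have e2 : ((1 + t) ^ (m + 1))⁻¹ = ((1 + t) ^ (m + (n + 1) + 1))⁻¹ * (1 + t) ^ (n + 1) := by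
      rw [e0, mul_inv, mul_right_comm, inv_mul_cancel₀ (by positivity), one_mul]
    rw [e1, e2]
    ring

/-- Integration by parts: oscillations gain a factor of order `t`. -/
theorem norm_betaInt_le_of_ne {θ : ℝ} (hθ : θ ≠ 0) (m n : ℕ) {t : ℝ} (ht : 0 ≤ t) :
    ‖betaInt θ m n t‖ ≤ |θ|⁻¹ * (2 + n + m) * (1 + t)⁻¹ := by
  have hc : (θ : ℂ) * Complex.I ≠ 0 := mul_ne_zero (by exact_mod_cast hθ) Complex.I_ne_zero
  have hcn : ‖(θ : ℂ) * Complex.I‖ = |θ| := by simp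
  let g : ℝ → ℝ := fun s => (1 + (t - s)) ^ n * (1 + s) ^ m
  let g' : ℝ → ℝ := fun s => -(n * (1 + (t - s)) ^ (n - 1)) * (1 + s) ^ m +
    (1 + (t - s)) ^ n * (m * (1 + s) ^ (m - 1))
  have hg : ∀ s : ℝ, HasDerivAt (fun s => (g s : ℂ)) (g' s : ℂ) s := by
    intro s
    have h1 := ((hasDerivAt_id s).const_add 1).pow m
    have h2 := (hasDerivAt_one_add_sub_pow n t s).mul h1
    refine HasDerivAt.ofReal_comp (h2.congr_deriv ?_)
    simp [g']
  let v : ℝ → ℂ := fun s => -(Complex.exp (θ * (t - s) * Complex.I) / (θ * Complex.I))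
  have hv : ∀ s : ℝ, HasDerivAt v (Complex.exp (θ * (t - s) * Complex.I)) s := by
    intro s
    have h1 : HasDerivAt (fun s : ℝ => (θ : ℂ) * (t - s) * Complex.I) (-(θ * Complex.I)) s := by
      have h2 := ((((hasDerivAt_id s).ofReal_comp).const_sub (t : ℂ)).const_mul (θ : ℂ)).mul_const
        Complex.I
      refine h2.congr_deriv ?_
      simp
    refine ((h1.cexp.div_const (θ * Complex.I)).neg).congr_deriv ?_
    rw [mul_neg, neg_div, neg_neg, mul_div_assoc, div_self hc, mul_one]
  have hvn : ∀ s, ‖v s‖ = |θ|⁻¹ := by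
    intro s
    simp only [v]
    rw [norm_neg, norm_div, hcn, ← Complex.ofReal_sub, ← Complex.ofReal_mul,
      Complex.norm_exp_ofReal_mul_I, one_div]
  have hg'c : Continuous g' := by
    simp only [g']
    fun_prop
  have hparts := intervalIntegral.integral_mul_deriv_eq_deriv_mul (a := 0) (b := t)
    (fun s _ => hg s) (fun s _ => hv s)
    (Continuous.intervalIntegrable (Complex.continuous_ofReal.comp hg'c) _ _)
    (Continuous.intervalIntegrable (by fun_prop) _ _)
  have hpos : (0 : ℝ) < 1 + t := by positivity
  have hbnd : ∀ s ∈ Set.Icc 0 t, (0 ≤ 1 + (t - s) ∧ 1 + (t - s) ≤ 1 + t) ∧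
      (0 ≤ 1 + s ∧ 1 + s ≤ 1 + t) := fun s hs => by
    obtain ⟨h1, h2⟩ := hs
    refine ⟨⟨?_, ?_⟩, ?_, ?_⟩ <;> linarith
  have hgn : ∀ s ∈ Set.Icc 0 t, ‖(g s : ℂ)‖ ≤ (1 + t) ^ (m + n) := by
    intro s hs
    obtain ⟨⟨h1, h2⟩, h3, h4⟩ := hbnd s hs
    rw [Complex.norm_real, Real.norm_of_nonneg (by simp only [g]; positivity), add_comm m n, pow_add]
    simp only [g]
    gcongr
  have hmono : ∀ j : ℕ, ∀ a : ℝ, 0 ≤ a → a ≤ 1 + t → j * a ^ (j - 1) * (1 + t) ≤ j * (1 + t) ^ j := by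
    intro j a h0 h1
    rcases Nat.eq_zero_or_pos j with rfl | hj
    · simp
    · rw [mul_assoc]
      refine mul_le_mul_of_nonneg_left ?_ (by positivity)
      calc a ^ (j - 1) * (1 + t) ≤ (1 + t) ^ (j - 1) * (1 + t) := by gcongr
        _ = (1 + t) ^ j := by rw [← pow_succ, Nat.sub_add_cancel hj]
  have hgn' : ∀ s ∈ Set.Icc 0 t, ‖(g' s : ℂ)‖ * (1 + t) ≤ (n + m) * (1 + t) ^ (m + n) := by
    intro s hs
    obtain ⟨⟨h1, h2⟩, h3, h4⟩ := hbnd s hs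
    have e1 := hmono n _ h1 h2
    have e2 := hmono m _ h3 h4
    have e3 : ‖(g' s : ℂ)‖ ≤ n * (1 + (t - s)) ^ (n - 1) * (1 + s) ^ m +
        (1 + (t - s)) ^ n * (m * (1 + s) ^ (m - 1)) := by
      rw [Complex.norm_real]
      refine (norm_add_le _ _).trans_eq ?_
      rw [norm_mul, norm_neg, Real.norm_of_nonneg (by positivity), Real.norm_of_nonneg (by positivity),
        Real.norm_of_nonneg (by positivity)]
    calc _ ≤ (n * (1 + (t - s)) ^ (n - 1) * (1 + s) ^ m +
        (1 + (t - s)) ^ n * (m * (1 + s) ^ (m - 1))) * (1 + t) := by gcongr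
      _ = n * (1 + (t - s)) ^ (n - 1) * (1 + t) * (1 + s) ^ m +
        (1 + (t - s)) ^ n * (m * (1 + s) ^ (m - 1) * (1 + t)) := by ring
      _ ≤ n * (1 + t) ^ n * (1 + t) ^ m + (1 + t) ^ n * (m * (1 + t) ^ m) := by gcongr
      _ = _ := by ring
  have hint : ‖∫ s in (0 : ℝ)..t, (g' s : ℂ) * v s‖ ≤
      (n + m) * (1 + t) ^ (m + n) * (1 + t)⁻¹ * |θ|⁻¹ * |t - 0| := by
    refine intervalIntegral.norm_integral_le_of_norm_le_const fun s hs => ?_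
    rw [Set.uIoc_of_le ht] at hs
    rw [norm_mul, hvn]
    refine mul_le_mul_of_nonneg_right ?_ (by positivity)
    rw [← div_eq_mul_inv, le_div_iff₀ hpos]
    exact hgn' s ⟨hs.1.le, hs.2⟩
  have htot : ‖∫ s in (0 : ℝ)..t, (g s : ℂ) * Complex.exp (θ * (t - s) * Complex.I)‖ ≤
      |θ|⁻¹ * (2 + n + m) * (1 + t) ^ (m + n) := by
    rw [hparts]
    refine (norm_sub_le _ _).trans ((add_le_add (norm_sub_le _ _) hint).trans ?_)
    rw [norm_mul, norm_mul, hvn, hvn, sub_zero, abs_of_nonneg ht]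
    have e1 := hgn t ⟨ht, le_rfl⟩
    have e2 := hgn 0 ⟨le_rfl, ht⟩
    have e3 : (1 + t)⁻¹ * t ≤ 1 := by
      rw [inv_mul_le_iff₀ hpos]
      linarith
    have hθ0 : 0 ≤ |θ|⁻¹ := by positivity
    calc _ ≤ (1 + t) ^ (m + n) * |θ|⁻¹ + (1 + t) ^ (m + n) * |θ|⁻¹ +
          (n + m) * (1 + t) ^ (m + n) * |θ|⁻¹ * ((1 + t)⁻¹ * t) := by
          refine add_le_add (add_le_add (by gcongr) (by gcongr)) (le_of_eq (by ring))
      _ ≤ (1 + t) ^ (m + n) * |θ|⁻¹ + (1 + t) ^ (m + n) * |θ|⁻¹ +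
          (n + m) * (1 + t) ^ (m + n) * |θ|⁻¹ * 1 := by gcongr
      _ = _ := by ring
  have hcomm : ∫ s in (0 : ℝ)..t, Complex.exp (θ * (t - s) * Complex.I) *
      (((1 + (t - s)) ^ n * (1 + s) ^ m : ℝ) : ℂ) =
      ∫ s in (0 : ℝ)..t, (g s : ℂ) * Complex.exp (θ * (t - s) * Complex.I) := by
    congr 1
    funext s
    exact mul_comm _ _
  rw [betaInt, norm_mul, Complex.norm_real, Real.norm_of_nonneg (by positivity), hcomm,
    inv_mul_le_iff₀ (by positivity)]
  refine htot.trans_eq ?_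
  rw [pow_succ]
  field_simp

/-- The normalised Beta integral converges to the Beta function if it does not oscillate, and to
`0` if it does. -/
theorem exists_rate_beta (θ : ℝ) (m n : ℕ) : ∃ ε, IsRate ε ∧ ∀ t : ℝ, 0 ≤ t →
    ‖betaInt θ m n t - if θ = 0 then (m.factorial * n.factorial : ℂ) / (m + n + 1).factorial
      else 0‖ ≤ ε t := by
  refine exists_isRate_unit _ (fun t ht =>
    (norm_sub_le _ _).trans (add_le_add (norm_betaInt_le θ m n ht) le_rfl)) fun δ hδ => ?_
  by_cases hθ : θ = 0
  · subst hθ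
    have h1 := (Complex.continuous_ofReal.tendsto _).comp (tendsto_beta_real n m)
    have h2 : Tendsto (fun t => ‖betaInt 0 m n t -
        (m.factorial * n.factorial : ℂ) / (m + n + 1).factorial‖) atTop (𝓝 0) := by
      have h3 : betaInt 0 m n = Complex.ofReal ∘ fun t : ℝ => ((1 + t) ^ (m + n + 1))⁻¹ *
          ∫ s in (0 : ℝ)..t, (1 + (t - s)) ^ n * (1 + s) ^ m := by
        funext t
        simp only [betaInt, Function.comp_apply, Complex.ofReal_zero, zero_mul, Complex.exp_zero,
          one_mul]
        rw [intervalIntegral.integral_ofReal, Complex.ofReal_mul]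
      rw [← tendsto_iff_norm_sub_tendsto_zero, h3]
      convert h1 using 2
      push_cast
      rfl
    simp only [eq_self, if_true]
    exact h2.eventually_le_const hδ
  · simp only [if_neg hθ, sub_zero]
    have h0 : Tendsto (fun t : ℝ => (1 + t)⁻¹) atTop (𝓝 0) :=
      tendsto_inv_atTop_zero.comp (tendsto_atTop_add_const_left _ 1 tendsto_id)
    have h1 := h0.const_mul (|θ|⁻¹ * (2 + n + m))
    rw [mul_zero] at h1
    filter_upwards [h1.eventually_le_const hδ, eventually_ge_atTop 0] with t ht ht0
    exact (norm_betaInt_le_of_ne hθ m n ht0).trans ht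

end BMP

namespace BMP

theorem toBdd_val {E : Type u} [MeasurableSpace E] {h : E → ℂ} (hh : h ∈ BddFun E) :
    (toBdd h).1 = h := by
  rw [toBdd, dif_pos hh]

namespace Spectrum

variable {E : Type u} [MeasurableSpace E] {D : Spectrum E} {X : Data.{u, v} E} {k : ℕ} {K : NNReal}

/-! ### Leading terms of the semigroup -/

theorem Φ₂_smul (i : Fin D.m) (j : ℕ) (c : ℂ) (f : BddFun E) :
    D.Φ₂ i j (c • f) = c • D.Φ₂ i j f := by
  simp only [Φ₂, map_smul, smul_eq_mul, mul_smul, Finset.smul_sum]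

/-- Asymptotics of the semigroup for functions of arbitrary size, by homogeneity. -/
theorem H1.exists_rate_sg_scaled (hH : D.H1 X) (hK : X.MomentBound k K) (hk : 1 ≤ k)
    (i : Fin D.m) {p : ℕ} (hp : 1 ≤ p) (hpP : p ≤ D.height) : ∃ ε, IsRate ε ∧
      ∀ (f : BddFun E) (R : ℝ), 0 ≤ R → (∀ y, ‖f.1 y‖ ≤ R) →
      (∀ l, l ≠ i → (D.eig i).re ≤ (D.eig l).re → D.proj l f = 0) →
      (D.nil ^ p) (D.proj i f) = 0 → ∀ t : ℝ, 0 ≤ t → ∀ x,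
      ‖X.sg t f.1 x - Complex.exp (D.eig i * t) * (((1 + t) ^ (p - 1) : ℝ) : ℂ) *
        (((p - 1).factorial : ℂ)⁻¹ * ((D.nil ^ (p - 1)) (D.proj i f)).1 x)‖ ≤
        Real.exp ((D.eig i).re * t) * (1 + t) ^ (p - 1) * (R * ε t) := by
  obtain ⟨ε, hε, h⟩ := hH.exists_rate_sg hK hk i hp hpP
  refine ⟨ε, hε, fun f R hR hf h1 h2 t ht x => ?_⟩
  rcases hR.eq_or_lt with rfl | hR
  · obtain rfl : f = 0 := Subtype.ext (funext fun y => norm_le_zero_iff.1 (hf y))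
    simp [Data.sg, pairing]
  have hRc : (R : ℂ) ≠ 0 := by exact_mod_cast hR.ne'
  have h3 := h ((R : ℂ)⁻¹ • f) (fun y => by
    change ‖(R : ℂ)⁻¹ * f.1 y‖ ≤ 1
    rw [norm_mul, norm_inv, Complex.norm_real, Real.norm_of_nonneg hR.le, inv_mul_le_iff₀ hR,
      mul_one]
    exact hf y) (fun l hl hre => by rw [map_smul, h1 l hl hre, smul_zero])
    (by rw [map_smul, map_smul, h2, smul_zero]) t ht x
  have e1 : X.sg t ((R : ℂ)⁻¹ • f).1 x = (R : ℂ)⁻¹ * X.sg t f.1 x :=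
    Data.sg_const_mul (X := X) (R : ℂ)⁻¹ f.1 t x
  have e2 : ((D.nil ^ (p - 1)) (D.proj i ((R : ℂ)⁻¹ • f))).1 x =
      (R : ℂ)⁻¹ * ((D.nil ^ (p - 1)) (D.proj i f)).1 x := by
    rw [map_smul, map_smul]
    rfl
  rw [e1, e2] at h3
  set w : ℂ := Complex.exp (-D.eig i * t) with hw
  have hwi : Complex.exp (D.eig i * t) * w = 1 := by
    rw [hw, ← Complex.exp_add, neg_mul, add_neg_cancel, Complex.exp_zero]
  have hpos : (0 : ℝ) < (1 + t) ^ (p - 1) := by positivity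
  have hq : (((1 + t) ^ (p - 1) : ℝ) : ℂ) ≠ 0 := by exact_mod_cast hpos.ne'
  have e3 : X.sg t f.1 x - Complex.exp (D.eig i * t) * (((1 + t) ^ (p - 1) : ℝ) : ℂ) *
        (((p - 1).factorial : ℂ)⁻¹ * ((D.nil ^ (p - 1)) (D.proj i f)).1 x) =
      Complex.exp (D.eig i * t) * (((1 + t) ^ (p - 1) : ℝ) : ℂ) * (R *
        (w * (((1 + t) ^ (p - 1))⁻¹ : ℝ) * ((R : ℂ)⁻¹ * X.sg t f.1 x) -
        ((p - 1).factorial : ℂ)⁻¹ * ((R : ℂ)⁻¹ * ((D.nil ^ (p - 1)) (D.proj i f)).1 x))) := by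
    rw [Complex.ofReal_inv]
    field_simp
    linear_combination (-X.sg t f.1 x) * hwi
  rw [e3, norm_mul, norm_mul, norm_mul, norm_cexp_mul_ofReal, Complex.norm_real,
    Real.norm_of_nonneg hpos.le, Complex.norm_real, Real.norm_of_nonneg hR.le]
  gcongr

variable (D) in
/-- The leading coefficient of `ψ_t[f]` for general `f`. -/
def lead (f : BddFun E) : BddFun E :=
  ((D.p1 - 1).factorial : ℂ)⁻¹ • D.Φ₂ 0 1 ((D.nil ^ (D.p1 - 1)) f)

variable (D) in
/-- The leading coefficient of `ψ_t[f]` for `f` in a critical eigenspace. -/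
def critLead (f : BddFun E) : BddFun E :=
  ((D.pOf f - 1).factorial : ℂ)⁻¹ • D.Φ₂ (D.ν f) 1 (D.star f)

theorem lead_smul (c : ℂ) (f : BddFun E) : D.lead (c • f) = c • D.lead f := by
  rw [lead, lead, map_smul, Φ₂_smul, smul_comm]

theorem H1.eig_zero (hH : D.H1 X) : D.eig 0 = (D.lam1 : ℂ) :=
  Complex.ext (by simp [lam1]) (by simp [hH.lam1_real])

/-- For general `f`, the growth of `ψ_t[f]` is that of the longest Jordan chains of `λ_1`, which
has the largest real part. The bound on the leading coefficient comes from the error bound at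
`t = 0`, where the semigroup is bounded. -/
theorem H1.exists_rate_lead (hH : D.H1 X) (hK : X.MomentBound k K) (hk : 1 ≤ k) :
    ∃ ε, IsRate ε ∧ ∃ M : ℝ, 0 ≤ M ∧ ∀ (f : BddFun E) (R : ℝ), 0 ≤ R → (∀ y, ‖f.1 y‖ ≤ R) →
      ∀ x, ‖(D.lead f).1 x‖ ≤ M * R ∧ ∀ t : ℝ, 0 ≤ t →
      ‖X.sg t f.1 x - ((Real.exp (D.lam1 * t) * (1 + t) ^ (D.p1 - 1) : ℝ) : ℂ) * (D.lead f).1 x‖ ≤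
        Real.exp (D.lam1 * t) * (1 + t) ^ (D.p1 - 1) * (R * ε t) ∧
      ‖X.sg t f.1 x‖ ≤ Real.exp (D.lam1 * t) * (1 + t) ^ (D.p1 - 1) * (M * R) := by
  obtain ⟨ε, hε, h⟩ := hH.exists_rate_sg_scaled hK hk 0 (hH.p_pos 0) (p_le_height 0)
  obtain ⟨M0, hM0, hM⟩ := hK.exists_norm_sg_le hk 0
  have hε0 := hε.nonneg 0
  refine ⟨ε, hε, M0 + 2 * ε 0, by positivity, fun f R hR hf x => ?_⟩
  have hlead : ((D.p1 - 1).factorial : ℂ)⁻¹ * ((D.nil ^ (D.p1 - 1)) (D.proj 0 f)).1 x =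
      (D.lead f).1 x := by
    rw [lead, ← hH.proj_nil_pow, hH.proj_eq_Φ₂]
    · rfl
    · have hp1 : D.p1 - 1 + 1 = D.p 0 := Nat.sub_add_cancel (hH.p_pos 0)
      rw [hH.proj_nil_pow, ← Module.End.mul_apply, ← pow_succ', hp1]
      exact hH.nil_pow_proj 0 le_rfl f
  have h1 : ∀ t : ℝ, 0 ≤ t →
      ‖X.sg t f.1 x - ((Real.exp (D.lam1 * t) * (1 + t) ^ (D.p1 - 1) : ℝ) : ℂ) *
        (D.lead f).1 x‖ ≤ Real.exp (D.lam1 * t) * (1 + t) ^ (D.p1 - 1) * (R * ε t) := by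
    intro t ht
    have h2 := h f R hR hf (fun l hl hre => absurd (hH.re_lt l hl) (not_lt.2 hre))
      (hH.nil_pow_proj 0 le_rfl f) t ht x
    change ‖X.sg t f.1 x - Complex.exp (D.eig 0 * t) * (((1 + t) ^ (D.p1 - 1) : ℝ) : ℂ) *
        (((D.p1 - 1).factorial : ℂ)⁻¹ * ((D.nil ^ (D.p1 - 1)) (D.proj 0 f)).1 x)‖ ≤
        Real.exp (D.lam1 * t) * (1 + t) ^ (D.p1 - 1) * (R * ε t) at h2
    rw [hlead, hH.eig_zero] at h2
    rwa [Complex.ofReal_mul, Complex.ofReal_exp, Complex.ofReal_mul]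
  have h3 : ‖(D.lead f).1 x‖ ≤ (M0 + ε 0) * R := by
    have h4 := h1 0 le_rfl
    simp only [mul_zero, Real.exp_zero, add_zero, one_pow, mul_one, Complex.ofReal_one,
      one_mul] at h4
    have h5 := hM f.1 R hR hf 0 le_rfl x
    have h6 := norm_sub_norm_le ((D.lead f).1 x) (X.sg 0 f.1 x)
    rw [norm_sub_rev] at h6
    linarith
  refine ⟨h3.trans (by nlinarith), fun t ht => ⟨h1 t ht, ?_⟩⟩
  have hg : 0 ≤ Real.exp (D.lam1 * t) * (1 + t) ^ (D.p1 - 1) := by positivity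
  have h4 := norm_le_norm_sub_add (X.sg t f.1 x)
    (((Real.exp (D.lam1 * t) * (1 + t) ^ (D.p1 - 1) : ℝ) : ℂ) * (D.lead f).1 x)
  rw [norm_mul, Complex.norm_real, Real.norm_of_nonneg hg] at h4
  calc _ ≤ _ := h4
    _ ≤ Real.exp (D.lam1 * t) * (1 + t) ^ (D.p1 - 1) * (R * ε 0) +
        Real.exp (D.lam1 * t) * (1 + t) ^ (D.p1 - 1) * ((M0 + ε 0) * R) := by
        refine add_le_add ((h1 t ht).trans ?_) (by gcongr)
        have := hε.le_zero ht
        gcongr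
    _ = _ := by ring

/-- For `f` in a critical eigenspace, `p(f)` determines the polynomial growth of `ψ_t[f]`, and all
components with a real part of at least `Re λ(f)` other than `Φ_{ν(f)}[f]` vanish. Since `ν(f)`
and `p(f)` take finitely many values, the rate does not depend on `f`. -/
theorem H1.exists_rate_critLead (hH : D.H1 X) (hK : X.MomentBound k K) (hk : 1 ≤ k) :
    ∃ ε, IsRate ε ∧ ∃ M : ℝ, 0 ≤ M ∧ ∀ f ∈ D.EiCrit, ∀ R : ℝ, 0 ≤ R → (∀ y, ‖f.1 y‖ ≤ R) →
      ∀ x, ‖(D.critLead f).1 x‖ ≤ M * R ∧ ∀ t : ℝ, 0 ≤ t →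
      ‖X.sg t f.1 x - Complex.exp (D.lam f * t) * (((1 + t) ^ (D.pOf f - 1) : ℝ) : ℂ) *
        (D.critLead f).1 x‖ ≤
        Real.exp (D.lam1 / 2 * t) * (1 + t) ^ (D.pOf f - 1) * (R * ε t) ∧
      ‖X.sg t f.1 x‖ ≤ Real.exp (D.lam1 / 2 * t) * (1 + t) ^ (D.pOf f - 1) * (M * R) := by
  choose! e he h using fun i p (hp : 1 ≤ p ∧ p ≤ D.height) =>
    hH.exists_rate_sg_scaled hK hk i hp.1 hp.2
  obtain ⟨M0, hM0, hM⟩ := hK.exists_norm_sg_le hk 0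
  set ε : ℝ → ℝ := fun t => ∑ i, ∑ p ∈ Finset.Icc 1 D.height, e i p t with hεdef
  have hε : IsRate ε := IsRate.sum _ fun i _ => IsRate.sum _ fun p hp =>
    he i p (Finset.mem_Icc.1 hp)
  have hle : ∀ i p, 1 ≤ p ∧ p ≤ D.height → ∀ t, e i p t ≤ ε t := by
    intro i p hp t
    have hn : ∀ j, ∀ q ∈ Finset.Icc 1 D.height, 0 ≤ e j q t := fun j q hq =>
      (he j q (Finset.mem_Icc.1 hq)).nonneg t
    refine (Finset.single_le_sum (f := fun q => e i q t) (hn i) (Finset.mem_Icc.2 hp)).trans ?_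
    exact Finset.single_le_sum (f := fun j => ∑ q ∈ Finset.Icc 1 D.height, e j q t)
      (fun j _ => Finset.sum_nonneg (hn j)) (Finset.mem_univ i)
  have hε0 := hε.nonneg 0
  refine ⟨ε, hε, M0 + 2 * ε 0, by positivity, fun f hfc R hR hf x => ?_⟩
  obtain ⟨hp1, hpP, hpn⟩ := hH.pOf_spec hfc
  obtain ⟨hei, hre⟩ := hH.mem_ei_ν hfc
  have hlam : (D.eig (D.ν f)).re = D.lam1 / 2 := by
    rw [lam] at hre
    linarith
  have hlead : ((D.pOf f - 1).factorial : ℂ)⁻¹ *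
      ((D.nil ^ (D.pOf f - 1)) (D.proj (D.ν f) f)).1 x = (D.critLead f).1 x := by
    rw [critLead, ← hH.proj_nil_pow, hH.proj_eq_Φ₂]
    · rfl
    · rw [hH.proj_nil_pow, ← Module.End.mul_apply, ← pow_succ', Nat.sub_add_cancel hp1,
        ← hH.proj_nil_pow, hpn, map_zero]
  have h1 : ∀ t : ℝ, 0 ≤ t →
      ‖X.sg t f.1 x - Complex.exp (D.lam f * t) * (((1 + t) ^ (D.pOf f - 1) : ℝ) : ℂ) *
        (D.critLead f).1 x‖ ≤
        Real.exp (D.lam1 / 2 * t) * (1 + t) ^ (D.pOf f - 1) * (R * ε t) := by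
    intro t ht
    have h2 := h (D.ν f) (D.pOf f) ⟨hp1, hpP⟩ f R hR hf
      (fun l hl hre => proj_eq_zero_of_mem_ei hH hei hl hre)
      (by rw [← hH.proj_nil_pow, hpn, map_zero]) t ht x
    rw [hlead, hlam] at h2
    refine h2.trans ?_
    have := hle (D.ν f) (D.pOf f) ⟨hp1, hpP⟩ t
    gcongr
  have h3 : ‖(D.critLead f).1 x‖ ≤ (M0 + ε 0) * R := by
    have h4 := h1 0 le_rfl
    simp only [mul_zero, Real.exp_zero, add_zero, one_pow, mul_one, Complex.ofReal_one,
      one_mul, Complex.ofReal_zero, Complex.exp_zero] at h4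
    have h5 := hM f.1 R hR hf 0 le_rfl x
    have h6 := norm_sub_norm_le ((D.critLead f).1 x) (X.sg 0 f.1 x)
    rw [norm_sub_rev] at h6
    linarith
  refine ⟨h3.trans (by nlinarith), fun t ht => ⟨h1 t ht, ?_⟩⟩
  have hg : 0 ≤ Real.exp (D.lam1 / 2 * t) * (1 + t) ^ (D.pOf f - 1) := by positivity
  have h4 := norm_le_norm_sub_add (X.sg t f.1 x)
    (Complex.exp (D.lam f * t) * (((1 + t) ^ (D.pOf f - 1) : ℝ) : ℂ) * (D.critLead f).1 x)
  rw [norm_mul, norm_mul, norm_cexp_mul_ofReal, Complex.norm_real,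
    Real.norm_of_nonneg (by positivity), lam, hlam] at h4
  rw [← lam] at h4
  calc _ ≤ _ := h4
    _ ≤ Real.exp (D.lam1 / 2 * t) * (1 + t) ^ (D.pOf f - 1) * (R * ε 0) +
        Real.exp (D.lam1 / 2 * t) * (1 + t) ^ (D.pOf f - 1) * ((M0 + ε 0) * R) := by
        refine add_le_add ((h1 t ht).trans ?_) (by gcongr)
        have := hε.le_zero ht
        gcongr
    _ = _ := by ring

/-! ### Conjugate tuples -/

variable {ι : Type} {f : ι → BddFun E}

/-- A pair is conjugate if and only if the frequencies `Im λ(f_i)` cancel. -/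
theorem H1.isConjugateTuple_pair (hH : D.H1 X) (hf : ∀ i, f i ∈ D.EiCrit) {A : Finset ι}
    (hA : A.card = 2) : D.IsConjugateTuple f A ↔ ∑ i ∈ A, (D.lam (f i)).im = 0 := by
  classical
  obtain ⟨a, b, hab, rfl⟩ := Finset.card_eq_two.1 hA
  have hre : ∀ i, (D.lam (f i)).re = D.lam1 / 2 := fun i => by
    linarith [(hH.mem_ei_ν (hf i)).2]
  have hconj : ∀ i j, D.lam (f i) = conj (D.lam (f j)) ↔
      (D.lam (f i)).im + (D.lam (f j)).im = 0 := by
    intro i j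
    rw [Complex.ext_iff, Complex.conj_re, Complex.conj_im, hre, hre]
    constructor
    · rintro ⟨-, h⟩
      linarith
    · intro h
      exact ⟨rfl, by linarith⟩
  rw [Finset.sum_pair hab, ← hconj]
  constructor
  · rintro ⟨σ, hσ⟩
    obtain ⟨B, hB⟩ := σ.parts_nonempty (Finset.insert_ne_empty a {b})
    obtain ⟨i, j, hij, rfl, hc⟩ := hσ B hB
    have hsub : ({i, j} : Finset ι) = {a, b} :=
      Finset.eq_of_subset_of_card_le (σ.le hB) (by rw [hA, Finset.card_pair hij])
    have hi : i ∈ ({a, b} : Finset ι) := hsub ▸ Finset.mem_insert_self i _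
    have hj : j ∈ ({a, b} : Finset ι) :=
      hsub ▸ Finset.mem_insert_of_mem (Finset.mem_singleton_self j)
    rw [Finset.mem_insert, Finset.mem_singleton] at hi hj
    rw [hconj] at hc ⊢
    rcases hi with rfl | rfl <;> rcases hj with rfl | rfl
    · exact absurd rfl hij
    · exact hc
    · linarith
    · exact absurd rfl hij
  · intro hc
    refine ⟨Finpartition.indiscrete (Finset.insert_ne_empty a {b}), fun B hB => ?_⟩
    rw [Finpartition.indiscrete_parts, Finset.mem_singleton] at hB
    exact ⟨a, b, hab, hB, hc⟩

open Classical in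
/-- The limit vanishes unless its index set is a conjugate tuple of even size. -/
theorem isConjugateTuple_of_L_ne_zero {A : Finset ι} {x : E} (h : D.L X f A x ≠ 0) :
    Even A.card ∧ 2 ≤ A.card ∧ D.IsConjugateTuple f A := by
  rw [L] at h
  by_cases h1 : A.card = 2 ∧ D.IsConjugateTuple f A
  · exact ⟨by rw [h1.1]; exact even_two, h1.1.ge, h1.2⟩
  · rw [if_neg h1] at h
    by_cases h2 : 4 ≤ A.card ∧ Even A.card ∧ D.IsConjugateTuple f A
    · exact ⟨h2.2.1, by omega, h2.2.2⟩
    · rw [if_neg h2] at h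
      exact absurd rfl h

open Classical in
/-- If `A` is not a conjugate tuple of even size, then each of its partitions has a block that is
not, so that the branching operator vanishes on the family of the limits. -/
theorem branching_L_eq_zero {A : Finset ι} (hA : ¬ (Even A.card ∧ D.IsConjugateTuple f A)) :
    X.branching A (D.L X f) = fun _ => 0 := by
  funext z
  rw [Data.branching, Data.ζ_eq]
  have h1 : ∀ c : (Σ n : ℕ, (Fin n → E)), zetaSum A (D.L X f) c = 0 := by
    intro c
    unfold zetaSum partitionTerm
    refine Finset.sum_eq_zero fun σ _ => Finset.sum_eq_zero fun e _ => ?_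
    by_contra hne
    refine hA ?_
    have hB : ∀ B : {B // B ∈ σ.parts}, _ := fun B =>
      isConjugateTuple_of_L_ne_zero (Finset.prod_ne_zero_iff.1 hne B (Finset.mem_univ B))
    constructor
    · rw [← σ.sum_card_parts]
      exact Finset.even_sum _ fun B hB' => (hB ⟨B, hB'⟩).1
    · choose τ hτ using fun B : {B // B ∈ σ.parts} => (hB B).2.2
      refine ⟨σ.bind fun B hB' => τ ⟨B, hB'⟩, fun B' hB' => ?_⟩
      obtain ⟨B, hBσ, hB'τ⟩ := Finpartition.mem_bind.1 hB'
      exact hτ ⟨B, hBσ⟩ B' hB'τ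
  simp [h1]

end Spectrum

end BMP

namespace BMP

namespace Spectrum

variable {E : Type u} [MeasurableSpace E] {D : Spectrum E} {X : Data.{u, v} E} {k : ℕ} {K : NNReal}
  {ι : Type} {f : ι → BddFun E}

/-! ### Normalised moments -/

variable (D) in
/-- The order of growth contributed by the function `f_i`. -/
def weight (f : ι → BddFun E) (t : ℝ) (i : ι) : ℝ :=
  Real.exp (D.lam1 / 2 * t) * (1 + t) ^ ((D.pOf (f i) : ℝ) + ((D.p1 : ℝ) - 2) / 2)

variable (D) in
/-- The order of growth of the product moments. -/
def scale (f : ι → BddFun E) (A : Finset ι) (t : ℝ) : ℝ := ∏ i ∈ A, D.weight f t i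

theorem weight_pos (f : ι → BddFun E) {t : ℝ} (ht : 0 ≤ t) (i : ι) : 0 < D.weight f t i :=
  mul_pos (Real.exp_pos _) (Real.rpow_pos_of_pos (by linarith) _)

theorem scale_pos (f : ι → BddFun E) (A : Finset ι) {t : ℝ} (ht : 0 ≤ t) : 0 < D.scale f A t :=
  Finset.prod_pos fun i _ => weight_pos f ht i

theorem scale_eq (f : ι → BddFun E) (A : Finset ι) {t : ℝ} (ht : 0 ≤ t) :
    D.scale f A t = Real.exp (A.card * D.lam1 * t / 2) *
      (1 + t) ^ ((D.pTilde f A : ℝ) + A.card * ((D.p1 : ℝ) - 2) / 2) := by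
  have hpos : 0 < 1 + t := by linarith
  simp only [scale, weight]
  rw [Finset.prod_mul_distrib, Finset.prod_const, ← Real.exp_nat_mul,
    ← Real.rpow_sum_of_pos hpos, Finset.sum_add_distrib, Finset.sum_const, nsmul_eq_mul, pTilde]
  push_cast
  congr 2
  · ring
  · ring

variable (X D) in
/-- The product moments divided by their order of growth; these converge to `L_A`. -/
def nmom (f : ι → BddFun E) (A : Finset ι) (t : ℝ) (x : E) : ℂ :=
  ((D.scale f A t : ℝ) : ℂ)⁻¹ * X.mom (fun i => (f i).1) A t x

variable (X D) in
/-- Uniform convergence of the normalised moments of order `n`, for functions bounded by `R`. -/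
def LimitRate (ι : Type) (n : ℕ) (R : ℝ) : Prop :=
  ∃ ε, IsRate ε ∧ ∀ f : ι → BddFun E, (∀ i, f i ∈ D.EiCrit ∧ ∀ y, ‖(f i).1 y‖ ≤ R) →
    ∀ A : Finset ι, A.card = n → ∀ t, 0 ≤ t → ∀ x, ‖nmom D X f A t x - D.L X f A x‖ ≤ ε t

/-- In the first order the fluctuations are smaller than the normalisation. -/
theorem H1.limitRate_one (hH : D.H1 X) (hK : X.MomentBound k K) (hk : 1 ≤ k) {R : ℝ}
    (hR : 0 ≤ R) : LimitRate D X ι 1 R := by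
  obtain ⟨_, _, M, hM0, hM⟩ := hH.exists_rate_critLead hK hk
  have h1 : Tendsto (fun t : ℝ => M * R * (1 + t) ^ (-(1 / 2) : ℝ)) atTop (𝓝 0) := by
    have := ((tendsto_rpow_neg_atTop (y := 1 / 2) (by norm_num)).comp
      (tendsto_atTop_add_const_left _ (1 : ℝ) tendsto_id)).const_mul (M * R)
    simpa using this
  obtain ⟨ε, hε, hle⟩ := exists_isRate_of_tendsto (g := fun t : ℝ =>
    M * R * (1 + t) ^ (-(1 / 2) : ℝ)) (by
      refine ContinuousOn.mul continuousOn_const (ContinuousOn.rpow_const (by fun_prop) ?_)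
      intro t ht
      have : (0 : ℝ) ≤ t := ht
      exact Or.inl (by positivity)) h1
  refine ⟨ε, hε, fun f hf A hA t ht x => ?_⟩
  obtain ⟨i, rfl⟩ := Finset.card_eq_one.1 hA
  have hL : D.L X f {i} x = 0 := by
    rw [L, if_neg (by simp), if_neg (by simp)]
  have hpos : 0 < 1 + t := by linarith
  have h2 := ((hM (f i) (hf i).1 R hR (hf i).2 x).2 t ht).2
  have hp := (hH.pOf_spec (hf i).1).1
  have hp1 : 1 ≤ D.p1 := hH.p_pos 0
  rw [hL, sub_zero, nmom, norm_mul, norm_inv, Complex.norm_real,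
    Real.norm_of_nonneg (scale_pos f _ ht).le, Data.mom_singleton, scale, Finset.prod_singleton,
    inv_mul_le_iff₀ (weight_pos f ht i)]
  refine h2.trans ?_
  refine le_trans ?_ (mul_le_mul_of_nonneg_left (hle t ht) (weight_pos f ht i).le)
  rw [weight]
  have e1 : (1 + t) ^ (D.pOf (f i) - 1) ≤ (1 + t) ^ ((D.pOf (f i) : ℝ) + ((D.p1 : ℝ) - 2) / 2) *
      (1 + t) ^ (-(1 / 2) : ℝ) := by
    rw [← Real.rpow_natCast, ← Real.rpow_add hpos, Nat.cast_sub hp, Nat.cast_one]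
    refine Real.rpow_le_rpow_of_exponent_le (by linarith) ?_
    have : (1 : ℝ) ≤ D.p1 := by exact_mod_cast hp1
    linarith
  calc _ ≤ Real.exp (D.lam1 / 2 * t) * ((1 + t) ^ ((D.pOf (f i) : ℝ) + ((D.p1 : ℝ) - 2) / 2) *
      (1 + t) ^ (-(1 / 2) : ℝ)) * (M * R) := by gcongr
    _ = _ := by ring

/-! ### The second moments -/

open Classical in
theorem exists_eq_singleton_of_ssubset {A B : Finset ι} (hA : A.card = 2) (hB : B.Nonempty)
    (hBA : B ⊂ A) : ∃ i ∈ A, B = {i} := by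
  have h1 := Finset.card_lt_card hBA
  have h2 := hB.card_pos
  obtain ⟨i, rfl⟩ := Finset.card_eq_one.1 (show B.card = 1 by omega)
  exact ⟨i, hBA.1 (Finset.mem_singleton_self i), rfl⟩

open Classical in
/-- The limit of the second moments in terms of the leading coefficient of `ψ_t` and the value of
a Beta integral. -/
theorem H1.L_pair (hH : D.H1 X) (hf : ∀ i, f i ∈ D.EiCrit) {A : Finset ι} (hA : A.card = 2)
    (hG : X.branching A (fun B y => ∏ i ∈ B, (D.Φ₂ (D.ν (f i)) 1 (D.star (f i))).1 y) ∈ BddFun E)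
    (x : E) :
    D.L X f A x = (if ∑ i ∈ A, (D.lam (f i)).im = 0 then
      ((D.p1 - 1).factorial * (D.pTilde f A - 2).factorial : ℂ) /
        (D.p1 - 1 + (D.pTilde f A - 2) + 1).factorial else 0) *
      (D.lead (toBdd (X.branching A fun B y => ∏ i ∈ B, (D.critLead (f i)).1 y))).1 x := by
  have hp1 : 1 ≤ D.p1 := hH.p_pos 0
  have hp : 2 ≤ D.pTilde f A := by
    have := Finset.sum_le_sum fun i (_ : i ∈ A) => (hH.pOf_spec (hf i)).1
    simpa [hA, pTilde] using this
  have h1 : X.branching A (fun B y => ∏ i ∈ B, (D.critLead (f i)).1 y) =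
      ((∏ i ∈ A, ((D.pOf (f i) - 1).factorial : ℂ)⁻¹) • X.branching A
        fun B y => ∏ i ∈ B, (D.Φ₂ (D.ν (f i)) 1 (D.star (f i))).1 y : E → ℂ) := by
    funext z
    change X.branching A _ z = (∏ i ∈ A, ((D.pOf (f i) - 1).factorial : ℂ)⁻¹) * X.branching A _ z
    rw [← Data.branching_mul]
    congr 1
    funext B y
    rw [← Finset.prod_mul_distrib]
    rfl
  have h2 : toBdd (X.branching A fun B y => ∏ i ∈ B, (D.critLead (f i)).1 y) =
      (∏ i ∈ A, ((D.pOf (f i) - 1).factorial : ℂ)⁻¹) • toBdd (X.branching A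
        fun B y => ∏ i ∈ B, (D.Φ₂ (D.ν (f i)) 1 (D.star (f i))).1 y) := by
    apply Subtype.ext
    rw [h1, toBdd_val ((BddFun E).smul_mem _ hG)]
    change _ = _ • (toBdd _).1
    rw [toBdd_val hG]
  rw [L, h2, lead_smul]
  by_cases hc : ∑ i ∈ A, (D.lam (f i)).im = 0
  · rw [if_pos ⟨hA, (hH.isConjugateTuple_pair hf hA).2 hc⟩, if_pos hc, lead]
    rw [show D.p1 - 1 + (D.pTilde f A - 2) + 1 = D.p1 + D.pTilde f A - 2 by omega]
    have h3 : ((D.p1 - 1).factorial : ℂ) ≠ 0 := by exact_mod_cast Nat.factorial_ne_zero _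
    have h4 : (toBdd fun z => (X.γ z : ℂ) * X.ζ A
        (fun B y => ∏ i ∈ B, (D.Φ₂ (D.ν (f i)) 1 (D.star (f i))).1 y) z) =
      toBdd (X.branching A fun B y => ∏ i ∈ B, (D.Φ₂ (D.ν (f i)) 1 (D.star (f i))).1 y) := rfl
    rw [h4]
    simp only [Submodule.coe_smul, Pi.smul_apply, smul_eq_mul]
    rw [Finset.prod_inv_distrib, div_eq_mul_inv, div_eq_mul_inv, mul_inv]
    field_simp
  · rw [if_neg fun h => hc ((hH.isConjugateTuple_pair hf hA).1 h.2), if_neg (by omega), if_neg hc,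
      zero_mul]

end Spectrum

end BMP

namespace BMP

namespace Data

variable {E : Type u} [MeasurableSpace E] {X : Data.{u, v} E} {k : ℕ} {K : NNReal} {ι : Type}

theorem measurable_branching_mom {f : ι → E → ℂ} (hf : ∀ i, Measurable (f i)) (A : Finset ι) :
    Measurable fun p : ℝ × E => X.branching A (fun B => X.mom f B p.1) p.2 :=
  measurable_branching (g := fun r B => X.mom f B r) fun B _ _ => measurable_mom hf B

theorem MomentBound.exists_norm_branching_mom_le (hK : X.MomentBound k K) (hk : 1 ≤ k) (T : ℝ)
    {f : ι → E → ℂ} {C : ℝ} (hC : ∀ i y, ‖f i y‖ ≤ C) (hC0 : 0 ≤ C) {A : Finset ι}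
    (hA : A.Nonempty) (hAk : A.card ≤ k) :
    ∃ G : ℝ, 0 ≤ G ∧ ∀ r, r ≤ T → ∀ y, ‖X.branching A (fun B => X.mom f B r) y‖ ≤ G := by
  obtain ⟨M, hM0, hM⟩ := hK.exists_norm_mom_le hk T hC0
  refine ⟨X.rateBound * (numPartitions A * (k * max 1 M ^ k * max 1 M) * K), ?_, fun r hr y =>
    hK.norm_branching_le hA hAk (le_max_left _ _) (fun B _ hB y =>
      (hM ι f hC B ((Finset.card_le_card hB.1).trans hAk) r hr y).trans (le_max_right _ _)) y⟩
  have := X.rateBound_nonneg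
  positivity

theorem MomentBound.branching_mom_mem (hK : X.MomentBound k K) (hk : 1 ≤ k) (r : ℝ)
    {f : ι → E → ℂ} (hf : ∀ i, Measurable (f i)) {C : ℝ} (hC : ∀ i y, ‖f i y‖ ≤ C) (hC0 : 0 ≤ C)
    {A : Finset ι} (hA : A.Nonempty) (hAk : A.card ≤ k) :
    X.branching A (fun B => X.mom f B r) ∈ BddFun E := by
  obtain ⟨G, -, hG⟩ := hK.exists_norm_branching_mom_le hk r hC hC0 hA hAk
  refine ⟨?_, G, hG r le_rfl⟩
  have h1 := (measurable_branching_mom (X := X) hf A).comp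
    (measurable_const.prodMk measurable_id : Measurable fun y : E => (r, y))
  exact h1

end Data

namespace Spectrum

variable {E : Type u} [MeasurableSpace E] {D : Spectrum E} {X : Data.{u, v} E} {k : ℕ} {K : NNReal}
  {ι : Type} {f : ι → BddFun E}

theorem lam_re (hH : D.H1 X) {f : BddFun E} (hf : f ∈ D.EiCrit) : (D.lam f).re = D.lam1 / 2 := by
  linarith [(hH.mem_ei_ν hf).2]

variable (D) in
/-- The growth of `ψ_t[f]` for `f` in a critical eigenspace. -/
def critGrowth (f : BddFun E) (t : ℝ) : ℂ :=
  Complex.exp (D.lam f * t) * (((1 + t) ^ (D.pOf f - 1) : ℝ) : ℂ)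

theorem norm_critGrowth (hH : D.H1 X) {f : BddFun E} (hf : f ∈ D.EiCrit) {t : ℝ} (ht : 0 ≤ t) :
    ‖D.critGrowth f t‖ = Real.exp (D.lam1 / 2 * t) * (1 + t) ^ (D.pOf f - 1) := by
  rw [critGrowth, norm_mul, norm_cexp_mul_ofReal, lam_re hH hf, Complex.norm_real,
    Real.norm_of_nonneg (by positivity)]

theorem critGrowth_ne_zero (f : BddFun E) {t : ℝ} (ht : 0 ≤ t) : D.critGrowth f t ≠ 0 := by
  refine mul_ne_zero (Complex.exp_ne_zero _) ?_
  have : (0 : ℝ) < (1 + t) ^ (D.pOf f - 1) := by positivity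
  exact_mod_cast this.ne'

theorem sum_pOf_sub_one (hH : D.H1 X) (hf : ∀ i, f i ∈ D.EiCrit) {A : Finset ι}
    (hA : A.card = 2) : ∑ i ∈ A, (D.pOf (f i) - 1) + 2 = D.pTilde f A := by
  have h1 : ∑ i ∈ A, (D.pOf (f i) - 1) + ∑ i ∈ A, 1 = D.pTilde f A := by
    rw [← Finset.sum_add_distrib, pTilde]
    exact Finset.sum_congr rfl fun i _ => Nat.sub_add_cancel (hH.pOf_spec (hf i)).1
  simpa [hA] using h1

/-- For a pair, the exponential growth rates add up to `λ_1`, and the frequencies to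
`θ = ∑ Im λ(f_i)`. -/
theorem prod_critGrowth (hH : D.H1 X) (hf : ∀ i, f i ∈ D.EiCrit) {A : Finset ι}
    (hA : A.card = 2) (t : ℝ) : ∏ i ∈ A, D.critGrowth (f i) t =
      ((Real.exp (D.lam1 * t) * (1 + t) ^ (D.pTilde f A - 2) : ℝ) : ℂ) *
        Complex.exp (((∑ i ∈ A, (D.lam (f i)).im : ℝ) : ℂ) * t * Complex.I) := by
  have h1 := sum_pOf_sub_one hH hf hA
  have h2 : ∑ i ∈ A, D.lam (f i) =
      (D.lam1 : ℂ) + ((∑ i ∈ A, (D.lam (f i)).im : ℝ) : ℂ) * Complex.I := by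
    apply Complex.ext
    · rw [Complex.re_sum, Finset.sum_congr rfl fun i _ => lam_re hH (hf i)]
      simp only [Finset.sum_const, hA]
      simp
      ring
    · simp [Complex.im_sum]
  simp only [critGrowth]
  rw [Finset.prod_mul_distrib, ← Complex.exp_sum, ← Finset.sum_mul, h2, ← Complex.ofReal_prod,
    Finset.prod_pow_eq_pow_sum, show ∑ i ∈ A, (D.pOf (f i) - 1) = D.pTilde f A - 2 by omega,
    Complex.ofReal_mul, Complex.ofReal_exp, Complex.ofReal_mul, add_mul, Complex.exp_add]
  ring_nf

theorem scale_pair (hH : D.H1 X) (hf : ∀ i, f i ∈ D.EiCrit) {A : Finset ι} (hA : A.card = 2)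
    {t : ℝ} (ht : 0 ≤ t) : D.scale f A t =
      Real.exp (D.lam1 * t) * (1 + t) ^ (D.p1 - 1 + (D.pTilde f A - 2) + 1) := by
  have h1 := sum_pOf_sub_one hH hf hA
  have hp1 : 1 ≤ D.p1 := hH.p_pos 0
  rw [scale_eq f A ht, hA, ← Real.rpow_natCast]
  congr 2
  · push_cast
    ring
  · rw [show D.p1 - 1 + (D.pTilde f A - 2) + 1 = D.p1 + D.pTilde f A - 2 by omega,
      Nat.cast_sub (by omega)]
    push_cast
    ring

/-- For pairs, the oscillating Beta integrals converge at a common rate. -/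
theorem H1.exists_rate_beta_pair (hH : D.H1 X) (ι : Type) : ∃ ε, IsRate ε ∧ ∀ f : ι → BddFun E,
    (∀ i, f i ∈ D.EiCrit) → ∀ A : Finset ι, A.card = 2 → ∀ t : ℝ, 0 ≤ t →
    ‖betaInt (∑ i ∈ A, (D.lam (f i)).im) (D.p1 - 1) (D.pTilde f A - 2) t -
      if ∑ i ∈ A, (D.lam (f i)).im = 0 then
        ((D.p1 - 1).factorial * (D.pTilde f A - 2).factorial : ℂ) /
          (D.p1 - 1 + (D.pTilde f A - 2) + 1).factorial else 0‖ ≤ ε t := by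
  classical
  choose e he h using fun (i j : Fin D.m) (n : ℕ) =>
    exists_rate_beta ((D.eig i).im + (D.eig j).im) (D.p1 - 1) n
  refine ⟨fun t => ∑ a ∈ (Finset.univ ×ˢ Finset.univ) ×ˢ Finset.range (2 * D.height + 1),
    e a.1.1 a.1.2 a.2 t, IsRate.sum _ fun a _ => he _ _ _, fun f hf A hA t ht => ?_⟩
  have h1 := sum_pOf_sub_one hH hf hA
  obtain ⟨a, b, hab, rfl⟩ := Finset.card_eq_two.1 hA
  have h2 : D.pTilde f {a, b} - 2 ≤ 2 * D.height := by
    have ha := (hH.pOf_spec (hf a)).2.1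
    have hb := (hH.pOf_spec (hf b)).2.1
    rw [pTilde, Finset.sum_pair hab]
    omega
  rw [Finset.sum_pair hab]
  refine (h (D.ν (f a)) (D.ν (f b)) (D.pTilde f {a, b} - 2) t ht).trans ?_
  exact Finset.single_le_sum (f := fun c : (Fin D.m × Fin D.m) × ℕ => e c.1.1 c.1.2 c.2 t)
    (fun c _ => (he _ _ _).nonneg t) (a := ((D.ν (f a), D.ν (f b)), D.pTilde f {a, b} - 2))
    (by simp; omega)

open Classical in
theorem branching_pair_mem (hK : X.MomentBound k K) (hk : 2 ≤ k) (h : ι → BddFun E)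
    {A : Finset ι} (hA : A.card = 2) :
    X.branching A (fun B y => ∏ i ∈ B, (h i).1 y) ∈ BddFun E := by
  refine ⟨?_, ?_⟩
  · have h1 := (Data.measurable_branching (X := X) (A := A) (T := Unit)
      (g := fun _ B y => ∏ i ∈ B, (h i).1 y) fun B _ _ =>
      (Finset.measurable_fun_prod B fun i _ => (h i).2.1).comp measurable_snd).comp
      (measurable_const.prodMk measurable_id : Measurable fun y : E => ((), y))
    exact h1
  · choose C hC using fun i => (h i).2.2
    refine ⟨_, hK.norm_branching_le (Finset.card_pos.1 (by omega)) (hA.le.trans hk)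
      (le_max_left 1 (∑ i ∈ A, |C i|)) fun B hB hBA y => ?_⟩
    obtain ⟨i, hi, rfl⟩ := exists_eq_singleton_of_ssubset hA hB hBA
    rw [Finset.prod_singleton]
    refine ((hC i y).trans (le_abs_self _)).trans (le_trans ?_ (le_max_right _ _))
    exact Finset.single_le_sum (f := fun i => |C i|) (fun _ _ => abs_nonneg _) hi

open Classical in
/-- The branching term of a pair, at time `r`, is the product of the growth factors of its members
times a function that converges as `r → ∞`. -/
theorem H1.exists_rate_branching_pair [Fintype ι] (hH : D.H1 X) (hK : X.MomentBound k K)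
    (hk : 2 ≤ k) {R : ℝ} (hR : 0 ≤ R) : ∃ ε, IsRate ε ∧ ∃ M : ℝ, 0 ≤ M ∧ ∀ f : ι → BddFun E,
      (∀ i, f i ∈ D.EiCrit ∧ ∀ y, ‖(f i).1 y‖ ≤ R) → ∀ A : Finset ι, A.card = 2 →
      X.branching A (fun B y => ∏ i ∈ B, (D.critLead (f i)).1 y) ∈ BddFun E ∧
      (∀ z, ‖X.branching A (fun B y => ∏ i ∈ B, (D.critLead (f i)).1 y) z‖ ≤ M) ∧
      ∀ r : ℝ, 0 ≤ r → ∀ z, ‖X.branching A (fun B => X.mom (fun i => (f i).1) B r) z -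
        (∏ i ∈ A, D.critGrowth (f i) r) *
          X.branching A (fun B y => ∏ i ∈ B, (D.critLead (f i)).1 y) z‖ ≤
        ‖∏ i ∈ A, D.critGrowth (f i) r‖ * ε r := by
  obtain ⟨ε, hε, M, hM0, hM⟩ := hH.exists_rate_critLead hK (by omega)
  set C : ℝ := max 1 (M * R) with hCdef
  have hC1 : 1 ≤ C := le_max_left _ _
  set NP : ℕ := ∑ A : Finset ι, numPartitions A with hNP
  have hNPle : ∀ A : Finset ι, (numPartitions A : ℝ) ≤ NP := fun A => by
    exact_mod_cast Finset.single_le_sum (f := fun A : Finset ι => numPartitions A)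
      (fun _ _ => Nat.zero_le _) (Finset.mem_univ A)
  have hrb := X.rateBound_nonneg
  refine ⟨fun r => X.rateBound * (NP * (k * C ^ k * R) * K) * ε r, hε.const_mul (by positivity),
    X.rateBound * (NP * (k * C ^ k * C) * K), by positivity, fun f hf A hA => ?_⟩
  have hAn : A.Nonempty := Finset.card_pos.1 (by omega)
  have hbl : ∀ B : Finset ι, B.Nonempty → B ⊂ A → ∀ y, ‖∏ i ∈ B, (D.critLead (f i)).1 y‖ ≤ C := by
    intro B hB hBA y
    obtain ⟨i, -, rfl⟩ := exists_eq_singleton_of_ssubset hA hB hBA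
    rw [Finset.prod_singleton]
    exact (hM (f i) (hf i).1 R hR (hf i).2 y).1.trans (le_max_right _ _)
  have hblm : ∀ B : Finset ι, Measurable fun y => ∏ i ∈ B, (D.critLead (f i)).1 y := fun B =>
    Finset.measurable_fun_prod _ fun i _ => (D.critLead (f i)).2.1
  have hb : ∀ z, ‖X.branching A (fun B y => ∏ i ∈ B, (D.critLead (f i)).1 y) z‖ ≤
      X.rateBound * (NP * (k * C ^ k * C) * K) := fun z =>
    (hK.norm_branching_le hAn (by omega) hC1 hbl z).trans (by have := hNPle A; gcongr)
  refine ⟨branching_pair_mem hK hk _ hA, hb, fun r hr z => ?_⟩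
  · set d : ι → ℂ := fun i => D.critGrowth (f i) r with hd
    have hd0 : ∀ i, d i ≠ 0 := fun i => critGrowth_ne_zero (f i) hr
    -- by homogeneity of `ζ_A`, the growth factors can be divided out of the moments, which are of
    -- order one since the blocks of the partitions are singletons
    have e1 : X.branching A (fun B => X.mom (fun i => (f i).1) B r) z = (∏ i ∈ A, d i) *
        X.branching A (fun B y => (∏ i ∈ B, d i)⁻¹ * X.mom (fun i => (f i).1) B r y) z := by
      rw [← Data.branching_mul]
      congr 1
      funext B y
      rw [mul_inv_cancel_left₀ (Finset.prod_ne_zero_iff.2 fun i _ => hd0 i)]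
    rw [e1, ← mul_sub, norm_mul]
    refine mul_le_mul_of_nonneg_left ?_ (norm_nonneg _)
    have h2 := hK.norm_branching_sub_le (A := A) hAn (by omega) hC1
      (mul_nonneg hR (hε.nonneg r)) (g := fun B y => (∏ i ∈ B, d i)⁻¹ *
        X.mom (fun i => (f i).1) B r y) (g' := fun B y => ∏ i ∈ B, (D.critLead (f i)).1 y)
      (fun B _ _ => by
        have h1 := (Data.measurable_mom (X := X) (f := fun i => (f i).1)
          (fun i => (f i).2.1) B).comp
          (measurable_const.prodMk measurable_id : Measurable fun y : E => (r, y))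
        exact measurable_const.mul h1)
      (fun B _ _ => hblm B) (fun B hB hBA y => by
        obtain ⟨i, -, rfl⟩ := exists_eq_singleton_of_ssubset hA hB hBA
        rw [Finset.prod_singleton, Data.mom_singleton, norm_mul, norm_inv,
          inv_mul_le_iff₀ (norm_pos_iff.2 (hd0 i)), hd, norm_critGrowth hH (hf i).1 hr]
        refine ((hM (f i) (hf i).1 R hR (hf i).2 y).2 r hr).2.trans ?_
        have := le_max_right 1 (M * R)
        gcongr) hbl (fun B hB hBA y => by
        obtain ⟨i, -, rfl⟩ := exists_eq_singleton_of_ssubset hA hB hBA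
        rw [Finset.prod_singleton, Finset.prod_singleton, Data.mom_singleton]
        have e2 : (d i)⁻¹ * X.sg r (f i).1 y - (D.critLead (f i)).1 y =
            (d i)⁻¹ * (X.sg r (f i).1 y - d i * (D.critLead (f i)).1 y) := by
          rw [mul_sub, inv_mul_cancel_left₀ (hd0 i)]
        rw [e2, norm_mul, norm_inv, inv_mul_le_iff₀ (norm_pos_iff.2 (hd0 i)), hd,
          norm_critGrowth hH (hf i).1 hr]
        exact ((hM (f i) (hf i).1 R hR (hf i).2 y).2 r hr).1) z
    refine h2.trans ?_
    have := hNPle A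
    have := hε.nonneg r
    calc _ ≤ X.rateBound * (NP * (k * C ^ k * (R * ε r)) * K) := by gcongr
      _ = _ := by ring

end Spectrum

end BMP

namespace BMP

namespace Spectrum

variable {E : Type u} [MeasurableSpace E] {D : Spectrum E} {X : Data.{u, v} E} {k : ℕ} {K : NNReal}
  {ι : Type} {f : ι → BddFun E}

theorem exists_rate_inv_one_add : ∃ ε, IsRate ε ∧ ∀ t : ℝ, 0 ≤ t → (1 + t)⁻¹ ≤ ε t := by
  refine exists_isRate_of_tendsto (fun t ht => ?_)
    (by simpa using tendsto_inv_one_add_pow (n := 1) le_rfl)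
  have : (0 : ℝ) ≤ t := ht
  exact (ContinuousAt.inv₀ (by fun_prop) (by positivity)).continuousWithinAt

/-- The leading behaviour of `ψ_s[g]` when `g` is close to a multiple of `G`. -/
theorem norm_sg_sub_lead_le (hK : X.MomentBound k K) (hk : 1 ≤ k) {ε : ℝ → ℝ} {M : ℝ}
    (hM : ∀ (f : BddFun E) (R : ℝ), 0 ≤ R → (∀ y, ‖f.1 y‖ ≤ R) →
      ∀ x, ‖(D.lead f).1 x‖ ≤ M * R ∧ ∀ t : ℝ, 0 ≤ t →
      ‖X.sg t f.1 x - ((Real.exp (D.lam1 * t) * (1 + t) ^ (D.p1 - 1) : ℝ) : ℂ) * (D.lead f).1 x‖ ≤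
        Real.exp (D.lam1 * t) * (1 + t) ^ (D.p1 - 1) * (R * ε t) ∧
      ‖X.sg t f.1 x‖ ≤ Real.exp (D.lam1 * t) * (1 + t) ^ (D.p1 - 1) * (M * R))
    {g : E → ℂ} (hg : g ∈ BddFun E) (G : BddFun E) {η R : ℝ} (hη : 0 ≤ η) (hR : 0 ≤ R)
    (hG : ∀ y, ‖G.1 y‖ ≤ R) {c : ℂ} (hc : ∀ y, ‖g y - c * G.1 y‖ ≤ ‖c‖ * η) {s : ℝ} (hs : 0 ≤ s)
    (x : E) :
    ‖X.sg s g x - c * (((Real.exp (D.lam1 * s) * (1 + s) ^ (D.p1 - 1) : ℝ) : ℂ) *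
      (D.lead G).1 x)‖ ≤
      ‖c‖ * (Real.exp (D.lam1 * s) * (1 + s) ^ (D.p1 - 1)) * (M * η + R * ε s) := by
  have hcG : (fun y => c * G.1 y) ∈ BddFun E := (BddFun E).smul_mem c G.2
  have h1 := ((hM ⟨fun y => g y - c * G.1 y, (BddFun E).sub_mem hg hcG⟩ (‖c‖ * η)
    (by positivity) hc x).2 s hs).2
  have h2 := ((hM G R hR hG x).2 s hs).1
  change ‖X.sg s (fun y => g y - c * G.1 y) x‖ ≤ _ at h1
  rw [hK.sg_sub hk hg hcG, Data.sg_const_mul] at h1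
  set q : ℝ := Real.exp (D.lam1 * s) * (1 + s) ^ (D.p1 - 1) with hq
  have e1 : X.sg s g x - c * ((q : ℂ) * (D.lead G).1 x) = (X.sg s g x - c * X.sg s G.1 x) +
      c * (X.sg s G.1 x - (q : ℂ) * (D.lead G).1 x) := by ring
  rw [e1]
  refine (norm_add_le _ _).trans ?_
  rw [norm_mul c]
  calc _ ≤ q * (M * (‖c‖ * η)) + ‖c‖ * (q * (R * ε s)) := by gcongr
    _ = _ := by ring

open Classical in
/-- In the second order, the limit comes from the early and the late times of the branching event
alike: the growth rates of the pair and of the semigroup agree, so that the convolution of their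
polynomial factors gives a Beta integral. -/
theorem H1.limitRate_two [Fintype ι] (hH : D.H1 X) (hK : X.MomentBound k K) (hk : 2 ≤ k) {R : ℝ}
    (hR : 0 ≤ R) : LimitRate D X ι 2 R := by
  have hk1 : 1 ≤ k := by omega
  obtain ⟨ε₁, hε₁, M₁, hM₁0, hM₁⟩ := hH.exists_rate_lead hK hk1
  obtain ⟨ε₂, hε₂, M₂, hM₂0, hM₂⟩ := hH.exists_rate_branching_pair (ι := ι) hK hk hR
  obtain ⟨ε₃, hε₃, h₃⟩ := hH.exists_rate_beta_pair ι
  obtain ⟨ε₄, hε₄, h₄⟩ := exists_rate_inv_one_add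
  obtain ⟨ε₅, hε₅, h₅⟩ := ((hε₂.const_mul hM₁0).add (hε₁.const_mul hM₂0)).average
  refine ⟨fun t => M₁ * R ^ 2 * ε₄ t + (ε₅ t + M₁ * M₂ * ε₃ t),
    (hε₄.const_mul (by positivity)).add (hε₅.add (hε₃.const_mul (by positivity))),
    fun f hf A hA t ht x => ?_⟩
  have hfc : ∀ i, f i ∈ D.EiCrit := fun i => (hf i).1
  have hAn : A.Nonempty := Finset.card_pos.1 (by omega)
  obtain ⟨hGm, hGb, hGr⟩ := hM₂ f hf A hA
  set G : BddFun E := toBdd (X.branching A fun B y => ∏ i ∈ B, (D.critLead (f i)).1 y) with hG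
  have hGv : G.1 = X.branching A fun B y => ∏ i ∈ B, (D.critLead (f i)).1 y := toBdd_val hGm
  set θ : ℝ := ∑ i ∈ A, (D.lam (f i)).im with hθ
  set n : ℕ := D.pTilde f A - 2 with hn
  set m : ℕ := D.p1 - 1 with hm
  set g : ℝ → E → ℂ := fun r => X.branching A fun B => X.mom (fun i => (f i).1) B r with hg
  set P : ℝ → ℂ := fun r => ∏ i ∈ A, D.critGrowth (f i) r with hP
  have hpos : 0 < 1 + t := by linarith
  have hPn : ∀ r, 0 ≤ r → ‖P r‖ = Real.exp (D.lam1 * r) * (1 + r) ^ n := by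
    intro r hr
    simp only [hP]
    rw [prod_critGrowth hH hfc hA, norm_mul, Complex.norm_real, ← Complex.ofReal_mul,
      Complex.norm_exp_ofReal_mul_I, mul_one, Real.norm_of_nonneg (by positivity)]
  have hfm : ∀ i, Measurable (f i).1 := fun i => (f i).2.1
  have hfR : ∀ i y, ‖(f i).1 y‖ ≤ R := fun i => (hf i).2
  obtain ⟨B₀, hB₀, hB₀g⟩ := hK.exists_norm_branching_mom_le hk1 t hfR hR hAn (hA.le.trans hk)
  have hgm : ∀ r, g r ∈ BddFun E := fun r =>
    hK.branching_mom_mem hk1 r hfm hfR hR hAn (hA.le.trans hk)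
  have hint : IntegrableOn (fun s => X.sg s (g (t - s)) x) (Set.Ioc 0 t) :=
    hK.integrableOn_sg hk1 (g := g) (Data.measurable_branching_mom hfm A) hB₀ hB₀g le_rfl x
  -- the main part of the convolution
  set Q : ℝ → ℂ := fun s => P (t - s) * (((Real.exp (D.lam1 * s) * (1 + s) ^ m : ℝ) : ℂ) *
    (D.lead G).1 x) with hQ
  have hQcont : Continuous Q := by
    simp only [hQ, hP, critGrowth]
    fun_prop
  have hQint : IntegrableOn Q (Set.Ioc 0 t) :=
    (hQcont.integrableOn_Icc).mono_set Set.Ioc_subset_Icc_self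
  have hbetaQ : (∫ s in Set.Ioc 0 t, Q s) =
      ((D.scale f A t : ℝ) : ℂ) * (betaInt θ m n t * (D.lead G).1 x) := by
    have e1 : ∀ s, Q s = ((Real.exp (D.lam1 * t) : ℝ) : ℂ) * (D.lead G).1 x *
        (Complex.exp (θ * (t - s) * Complex.I) * (((1 + (t - s)) ^ n * (1 + s) ^ m : ℝ) : ℂ)) := by
      intro s
      have e2 : Real.exp (D.lam1 * t) = Real.exp (D.lam1 * (t - s)) * Real.exp (D.lam1 * s) := by
        rw [← Real.exp_add]
        congr 1
        ring
      simp only [hQ, hP]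
      rw [prod_critGrowth hH hfc hA, e2, ← hθ, ← hn, Complex.ofReal_sub]
      push_cast
      ring
    simp_rw [e1]
    rw [integral_const_mul, scale_pair hH hfc hA ht, ← hm, ← hn, betaInt,
      intervalIntegral.integral_of_le ht]
    have e3 : ((1 + t : ℝ) : ℂ) ^ (m + n + 1) ≠ 0 := pow_ne_zero _ (by exact_mod_cast hpos.ne')
    rw [← Complex.ofReal_pow] at e3
    rw [Complex.ofReal_mul, Complex.ofReal_inv]
    generalize (∫ s in Set.Ioc 0 t, Complex.exp (θ * (t - s) * Complex.I) *
      (((1 + (t - s)) ^ n * (1 + s) ^ m : ℝ) : ℂ)) = J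
    field_simp
  have herr : ∀ s ∈ Set.Ioc 0 t, ‖X.sg s (g (t - s)) x - Q s‖ ≤
      Real.exp (D.lam1 * t) * (1 + t) ^ (m + n) * (M₁ * ε₂ (t - s) + M₂ * ε₁ s) := by
    intro s hs
    have hr : 0 ≤ t - s := by linarith [hs.2]
    -- replace the branching term at time `t - s` and the semigroup at time `s` by their leading
    -- terms
    have h1 := norm_sg_sub_lead_le hK hk1 hM₁ (hgm (t - s)) G (hε₂.nonneg (t - s)) hM₂0
      (by rw [hGv]; exact hGb) (c := P (t - s)) (by rw [hGv]; exact hGr _ hr) hs.1.le x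
    refine h1.trans ?_
    rw [hPn _ hr]
    have e2 : Real.exp (D.lam1 * t) = Real.exp (D.lam1 * (t - s)) * Real.exp (D.lam1 * s) := by
      rw [← Real.exp_add]
      congr 1
      ring
    have h5 := hε₂.nonneg (t - s)
    have h6 := hε₁.nonneg s
    have hs0 := hs.1.le
    rw [e2, pow_add]
    calc _ ≤ Real.exp (D.lam1 * (t - s)) * (1 + t) ^ n * (Real.exp (D.lam1 * s) * (1 + t) ^ m) *
        (M₁ * ε₂ (t - s) + M₂ * ε₁ s) := by
          gcongr
          · linarith
          · exact hs.2
      _ = _ := by ring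
  have hε₂int : IntegrableOn (fun s => ε₂ (t - s)) (Set.Ioc 0 t) :=
    Measure.integrableOn_of_bounded (M := ε₂ 0) (by simp)
      (hε₂.measurable.comp (by fun_prop)).aestronglyMeasurable (by
      filter_upwards [ae_restrict_mem measurableSet_Ioc] with s hs
      rw [Real.norm_of_nonneg (hε₂.nonneg _)]
      exact hε₂.le_zero (by linarith [hs.2]))
  -- the errors depend on `s` and on `t - s`; both kinds have the same average
  have hreflect : ∫ s in Set.Ioc 0 t, ε₂ (t - s) = ∫ s in Set.Ioc 0 t, ε₂ s := by
    rw [← intervalIntegral.integral_of_le ht, ← intervalIntegral.integral_of_le ht,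
      intervalIntegral.integral_comp_sub_left]
    simp
  have hduh : ‖X.duhamel g t x - ((D.scale f A t : ℝ) : ℂ) * (betaInt θ m n t * (D.lead G).1 x)‖ ≤
      D.scale f A t * ε₅ t := by
    rw [Data.duhamel, ← hbetaQ, ← integral_sub hint hQint]
    refine (norm_integral_le_of_norm_le (g := fun s => Real.exp (D.lam1 * t) * (1 + t) ^ (m + n) *
      (M₁ * ε₂ (t - s) + M₂ * ε₁ s)) (((hε₂int.const_mul _).add
        ((hε₁.integrableOn t).const_mul _)).const_mul _) ?_).trans ?_
    · filter_upwards [ae_restrict_mem measurableSet_Ioc] with s hs using herr s hs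
    rw [integral_const_mul, integral_add (hε₂int.const_mul _) ((hε₁.integrableOn t).const_mul _),
      integral_const_mul, hreflect, ← integral_const_mul, ← integral_add
      ((hε₂.integrableOn t).const_mul _) ((hε₁.integrableOn t).const_mul _),
      scale_pair hH hfc hA ht, pow_succ]
    have h7 := h₅ t ht
    rw [inv_mul_le_iff₀ hpos] at h7
    calc _ ≤ Real.exp (D.lam1 * t) * (1 + t) ^ (m + n) * ((1 + t) * ε₅ t) := by gcongr
      _ = _ := by ring
  -- the particles counted by both factors coincide
  obtain ⟨hprod, hprodR⟩ := Data.prod_mem_bddFun hfm hfR A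
  have hfirst : ‖X.sg t (fun y => ∏ i ∈ A, (f i).1 y) x‖ ≤
      D.scale f A t * (M₁ * R ^ 2 * ε₄ t) := by
    have h1 := ((hM₁ ⟨_, hprod⟩ (R ^ A.card) (by positivity) hprodR x).2 t ht).2
    refine h1.trans ?_
    rw [hA, scale_pair hH hfc hA ht]
    have h2 : (1 + t) ^ m ≤ (1 + t) ^ (m + n) := pow_le_pow_right₀ (by linarith) (by omega)
    have h3 : 1 ≤ (1 + t) * ε₄ t := by
      have := h₄ t ht
      rwa [inv_le_iff_one_le_mul₀' hpos] at this
    calc _ ≤ Real.exp (D.lam1 * t) * (1 + t) ^ (m + n) * (M₁ * R ^ 2) * 1 := by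
          rw [mul_one]
          gcongr
      _ ≤ Real.exp (D.lam1 * t) * (1 + t) ^ (m + n) * (M₁ * R ^ 2) * ((1 + t) * ε₄ t) := by gcongr
      _ = _ := by rw [pow_succ]; ring
  have hbeta := h₃ f hfc A hA t ht
  have hlead := (hM₁ G M₂ hM₂0 (by rw [hGv]; exact hGb) x).1
  have hL := hH.L_pair hfc hA (x := x) (X := X) ?_
  · have hS := scale_pos (D := D) f A ht
    have hSc : ((D.scale f A t : ℝ) : ℂ) ≠ 0 := by exact_mod_cast hS.ne'
    rw [hL, nmom, hK.mom_eq_sg_add_duhamel hk1 hfm hfR hR hAn (hA.le.trans hk) ht x]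
    have e1 : ∀ a b c d : ℂ, ((D.scale f A t : ℝ) : ℂ)⁻¹ * (a + b) - d * (D.lead G).1 x =
        ((D.scale f A t : ℝ) : ℂ)⁻¹ * a + (((D.scale f A t : ℝ) : ℂ)⁻¹ *
          (b - ((D.scale f A t : ℝ) : ℂ) * (c * (D.lead G).1 x)) + (c - d) * (D.lead G).1 x) := by
      intro a b c d
      field_simp
      ring
    rw [e1 _ _ (betaInt θ m n t)]
    refine (norm_add_le _ _).trans (add_le_add ?_ ((norm_add_le _ _).trans (add_le_add ?_ ?_)))
    · rw [norm_mul, norm_inv, Complex.norm_real, Real.norm_of_nonneg hS.le, inv_mul_le_iff₀ hS]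
      exact hfirst
    · rw [norm_mul, norm_inv, Complex.norm_real, Real.norm_of_nonneg hS.le, inv_mul_le_iff₀ hS]
      exact hduh
    · rw [norm_mul]
      have := hε₃.nonneg t
      calc _ ≤ ε₃ t * (M₁ * M₂) := by gcongr
        _ = _ := by ring
  · exact branching_pair_mem hK hk (fun i => D.Φ₂ (D.ν (f i)) 1 (D.star (f i))) hA

end Spectrum

end BMP

namespace BMP

theorem tendsto_one_add_pow_mul_exp_neg (n : ℕ) {δ : ℝ} (hδ : 0 < δ) :
    Tendsto (fun t : ℝ => (1 + t) ^ n * Real.exp (-δ * t)) atTop (𝓝 0) := by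
  have h1 := ((tendsto_pow_mul_exp_neg n hδ).comp
    (tendsto_atTop_add_const_left _ (1 : ℝ) tendsto_id)).mul_const (Real.exp δ)
  rw [zero_mul] at h1
  refine h1.congr fun t => ?_
  simp only [Function.comp_apply, id_eq]
  rw [mul_assoc, ← Real.exp_add]
  congr 2
  ring

theorem integrableOn_exp_neg_mul_one_add_pow {a : ℝ} (ha : 0 < a) (m : ℕ) :
    IntegrableOn (fun s : ℝ => Real.exp (-a * s) * (1 + s) ^ m) (Set.Ioi 0) := by
  refine integrable_of_isBigO_exp_neg (b := a / 2) (by positivity) (by fun_prop) ?_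
  have h1 : Tendsto (fun s : ℝ => (1 + s) ^ m * Real.exp (-(a / 2) * s)) atTop (𝓝 0) :=
    tendsto_one_add_pow_mul_exp_neg m (by positivity)
  have h2 := (h1.isBigO_one ℝ).mul (Asymptotics.isBigO_refl (fun s => Real.exp (-(a / 2) * s)) atTop)
  refine (h2.congr (fun s => ?_) fun s => one_mul _)
  rw [mul_assoc, ← Real.exp_add, mul_comm]
  congr 2
  ring

namespace Spectrum

variable {E : Type u} [MeasurableSpace E] {D : Spectrum E} {X : Data.{u, v} E} {k : ℕ} {K : NNReal}
  {ι : Type} {f : ι → BddFun E}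

/-! ### Moments of higher order -/

/-- Uniform convergence of the normalised moments makes them, and their limits, bounded and
measurable. -/
theorem LimitRate.exists_bound (hK : X.MomentBound k K) (hk : 1 ≤ k) {n : ℕ} (hn : n ≤ k) {R : ℝ}
    (hR : 0 ≤ R) (h : LimitRate D X ι n R) : ∃ C : ℝ, 0 ≤ C ∧ ∀ f : ι → BddFun E,
      (∀ i, f i ∈ D.EiCrit ∧ ∀ y, ‖(f i).1 y‖ ≤ R) → ∀ A : Finset ι, A.card = n →
      Measurable (D.L X f A) ∧ (∀ x, ‖D.L X f A x‖ ≤ C) ∧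
      ∀ t, 0 ≤ t → ∀ x, ‖nmom D X f A t x‖ ≤ C := by
  obtain ⟨ε, hε, h⟩ := h
  obtain ⟨M, hM0, hM⟩ := hK.exists_norm_mom_le hk 0 hR
  have hε0 := hε.nonneg 0
  refine ⟨M + 2 * ε 0, by positivity, fun f hf A hA => ?_⟩
  have h0 : ∀ x, ‖nmom D X f A 0 x‖ ≤ M := by
    intro x
    have hs : D.scale f A 0 = 1 := by simp [scale_eq f A le_rfl]
    rw [nmom, hs, Complex.ofReal_one, inv_one, one_mul]
    exact hM ι _ (fun i => (hf i).2) A (hA.le.trans hn) 0 le_rfl x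
  have h1 : ∀ x, ‖D.L X f A x‖ ≤ M + ε 0 := by
    intro x
    have h2 := h f hf A hA 0 le_rfl x
    have h3 := norm_sub_norm_le (D.L X f A x) (nmom D X f A 0 x)
    rw [norm_sub_rev] at h3
    linarith [h0 x]
  refine ⟨?_, fun x => (h1 x).trans (by linarith), fun t ht x => ?_⟩
  · refine measurable_of_tendsto_metrizable (f := fun (j : ℕ) x => nmom D X f A j x)
      (fun j => ?_) (tendsto_pi_nhds.2 fun x => ?_)
    · have h2 := (Data.measurable_mom (X := X) (f := fun i => (f i).1)
        (fun i => (f i).2.1) A).comp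
        (measurable_const.prodMk measurable_id : Measurable fun y : E => ((j : ℝ), y))
      exact measurable_const.mul h2
    · rw [tendsto_iff_norm_sub_tendsto_zero]
      exact squeeze_zero (fun _ => norm_nonneg _) (fun j => h f hf A hA j (Nat.cast_nonneg j) x)
        (hε.lim.comp tendsto_natCast_atTop_atTop)
  · have h2 := h f hf A hA t ht x
    have h3 := norm_sub_norm_le (nmom D X f A t x) (D.L X f A x)
    linarith [h1 x, hε.le_zero ht]

/-- The order of growth of the product moments, relative to that at a later time. -/
theorem scale_sub (f : ι → BddFun E) (A : Finset ι) {s t : ℝ} (hs : 0 ≤ s) (hst : s ≤ t) :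
    D.scale f A (t - s) = D.scale f A t * (Real.exp (-(D.lam1 * A.card * s / 2)) *
      ((1 + (t - s)) / (1 + t)) ^ ((D.pTilde f A : ℝ) + A.card * ((D.p1 : ℝ) - 2) / 2)) := by
  have hpos : 0 < 1 + t := by linarith
  have hpos' : 0 < 1 + (t - s) := by linarith
  rw [scale_eq f A (by linarith), scale_eq f A (by linarith), Real.div_rpow hpos'.le hpos.le]
  have h1 := (Real.rpow_pos_of_pos hpos
    ((D.pTilde f A : ℝ) + A.card * ((D.p1 : ℝ) - 2) / 2)).ne'
  have h2 : Real.exp (A.card * D.lam1 * (t - s) / 2) =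
      Real.exp (A.card * D.lam1 * t / 2) * Real.exp (-(D.lam1 * A.card * s / 2)) := by
    rw [← Real.exp_add]
    congr 1
    ring
  rw [h2]
  field_simp

/-- The exponent of the polynomial factor is nonnegative, although `(p_1 - 2) / 2` may be
negative, because `p(f_i) ≥ 1`; it is bounded uniformly in the functions. -/
theorem scale_exponent_bounds (hH : D.H1 X) (hf : ∀ i, f i ∈ D.EiCrit) (A : Finset ι) :
    0 ≤ (D.pTilde f A : ℝ) + A.card * ((D.p1 : ℝ) - 2) / 2 ∧
    (D.pTilde f A : ℝ) + A.card * ((D.p1 : ℝ) - 2) / 2 ≤ ((A.card * (D.height + D.p1) : ℕ) : ℝ) := by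
  have h1 : (1 : ℝ) ≤ D.p1 := by exact_mod_cast hH.p_pos 0
  have h2 : (A.card : ℝ) ≤ D.pTilde f A := by
    have := Finset.card_nsmul_le_sum A (fun i => D.pOf (f i)) 1 fun i _ => (hH.pOf_spec (hf i)).1
    rw [smul_eq_mul, mul_one] at this
    exact_mod_cast this
  have h3 : (D.pTilde f A : ℝ) ≤ A.card * D.height := by
    have := Finset.sum_le_card_nsmul A (fun i => D.pOf (f i)) D.height
      fun i _ => (hH.pOf_spec (hf i)).2.1
    rw [smul_eq_mul] at this
    exact_mod_cast this
  have h4 : (0 : ℝ) ≤ A.card := Nat.cast_nonneg _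
  constructor
  · nlinarith
  · push_cast
    nlinarith

variable (D) in
/-- An integrable bound for the integrands of the limits of order at least three. -/
def decay (s : ℝ) : ℝ := Real.exp (-(D.lam1 / 2) * s) * (1 + s) ^ (D.p1 - 1)

theorem decay_nonneg {s : ℝ} (hs : 0 ≤ s) : 0 ≤ D.decay s := by
  unfold decay
  positivity

/-- In the order `n ≥ 3`, the normalisation `exp (n λ_1 s / 2)` exceeds the growth `exp (λ_1 s)`
of the semigroup by a factor of at least `exp (λ_1 s / 2)`. -/
theorem exp_mul_le_decay (hH : D.H1 X) {n : ℕ} (hn : 3 ≤ n) {s : ℝ} (hs : 0 ≤ s) :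
    Real.exp (-(D.lam1 * n * s / 2)) * (Real.exp (D.lam1 * s) * (1 + s) ^ (D.p1 - 1)) ≤
      D.decay s := by
  have h1 := hH.lam1_pos
  have h2 : (3 : ℝ) ≤ n := by exact_mod_cast hn
  rw [← mul_assoc, ← Real.exp_add, decay]
  refine mul_le_mul_of_nonneg_right (Real.exp_le_exp.2 ?_) (by positivity)
  nlinarith [mul_nonneg h1.le hs]

theorem integrableOn_decay (hH : D.H1 X) : IntegrableOn D.decay (Set.Ioi 0) :=
  integrableOn_exp_neg_mul_one_add_pow (half_pos hH.lam1_pos) _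

theorem exists_rate_decay (hH : D.H1 X) : ∃ ε, IsRate ε ∧ ∀ t, 0 ≤ t → D.decay t ≤ ε t := by
  refine exists_isRate_of_tendsto (Continuous.continuousOn (by unfold decay; fun_prop)) ?_
  have := tendsto_one_add_pow_mul_exp_neg (D.p1 - 1) (half_pos hH.lam1_pos)
  exact this.congr fun t => mul_comm _ _

theorem measurable_sg_fixed {h : E → ℂ} (hh : Measurable h) (x : E) :
    Measurable fun s => X.sg s h x :=
  Data.measurable_sg_comp (X := X) (g := fun _ => h) (a := fun s => s) (b := fun _ => 0)
    (y := fun _ => x) (hh.comp measurable_snd) measurable_id measurable_const measurable_const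

/-- The integrals that define the limits converge absolutely. -/
theorem H1.integrableOn_exp_mul_sg (hH : D.H1 X) (hK : X.MomentBound k K) (hk : 1 ≤ k) {n : ℕ}
    (hn : 3 ≤ n) {h : E → ℂ} (hh : h ∈ BddFun E) (x : E) :
    IntegrableOn (fun s => (Real.exp (-(D.lam1 * n * s / 2)) : ℂ) * X.sg s h x) (Set.Ioi 0) := by
  obtain ⟨_, _, M, hM0, hM⟩ := hH.exists_rate_lead hK hk
  obtain ⟨R, hR⟩ := hh.2
  refine ((integrableOn_decay hH).mul_const (M * |R|)).mono'
    (Measurable.aestronglyMeasurable (Measurable.mul (by fun_prop)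
      (measurable_sg_fixed hh.1 x))) ?_
  filter_upwards [ae_restrict_mem measurableSet_Ioi] with s hs
  have hs0 : 0 ≤ s := (Set.mem_Ioi.1 hs).le
  have h1 := ((hM ⟨h, hh⟩ |R| (abs_nonneg R) (fun y => (hR y).trans (le_abs_self R)) x).2 s hs0).2
  rw [norm_mul, Complex.norm_real, Real.norm_of_nonneg (Real.exp_pos _).le]
  calc _ ≤ Real.exp (-(D.lam1 * n * s / 2)) *
      (Real.exp (D.lam1 * s) * (1 + s) ^ (D.p1 - 1) * (M * |R|)) := by gcongr
    _ = Real.exp (-(D.lam1 * n * s / 2)) * (Real.exp (D.lam1 * s) * (1 + s) ^ (D.p1 - 1)) *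
      (M * |R|) := by ring
    _ ≤ _ := by
      have := exp_mul_le_decay hH hn hs0
      gcongr

open Classical in
/-- For index sets that are not conjugate, the integral vanishes with the branching term. -/
theorem L_eq_integral (hK : X.MomentBound k K) (hk : 1 ≤ k) (f : ι → BddFun E) {A : Finset ι}
    (hA : 3 ≤ A.card) (x : E) : D.L X f A x = ∫ s in Set.Ioi (0 : ℝ),
      (Real.exp (-(D.lam1 * A.card * s / 2)) : ℂ) * X.sg s (X.branching A (D.L X f)) x := by
  rw [L, if_neg (by omega)]
  by_cases h : Even A.card ∧ D.IsConjugateTuple f A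
  · have h4 : 4 ≤ A.card := by
      obtain ⟨j, hj⟩ := h.1
      omega
    rw [if_pos ⟨h4, h.1, h.2⟩]
    refine setIntegral_congr_fun measurableSet_Ioi fun s hs => ?_
    have e1 : X.branching A (fun B y => if _h : B ⊂ A then D.L X f B y else 0) =
        X.branching A (D.L X f) :=
      Data.branching_congr fun B _ hB => funext fun y => dif_pos hB
    have e2 := hK.ψ_eq hk (Set.mem_Ioi.1 hs).le (X.branching A (D.L X f)) x
    rw [← e2, ← e1]
    rfl
  · rw [if_neg fun h' => h h'.2, branching_L_eq_zero h]
    have : ∀ s, X.sg s (fun _ => 0) x = 0 := fun s => by simp [Data.sg, pairing]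
    simp [this]

end Spectrum

end BMP

namespace BMP

namespace Spectrum

variable {E : Type u} [MeasurableSpace E] {D : Spectrum E} {X : Data.{u, v} E} {k : ℕ} {K : NNReal}
  {ι : Type} {f : ι → BddFun E}

open Classical in
/-- The branching term of the normalised moments converges, if the normalised moments of all lower
orders do. -/
theorem exists_rate_branching [Fintype ι] (hK : X.MomentBound k K) (hk : 1 ≤ k) {R : ℝ}
    (hR : 0 ≤ R) {n : ℕ} (hn : 1 ≤ n) (hnk : n ≤ k)
    (h : ∀ j, 1 ≤ j → j < n → LimitRate D X ι j R) : ∃ ε, IsRate ε ∧ ∃ C : ℝ, 0 ≤ C ∧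
      ∀ f : ι → BddFun E, (∀ i, f i ∈ D.EiCrit ∧ ∀ y, ‖(f i).1 y‖ ≤ R) →
      ∀ A : Finset ι, A.card = n →
      X.branching A (D.L X f) ∈ BddFun E ∧ (∀ y, ‖X.branching A (D.L X f) y‖ ≤ C) ∧
      ∀ r : ℝ, 0 ≤ r → X.branching A (fun B => nmom D X f B r) ∈ BddFun E ∧
        (∀ y, ‖X.branching A (fun B => nmom D X f B r) y‖ ≤ C) ∧
        ∀ y, ‖X.branching A (fun B => nmom D X f B r) y - X.branching A (D.L X f) y‖ ≤ ε r := by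
  choose! C hC0 hC using fun j (hj : 1 ≤ j ∧ j < n) =>
    (h j hj.1 hj.2).exists_bound hK hk (by omega) hR
  choose! e he hlim using h
  set C' : ℝ := max 1 (∑ j ∈ Finset.Ico 1 n, C j) with hC'
  have hC1 : 1 ≤ C' := le_max_left _ _
  have hCle : ∀ j, 1 ≤ j → j < n → C j ≤ C' := fun j h1 h2 =>
    (Finset.single_le_sum (f := C) (fun i hi => hC0 i (Finset.mem_Ico.1 hi))
      (Finset.mem_Ico.2 ⟨h1, h2⟩)).trans (le_max_right _ _)
  set ε : ℝ → ℝ := fun t => ∑ j ∈ Finset.Ico 1 n, e j t with hεdef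
  have hε : IsRate ε := IsRate.sum _ fun j hj =>
    he j (Finset.mem_Ico.1 hj).1 (Finset.mem_Ico.1 hj).2
  have hεle : ∀ j, 1 ≤ j → j < n → ∀ t, e j t ≤ ε t := fun j h1 h2 t =>
    Finset.single_le_sum (f := fun j => e j t)
      (fun i hi => (he i (Finset.mem_Ico.1 hi).1 (Finset.mem_Ico.1 hi).2).nonneg t)
      (Finset.mem_Ico.2 ⟨h1, h2⟩)
  set NP : ℕ := ∑ A : Finset ι, numPartitions A with hNP
  have hNPle : ∀ A : Finset ι, (numPartitions A : ℝ) ≤ NP := fun A => by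
    exact_mod_cast Finset.single_le_sum (f := fun A : Finset ι => numPartitions A)
      (fun _ _ => Nat.zero_le _) (Finset.mem_univ A)
  have hrb := X.rateBound_nonneg
  refine ⟨fun r => X.rateBound * (NP * (k * C' ^ k) * K) * ε r, hε.const_mul (by positivity),
    X.rateBound * (NP * (k * C' ^ k * C') * K), by positivity, fun f hf A hA => ?_⟩
  have hAn : A.Nonempty := Finset.card_pos.1 (by omega)
  have hAk : A.card ≤ k := hA.le.trans hnk
  have hcard : ∀ B : Finset ι, B.Nonempty → B ⊂ A → 1 ≤ B.card ∧ B.card < n := fun B hB hBA =>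
    ⟨hB.card_pos, hA ▸ Finset.card_lt_card hBA⟩
  have hmem : ∀ g : Finset ι → E → ℂ, (∀ B, B.Nonempty → B ⊂ A → Measurable (g B)) →
      (∀ B, B.Nonempty → B ⊂ A → ∀ y, ‖g B y‖ ≤ C') → X.branching A g ∈ BddFun E ∧
      ∀ y, ‖X.branching A g y‖ ≤ X.rateBound * (NP * (k * C' ^ k * C') * K) := by
    intro g hgm hg
    have h1 : ∀ y, ‖X.branching A g y‖ ≤ X.rateBound * (NP * (k * C' ^ k * C') * K) := fun y =>
      (hK.norm_branching_le hAn hAk hC1 hg y).trans (by have := hNPle A; gcongr)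
    refine ⟨⟨?_, _, h1⟩, h1⟩
    have h2 := (Data.measurable_branching (X := X) (A := A) (T := Unit) (g := fun _ => g)
      fun B hB hBA => (hgm B hB hBA).comp measurable_snd).comp
      (measurable_const.prodMk measurable_id : Measurable fun y : E => ((), y))
    exact h2
  have hLm : ∀ B, B.Nonempty → B ⊂ A → Measurable (D.L X f B) := fun B hB hBA =>
    (hC _ (hcard B hB hBA) f hf B rfl).1
  have hLb : ∀ B, B.Nonempty → B ⊂ A → ∀ y, ‖D.L X f B y‖ ≤ C' := fun B hB hBA y =>
    ((hC _ (hcard B hB hBA) f hf B rfl).2.1 y).trans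
      (hCle _ (hcard B hB hBA).1 (hcard B hB hBA).2)
  obtain ⟨hL1, hL2⟩ := hmem _ hLm hLb
  refine ⟨hL1, hL2, fun r hr => ?_⟩
  have hnm : ∀ B, B.Nonempty → B ⊂ A → Measurable (nmom D X f B r) := fun B _ _ => by
    have h2 := (Data.measurable_mom (X := X) (f := fun i => (f i).1)
      (fun i => (f i).2.1) B).comp
      (measurable_const.prodMk measurable_id : Measurable fun y : E => (r, y))
    exact measurable_const.mul h2
  have hnb : ∀ B, B.Nonempty → B ⊂ A → ∀ y, ‖nmom D X f B r y‖ ≤ C' := fun B hB hBA y =>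
    ((hC _ (hcard B hB hBA) f hf B rfl).2.2 r hr y).trans
      (hCle _ (hcard B hB hBA).1 (hcard B hB hBA).2)
  obtain ⟨h1, h2⟩ := hmem _ hnm hnb
  refine ⟨h1, h2, fun y => ?_⟩
  have h3 := hK.norm_branching_sub_le hAn hAk hC1 (hε.nonneg r) hnm hLm hnb hLb
    (fun B hB hBA y => (hlim _ (hcard B hB hBA).1 (hcard B hB hBA).2 f hf B rfl r hr y).trans
      (hεle _ (hcard B hB hBA).1 (hcard B hB hBA).2 r)) y
  refine h3.trans ?_
  have := hNPle A
  have := hε.nonneg r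
  calc _ ≤ X.rateBound * (NP * (k * C' ^ k * ε r) * K) := by gcongr
    _ = _ := by ring

/-- A bound on the change of the polynomial factor that does not depend on the exponent. -/
theorem abs_rpow_sub_one_le {u e : ℝ} (hu : 0 < u) (hu1 : u ≤ 1) (he : 0 ≤ e) {N : ℕ}
    (heN : e ≤ N) : u ^ e ≤ 1 ∧ |u ^ e - 1| ≤ 1 - u ^ N := by
  have h1 := Real.rpow_le_one hu.le hu1 he
  have h2 := Real.rpow_le_rpow_of_exponent_ge hu hu1 heN
  rw [Real.rpow_natCast] at h2
  refine ⟨h1, ?_⟩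
  rw [abs_sub_comm, abs_of_nonneg (by linarith)]
  linarith

open Classical in
/-- From the third order on, the normalisation outgrows the semigroup, so that branching events at
late times do not contribute, and the limit follows by dominated convergence. -/
theorem H1.limitRate_of_lt [Fintype ι] (hH : D.H1 X) (hK : X.MomentBound k K) (hk : 1 ≤ k) {R : ℝ}
    (hR : 0 ≤ R) {n : ℕ} (hn : 3 ≤ n) (hnk : n ≤ k)
    (h : ∀ j, 1 ≤ j → j < n → LimitRate D X ι j R) : LimitRate D X ι n R := by
  obtain ⟨_, _, M, hM0, hM⟩ := hH.exists_rate_lead hK hk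
  obtain ⟨ε, hε, C, hC0, hC⟩ := exists_rate_branching hK hk hR (by omega) hnk h
  obtain ⟨ε₁, hε₁, h₁⟩ := exists_rate_decay hH
  set N : ℕ := n * (D.height + D.p1) with hN
  obtain ⟨ε₂, hε₂, h₂⟩ := exists_rate_conv hε N (integrableOn_decay hH)
    fun s hs => decay_nonneg hs.le
  refine ⟨fun t => M * R ^ n * ε₁ t + M * (C + 1) * ε₂ t,
    (hε₁.const_mul (by positivity)).add (hε₂.const_mul (by positivity)),
    fun f hf A hA t ht x => ?_⟩
  have hAn : A.Nonempty := Finset.card_pos.1 (by omega)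
  have hAk : A.card ≤ k := hA.le.trans hnk
  have hfm : ∀ i, Measurable (f i).1 := fun i => (f i).2.1
  have hfR : ∀ i y, ‖(f i).1 y‖ ≤ R := fun i => (hf i).2
  obtain ⟨hLm, hLb, hbr⟩ := hC f hf A hA
  set bL : E → ℂ := X.branching A (D.L X f) with hbL
  set b : ℝ → E → ℂ := fun r => X.branching A fun B => nmom D X f B r with hb
  set g : ℝ → E → ℂ := fun r => X.branching A fun B => X.mom (fun i => (f i).1) B r with hg
  set S : ℝ → ℝ := fun r => D.scale f A r with hS
  set e : ℝ := (D.pTilde f A : ℝ) + A.card * ((D.p1 : ℝ) - 2) / 2 with he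
  obtain ⟨he0, heN⟩ := scale_exponent_bounds hH (fun i => (hf i).1) A
  rw [← he] at he0 heN
  have hpos : 0 < 1 + t := by linarith
  have hSt : 0 < S t := scale_pos f A ht
  have hStc : ((S t : ℝ) : ℂ) ≠ 0 := by exact_mod_cast hSt.ne'
  -- by homogeneity of `ζ_A`, the normalisation can be taken out of the branching term
  have hgb : ∀ r, 0 ≤ r → g r = fun y => ((S r : ℝ) : ℂ) * b r y := by
    intro r hr
    funext y
    have hSr : ((S r : ℝ) : ℂ) = ∏ i ∈ A, ((D.weight f r i : ℝ) : ℂ) := by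
      rw [← Complex.ofReal_prod]
      rfl
    simp only [hg, hb]
    rw [hSr, ← Data.branching_mul]
    congr 1
    funext B z
    have h3 : ((D.scale f B r : ℝ) : ℂ) ≠ 0 := by exact_mod_cast (scale_pos f B hr).ne'
    rw [nmom, ← Complex.ofReal_prod]
    change _ = ((D.scale f B r : ℝ) : ℂ) * _
    rw [mul_inv_cancel_left₀ h3]
  -- the semigroup, normalised
  have hsg : ∀ (φ : E → ℂ) (Q : ℝ), φ ∈ BddFun E → 0 ≤ Q → (∀ y, ‖φ y‖ ≤ Q) → ∀ s, 0 ≤ s →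
      Real.exp (-(D.lam1 * A.card * s / 2)) * ‖X.sg s φ x‖ ≤ D.decay s * (M * Q) := by
    intro φ Q hφ hQ0 hQ s hs
    have h3 := ((hM ⟨φ, hφ⟩ Q hQ0 hQ x).2 s hs).2
    calc _ ≤ Real.exp (-(D.lam1 * A.card * s / 2)) *
        (Real.exp (D.lam1 * s) * (1 + s) ^ (D.p1 - 1) * (M * Q)) := by gcongr
      _ = Real.exp (-(D.lam1 * A.card * s / 2)) *
        (Real.exp (D.lam1 * s) * (1 + s) ^ (D.p1 - 1)) * (M * Q) := by ring
      _ ≤ _ := by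
        have := exp_mul_le_decay hH (hn.trans hA.ge) hs
        gcongr
  -- the normalised convolution and its limit, as integrals over all `s > 0`
  set F : ℝ → ℂ := (Set.Ioc 0 t).indicator fun s => ((S t : ℝ) : ℂ)⁻¹ * X.sg s (g (t - s)) x with hF
  set F' : ℝ → ℂ := fun s => (Real.exp (-(D.lam1 * A.card * s / 2)) : ℂ) * X.sg s bL x with hF'
  obtain ⟨B₀, hB₀, hB₀g⟩ := hK.exists_norm_branching_mom_le hk t hfR hR hAn hAk
  have hint : IntegrableOn (fun s => X.sg s (g (t - s)) x) (Set.Ioc 0 t) :=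
    hK.integrableOn_sg hk (g := g) (Data.measurable_branching_mom hfm A) hB₀ hB₀g le_rfl x
  have hFint : IntegrableOn F (Set.Ioi 0) := by
    have h3 : IntegrableOn (fun s => ((S t : ℝ) : ℂ)⁻¹ * X.sg s (g (t - s)) x) (Set.Ioc 0 t) :=
      hint.const_mul _
    exact ((integrable_indicator_iff measurableSet_Ioc).2 h3).integrableOn
  have hF'int : IntegrableOn F' (Set.Ioi 0) :=
    hH.integrableOn_exp_mul_sg hK hk (hn.trans hA.ge) hLm x
  have hduh : ((S t : ℝ) : ℂ)⁻¹ * X.duhamel g t x = ∫ s in Set.Ioi 0, F s := by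
    rw [Data.duhamel, ← integral_const_mul, setIntegral_indicator measurableSet_Ioc,
      Set.inter_eq_right.2 Set.Ioc_subset_Ioi_self]
  have hdiff : ∀ s ∈ Set.Ioi (0 : ℝ),
      ‖F s - F' s‖ ≤ M * (C + 1) * (D.decay s * convWeight ε N t s) := by
    intro s hs
    have hs0 : 0 ≤ s := (Set.mem_Ioi.1 hs).le
    have hd := decay_nonneg (D := D) hs0
    have h3 := hsg bL C hLm hC0 hLb s hs0
    by_cases hst : s ≤ t
    · have hr : 0 ≤ t - s := by linarith
      obtain ⟨hbm, hbb, hbd⟩ := hbr (t - s) hr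
      have hu0 : 0 < (1 + (t - s)) / (1 + t) := div_pos (by linarith) hpos
      have hu1 : (1 + (t - s)) / (1 + t) ≤ 1 := by
        rw [div_le_one hpos]
        linarith
      rw [hA, ← hN] at heN
      obtain ⟨hr1, hr2⟩ := abs_rpow_sub_one_le hu0 hu1 he0 heN
      have hr0 := (Real.rpow_pos_of_pos hu0 e).le
      -- two errors: that of the branching term, and that of the polynomial factor
      have hFs : F s - F' s =
          ((((1 + (t - s)) / (1 + t)) ^ e : ℝ) : ℂ) * ((Real.exp (-(D.lam1 * A.card * s / 2)) : ℂ) *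
            X.sg s (fun y => b (t - s) y - bL y) x) +
          (((((1 + (t - s)) / (1 + t)) ^ e - 1 : ℝ)) : ℂ) * F' s := by
        have h4 : S (t - s) = S t * (Real.exp (-(D.lam1 * A.card * s / 2)) *
          ((1 + (t - s)) / (1 + t)) ^ e) := scale_sub f A hs0 hst
        rw [hK.sg_sub hk hbm hLm, hF', hF, Set.indicator_of_mem (Set.mem_Ioc.2 ⟨hs, hst⟩),
          hgb _ hr, Data.sg_const_mul, h4]
        push_cast
        field_simp
        ring
      have h5 := hsg (fun y => b (t - s) y - bL y) (ε (t - s)) ((BddFun E).sub_mem hbm hLm)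
        (hε.nonneg _) hbd s hs0
      have h6 := hε.nonneg (t - s)
      have h7 : 0 ≤ 1 - ((1 + (t - s)) / (1 + t)) ^ N := (abs_nonneg _).trans hr2
      rw [hFs, convWeight, if_pos hst]
      refine (norm_add_le _ _).trans ?_
      rw [norm_mul, norm_mul, norm_mul, norm_mul (Complex.ofReal _) (X.sg s bL x),
        Complex.norm_real, Complex.norm_real, Complex.norm_real, Real.norm_of_nonneg hr0,
        Real.norm_eq_abs (_ - 1), Real.norm_of_nonneg (Real.exp_pos _).le]
      calc _ ≤ 1 * (D.decay s * (M * ε (t - s))) +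
            (1 - ((1 + (t - s)) / (1 + t)) ^ N) * (D.decay s * (M * C)) := by gcongr
        _ = M * (1 * (D.decay s * ε (t - s)) +
            C * (D.decay s * (1 - ((1 + (t - s)) / (1 + t)) ^ N))) := by ring
        _ ≤ M * ((C + 1) * (D.decay s * ε (t - s)) +
            (C + 1) * (D.decay s * (1 - ((1 + (t - s)) / (1 + t)) ^ N))) := by
            gcongr <;> linarith
        _ = _ := by ring
    · rw [hF, Set.indicator_of_notMem fun h' => hst h'.2, zero_sub, norm_neg, norm_mul,
        Complex.norm_real, Real.norm_of_nonneg (Real.exp_pos _).le, convWeight, if_neg hst]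
      calc _ ≤ _ := h3
        _ ≤ D.decay s * (M * (C + 1)) := by gcongr; linarith
        _ = _ := by ring
  obtain ⟨hci, hcle⟩ := h₂ t ht
  have hmain : ‖((S t : ℝ) : ℂ)⁻¹ * X.duhamel g t x - D.L X f A x‖ ≤ M * (C + 1) * ε₂ t := by
    rw [hduh, L_eq_integral hK hk f (hn.trans hA.ge) x, ← integral_sub hFint hF'int]
    refine (norm_integral_le_of_norm_le (hci.const_mul (M * (C + 1))) ?_).trans ?_
    · filter_upwards [ae_restrict_mem measurableSet_Ioi] with s hs using hdiff s hs
    · rw [integral_const_mul]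
      gcongr
  -- the contribution of a common particle
  obtain ⟨hprod, hprodR⟩ := Data.prod_mem_bddFun hfm hfR A
  have hfirst : ‖((S t : ℝ) : ℂ)⁻¹ * X.sg t (fun y => ∏ i ∈ A, (f i).1 y) x‖ ≤
      M * R ^ n * ε₁ t := by
    have h3 := hsg _ (R ^ A.card) hprod (by positivity) hprodR t ht
    have h4 : (S t)⁻¹ ≤ Real.exp (-(D.lam1 * A.card * t / 2)) := by
      rw [Real.exp_neg]
      refine inv_anti₀ (Real.exp_pos _) ?_
      have h5 : S t = Real.exp (A.card * D.lam1 * t / 2) * (1 + t) ^ e := scale_eq f A ht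
      rw [h5, mul_comm (A.card : ℝ)]
      exact le_mul_of_one_le_right (Real.exp_pos _).le (Real.one_le_rpow (by linarith) he0)
    rw [norm_mul, norm_inv, Complex.norm_real, Real.norm_of_nonneg hSt.le]
    calc _ ≤ Real.exp (-(D.lam1 * A.card * t / 2)) *
          ‖X.sg t (fun y => ∏ i ∈ A, (f i).1 y) x‖ := by gcongr
      _ ≤ _ := h3
      _ ≤ ε₁ t * (M * R ^ n) := by
        rw [hA]
        have := h₁ t ht
        gcongr
      _ = _ := by ring
  rw [nmom, hK.mom_eq_sg_add_duhamel hk hfm hfR hR hAn hAk ht x, mul_add, add_sub_assoc]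
  exact (norm_add_le _ _).trans (add_le_add hfirst hmain)

/-- The normalised moments of all orders converge uniformly. -/
theorem H1.limitRate [Fintype ι] (hH : D.H1 X) (hK : X.MomentBound k K) {R : ℝ} (hR : 0 ≤ R)
    (n : ℕ) (hn : 1 ≤ n) (hnk : n ≤ k) : LimitRate D X ι n R := by
  induction n using Nat.strong_induction_on with
  | _ n ih =>
    rcases (show n = 1 ∨ n = 2 ∨ 3 ≤ n by omega) with rfl | rfl | h3
    · exact hH.limitRate_one hK hnk hR
    · exact hH.limitRate_two hK hnk hR
    · exact hH.limitRate_of_lt hK (hn.trans hnk) hR h3 hnk fun j hj hjn => ih j hjn hj (by omega)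

end Spectrum

end BMP

namespace BMP

namespace Spectrum

variable {E : Type u} [MeasurableSpace E] {D : Spectrum E} {X : Data.{u, v} E} {k : ℕ} {K : NNReal}

/-! ### Conclusion -/

/-- A common bound for finitely many bounded functions. -/
theorem exists_common_bound {ι : Type} [Fintype ι] (f : ι → BddFun E) :
    ∃ C : ℝ, 0 ≤ C ∧ ∀ i y, ‖(f i).1 y‖ ≤ C := by
  choose C hC using fun i => (f i).2.2
  refine ⟨∑ i, |C i|, Finset.sum_nonneg fun _ _ => abs_nonneg _, fun i y => ?_⟩
  exact ((hC i y).trans (le_abs_self _)).trans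
    (Finset.single_le_sum (f := fun i => |C i|) (fun _ _ => abs_nonneg _) (Finset.mem_univ i))

theorem integrable_prod_integral (hK : X.MomentBound k K) (hk : 1 ≤ k) {ℓ : ℕ} (hℓk : ℓ ≤ k) {t : ℝ}
    (ht : 0 ≤ t) (x : E) (f : Fin ℓ → BddFun E) :
    Integrable (fun μ : Measure E => ∏ i, ∫ y, (f i).1 y ∂μ) (X.law t x) := by
  obtain ⟨C, hC0, hC⟩ := exists_common_bound f
  rw [X.law_eq ht]
  refine (hK.integrable_prod_pairing hk (fun i => (f i).2.1) hC hC0 (A := Finset.univ)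
    (by simpa using hℓk) t x).congr ?_
  filter_upwards [hK.ae_isFiniteMeasure hk t x] with μ hμ
  exact Finset.prod_congr rfl fun i _ => pairing_eq _ μ

theorem H1.integrableOn_limit (hH : D.H1 X) (hK : X.MomentBound k K) {ℓ : ℕ} (hℓk : ℓ ≤ k)
    (f : Fin ℓ → BddFun E) (hf : ∀ i, f i ∈ D.EiCrit) {A : Finset (Fin ℓ)} (hA : 3 ≤ A.card)
    (x : E) : IntegrableOn (fun s : ℝ => (Real.exp (-(D.lam1 * A.card * s / 2)) : ℂ) *
      X.ψ s (fun z => (X.γ z : ℂ) * X.ζ A (D.L X f) z) x) (Set.Ioi 0) := by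
  obtain ⟨C, hC0, hC⟩ := exists_common_bound f
  have hAk : A.card ≤ k := (Finset.card_le_univ A).trans (by simpa using hℓk)
  have hk : 1 ≤ k := by omega
  obtain ⟨_, _, _, _, h⟩ := exists_rate_branching hK hk hC0 (n := A.card) (by omega) hAk
    fun j hj hjn => hH.limitRate (ι := Fin ℓ) hK hC0 j hj (by omega)
  refine (hH.integrableOn_exp_mul_sg hK hk hA (h f (fun i => ⟨hf i, hC i⟩) A rfl).1 x).congr_fun
    (fun s hs => ?_) measurableSet_Ioi
  have h1 := hK.ψ_eq hk (Set.mem_Ioi.1 hs).le (X.branching A (D.L X f)) x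
  simp only
  rw [← h1]
  rfl

/-- The rate of convergence of the normalised moments bounds `Δ_{ℓ,t}`, which is the supremum over
the starting point and the functions of norm at most `1`. -/
theorem H1.exists_rate_Δ (hH : D.H1 X) (hK : X.MomentBound k K) {ℓ : ℕ} (hℓ : 1 ≤ ℓ) (hℓk : ℓ ≤ k) :
    ∃ ε, IsRate ε ∧ ∀ t : ℝ, 0 ≤ t → D.Δ X ℓ t ≤ ENNReal.ofReal (ε t) := by
  obtain ⟨ε, hε, h⟩ := hH.limitRate (ι := Fin ℓ) hK zero_le_one ℓ hℓ hℓk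
  refine ⟨ε, hε, fun t ht => iSup_le fun x => iSup_le fun f => iSup_le fun hf => ?_⟩
  have h1 := h f hf Finset.univ (by simp) t ht x
  rw [← ofReal_norm]
  refine ENNReal.ofReal_le_ofReal (le_of_eq_of_le ?_ h1)
  have hpos : 0 < 1 + t := by linarith
  rw [nmom, scale_eq f _ ht, hK.ψProd_eq (hℓ.trans hℓk) ht, Real.rpow_neg hpos.le, Real.exp_neg,
    Finset.card_univ, Fintype.card_fin]
  push_cast
  rw [mul_inv]

end Spectrum

end BMP

end

theorem theorem2p3 {E : Type u} [TopologicalSpace E] [PolishSpace E] [MeasurableSpace E]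
    [BorelSpace E] (X : BMP.Data.{u, v} E) (D : BMP.Spectrum E) (hH1 : D.H1 X)
    (k : ℕ) (hk : 2 ≤ k)
    (hN : (⨆ x, ∫⁻ c : (Σ n : ℕ, (Fin n → E)), (c.1 : ℝ≥0∞) ^ k ∂(X.offspring x)) < ⊤)
    (ℓ : ℕ) (hℓ : 1 ≤ ℓ) (hℓk : ℓ ≤ k) :
    -- the process does not explode, and the moments and the limits are given by convergent integrals
    (∀ t : ℝ, 0 ≤ t → ∀ x, IsProbabilityMeasure (X.law t x) ∧
      ∀ f : Fin ℓ → BMP.BddFun E,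
        Integrable (fun μ : Measure E => ∏ i, ∫ y, (f i).1 y ∂μ) (X.law t x)) ∧
    (∀ f : Fin ℓ → BMP.BddFun E, (∀ i, f i ∈ D.EiCrit) →
      ∀ A : Finset (Fin ℓ), 4 ≤ A.card → Even A.card → ∀ x,
        IntegrableOn (fun s : ℝ => (Real.exp (-(D.lam1 * A.card * s / 2)) : ℂ) *
          X.ψ s (fun z => (X.γ z : ℂ) * X.ζ A (D.L X f) z) x) (Set.Ioi 0)) ∧
    -- the claim on the moments
    (⨆ (t : ℝ) (_ : 0 ≤ t), D.Δ X ℓ t) < ⊤ ∧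
    Tendsto (D.Δ X ℓ) atTop (𝓝 0) := by
  obtain ⟨K, hK⟩ := X.exists_momentBound hN
  have hk1 : 1 ≤ k := by omega
  obtain ⟨ε, hε, hΔ⟩ := hH1.exists_rate_Δ hK hℓ hℓk
  refine ⟨fun t ht x => ⟨?_, fun f => BMP.Spectrum.integrable_prod_integral hK hk1 hℓk ht x f⟩,
    fun f hf A hA _ x => hH1.integrableOn_limit hK hℓk f hf (by omega) x, ?_, ?_⟩
  · rw [X.law_eq ht]
    exact hK.isProbabilityMeasure hk1 ht x
  · refine lt_of_le_of_lt (iSup₂_le fun t ht => (hΔ t ht).trans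
      (ENNReal.ofReal_le_ofReal (hε.le_zero ht))) ENNReal.ofReal_lt_top
  · refine tendsto_of_tendsto_of_tendsto_of_le_of_le' tendsto_const_nhds
      (by simpa using ENNReal.tendsto_ofReal hε.lim) (Eventually.of_forall fun _ => zero_le) ?_
    filter_upwards [eventually_ge_atTop 0] with t ht using hΔ t ht
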